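/- Let $n\ge 1$, $q\ge 0$. Consider the strict-feedback system on $t\ge 0$ $$\dot x_i=\phi_i(\underline x_i)^{\top}\theta(t)+x_{i+1}\ (1\le i\le n-1),\qquad \dot x_n=\phi_n(\underline x_n)^{\top}\theta(t)+b(t)u,$$ with $\underline x_i=(x_1,\dots,x_i)$ and smooth $\phi_i:\mathbb R^i\to\mathbb R^q$, $\phi_i(0)=0$. The functions $\theta:[0,\infty)\to\mathbb R^q$ and $b:[0,\infty)\to\mathbb R$ are unknown and piecewise continuous; $\theta(t)$ stays in an unknown compact set contained in a Euclidean ball of known radius $\delta>0$ with unknown centre; $b(t)$ stays in an unknown compact set $\Omega_b\not\ni 0$ and has constant, unknown sign. Differential equations are required at all times at which $\theta$ and $b$ are continuous, for continuous trajectories. Let $\lambda,\epsilon,k_1,\dots,k_n>0$, let $\Gamma$ be a symmetric positive definite $q\times q$ matrix, and put $\mu=e^{\lambda t}$. With $\alpha_0=0$, $z_0=0$ define recursively, $\alpha_i$ being a function of $(\underline x_i,\hat\theta,\mu)$ and $|\cdot|_{\mathsf F}$ the Frobenius norm, $$z_i=x_i-\alpha_{i-1},\quad s_i=\mu z_i,\quad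 w_i=\phi_i-\sum_{j=1}^{i-1}\frac{\partial\alpha_{i-1}}{\partial x_j}\phi_j,\quad \tau_i=\sum_{j=1}^{i}\mu s_jw_j,$$ $$\zeta_i=\lambda+\tfrac12\Big((n+1-i)\delta+\tfrac1\epsilon+\delta|W_i|_{\mathsf F}^2\Big),$$ $$\alpha_i=-(k_i+\zeta_i)z_i-z_{i-1}-w_i^{\top}\hat\theta+\frac{\partial\alpha_{i-1}}{\partial\hat\theta}\Gamma\tau_i+\sum_{j=2}^{i-1}\frac{\partial\alpha_{j-1}}{\partial\hat\theta}\Gamma\mu s_jw_i+\sum_{j=1}^{i-1}\frac{\partial\alpha_{i-1}}{\partial x_j}x_{j+1}+\frac{\partial\alpha_{i-1}}{\partial\mu}\lambda\mu\quad(1\le i\le n-1),$$ $$\psi=z_{n-1}+w_n^{\top}\hat\theta-\sum_{i=1}^{n-1}\frac{\partial\alpha_{n-1}}{\partial x_i}x_{i+1}-\frac{\partial\alpha_{n-1}}{\partial\hat\theta}\Gamma\tau_n-\frac{\partial\alpha_{n-1}}{\partial\mu}\lambda\mu-\sum_{i=2}^{n-1}\frac{\partial\alpha_{i-1}}{\partial\hat\theta}\Gamma\mu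 s_iw_n,$$ $$\kappa=k_n+\lambda+\tfrac12\Big(\delta(|W_n|_{\mathsf F}^2+1)+\tfrac1\epsilon+\epsilon|\bar\psi|^2\Big),$$ where $W_i(\underline x_i,\hat\theta,\mu)\in\mathbb R^{i\times q}$ and $\bar\psi(\underline x_n,\hat\theta,\mu)\in\mathbb R^n$ are mappings with $w_i=W_i^{\top}(z_1,\dots,z_i)^{\top}$ and $\psi=\bar\psi^{\top}(z_1,\dots,z_n)^{\top}$ for all $\mu>0$ that are smooth and bounded in the sense that they are smooth functions of $\underline x_i$, $\hat\theta$ and $\mu\underline x_i$ (with $i=n$ for $\bar\psi$). Such mappings exist; fix any choice of them. Let $\mathcal N$ be an enhanced Nussbaum function: it is $C^\infty$ on $[0,\infty)$ and, with $\mathcal N^{\pm}=\max\{0,\pm\mathcal N\}$, $$\lim_{\xi\to\infty}\frac1\xi\int_0^\xi\mathcal N^{\pm}=\infty,\qquad \limsup_{\xi\to\infty}\frac{\int_0^\xi\mathcal N^{\pm}}{\int_0^\xi\mathcal N^{\mp}}=\infty .$$ Apply the controller $$u=\mathcal N(\xi)\bar u,\qquad \bar u=\kappa z_n,\qquad \dot\xi=\mu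 s_n\bar u=\kappa s_n^2,\qquad \dot{\hat\theta}=\Gamma\tau_n .$$ Then for all initial values $x(0)\in\mathbb R^n$, $\hat\theta(0)\in\mathbb R^q$, $\xi(0)\ge 0$ the closed loop has a solution on $[0,\infty)$. There is a positive continuous function $N$ of $(x(0),\hat\theta(0),\xi(0))$ such that every solution on an interval $[0,T)$, $0<T\le\infty$, with $\xi(0)\ge 0$ satisfies $$\|x(t)\|\le N\,e^{-\lambda t},\qquad 0\le t<T$$ (this is what global exponential stability of the origin means here). On each such solution all signals are bounded: $x$, $\hat\theta$, $\xi$, $\mathcal N(\xi)$, $u$, $\bar u$, $\kappa$, $\dot\xi$, and all $z_i,s_i,w_i,\tau_i,\alpha_i$. If $T=\infty$, then $\lim_{t\to\infty}\hat\theta(t)$ and $\lim_{t\to\infty}\xi(t)$ exist. -/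

import Mathlib

open scoped Matrix ContDiff Topology

/-! ### General notions -/

/-- Euclidean norm of a coordinate vector. -/
noncomputable def euclNorm {ι : Type} [Fintype ι] (v : ι → ℝ) : ℝ :=
  Real.sqrt (∑ i, v i ^ 2)

/-- Square of the Frobenius norm of a matrix. -/
def frobSq {ι κ : Type} [Fintype ι] [Fintype κ] (M : Matrix ι κ ℝ) : ℝ :=
  ∑ a, ∑ c, M a c ^ 2

/-- Piecewise continuity on `[0, ∞)`: finitely many discontinuities in every bounded interval,
and one-sided limits everywhere.  Values at negative times are irrelevant. -/
structure PiecewiseContinuous {E : Type} [TopologicalSpace E] (f : ℝ → E) : Prop where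
  finite_disc : ∀ T : ℝ,
    {t : ℝ | 0 ≤ t ∧ t ≤ T ∧ ¬ ContinuousWithinAt f (Set.Ici 0) t}.Finite
  right_lim : ∀ t : ℝ, 0 ≤ t → ∃ l : E, Filter.Tendsto f (𝓝[>] t) (𝓝 l)
  left_lim : ∀ t : ℝ, 0 < t → ∃ l : E, Filter.Tendsto f (𝓝[<] t) (𝓝 l)

/-- Enhanced Nussbaum functions `𝒩 : [0, ∞) → ℝ` (only the values on `[0, ∞)` matter). -/
structure EnhancedNussbaum (𝒩 : ℝ → ℝ) : Prop where
  smooth : ContDiffOn ℝ ∞ 𝒩 (Set.Ici 0)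
  pos_mean : Filter.Tendsto (fun ξ : ℝ => (1 / ξ) * ∫ τ in (0 : ℝ)..ξ, max 0 (𝒩 τ))
    Filter.atTop Filter.atTop
  pos_ratio : Filter.limsup
    (fun ξ : ℝ => (((∫ τ in (0 : ℝ)..ξ, max 0 (𝒩 τ)) /
      (∫ τ in (0 : ℝ)..ξ, max 0 (-𝒩 τ)) : ℝ) : EReal)) Filter.atTop = ⊤
  neg_mean : Filter.Tendsto (fun ξ : ℝ => (1 / ξ) * ∫ τ in (0 : ℝ)..ξ, max 0 (-𝒩 τ))
    Filter.atTop Filter.atTop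
  neg_ratio : Filter.limsup
    (fun ξ : ℝ => (((∫ τ in (0 : ℝ)..ξ, max 0 (-𝒩 τ)) /
      (∫ τ in (0 : ℝ)..ξ, max 0 (𝒩 τ)) : ℝ) : EReal)) Filter.atTop = ⊤

/-! ### Index conventions

The coordinate `x_i` of the text, `1 ≤ i ≤ n`, is `x ⟨i - 1, _⟩`, so that an index `i : Fin n`
stands for the number `i + 1` of the text; the same holds for `φ_i, k_i, z_i, s_i, w_i, W_i, τ_i,
ζ_i`.  The virtual controls keep their numbers: `alpha m` is `α_m`, with `α_0 = 0`. -/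

/-- The truncation `(x_1, …, x_i)` of the text. -/
def trunc {n : ℕ} (i : Fin n) (x : Fin n → ℝ) : Fin (i.val + 1) → ℝ :=
  fun j => x (Fin.castLE i.isLt j)

/-- The coordinate following `j` (`0` if there is none). -/
def succCoord {n : ℕ} (x : Fin n → ℝ) (j : Fin n) : ℝ :=
  if h : j.val + 1 < n then x ⟨j.val + 1, h⟩ else 0

/-- The coordinate preceding `i` (`0` if there is none). -/
def predCoord {n : ℕ} (x : Fin n → ℝ) (i : Fin n) : ℝ :=
  if 0 < i.val then x ⟨i.val - 1, lt_of_le_of_lt (Nat.sub_le _ _) i.isLt⟩ else 0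

/-- The last index. -/
def lastIdx (n : ℕ) [NeZero n] : Fin n :=
  ⟨n - 1, Nat.sub_lt (NeZero.pos n) Nat.one_pos⟩

/-- Real functions of the state `x`, the parameter estimate `θ̂` and the scaling variable `μ`. -/
abbrev Fun3 (n q : ℕ) : Type := (Fin n → ℝ) → (Fin q → ℝ) → ℝ → ℝ

/-- `∂f/∂x_j`. -/
noncomputable def Fun3.dX {n q : ℕ} (f : Fun3 n q) (j : Fin n) : Fun3 n q :=
  fun x η μ => fderiv ℝ (fun y => f y η μ) x (Pi.single j 1)

/-- `(∂f/∂θ̂) v`, the row vector `∂f/∂θ̂` applied to the vector `v`. -/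
noncomputable def Fun3.dPar {n q : ℕ} (f : Fun3 n q)
    (x : Fin n → ℝ) (η : Fin q → ℝ) (μ : ℝ) (v : Fin q → ℝ) : ℝ :=
  fderiv ℝ (fun y => f x y μ) η v

/-- `∂f/∂μ`. -/
noncomputable def Fun3.dMu {n q : ℕ} (f : Fun3 n q) : Fun3 n q :=
  fun x η μ => deriv (fun ν => f x η ν) μ

/-- A smooth and bounded mapping of `(x, θ̂, μ)`: a smooth function of `x`, `θ̂` and the scaled
state `μ x`.  So `μ` enters only multiplied by the state, and the mapping stays bounded as long
as `x`, `θ̂` and `μ x` do, however large `μ = e^{λt}` is. -/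
def SmoothBounded {m q : ℕ} (f : (Fin m → ℝ) → (Fin q → ℝ) → ℝ → ℝ) : Prop :=
  ∃ g : (Fin m → ℝ) × (Fin q → ℝ) × (Fin m → ℝ) → ℝ, ContDiff ℝ ∞ g ∧
    ∀ x η μ, f x η μ = g (x, η, μ • x)

/-! ### The system data and the controller -/

/-- The regressors of the system and the constants of the controller. -/
structure Setup (n q : ℕ) where
  /-- the regressors `φ_i : ℝ^i → ℝ^q` -/
  phi : (i : Fin n) → (Fin (i.val + 1) → ℝ) → (Fin q → ℝ)
  /-- the gains `k_i` -/
  k : Fin n → ℝ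
  /-- the rate `λ` -/
  lam : ℝ
  /-- the known radius of the set of parameter values -/
  del : ℝ
  /-- the constant `ε_ψ` -/
  eps : ℝ
  /-- the adaptation gain matrix `Γ` -/
  Gam : Matrix (Fin q) (Fin q) ℝ

/-- Standing requirements on these data. -/
structure Setup.Admissible {n q : ℕ} (P : Setup n q) : Prop where
  phi_smooth : ∀ i, ContDiff ℝ ∞ (P.phi i)
  phi_zero : ∀ i, P.phi i 0 = 0
  k_pos : ∀ i, 0 < P.k i
  lam_pos : 0 < P.lam
  del_pos : 0 < P.del
  eps_pos : 0 < P.eps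
  Gam_pos : P.Gam.PosDef

/-- Families of regressor matrices `W_i(x_1, …, x_i, θ̂, μ) ∈ ℝ^{i × q}`. -/
abbrev RegMat (n q : ℕ) : Type :=
  (i : Fin n) → (Fin (i.val + 1) → ℝ) → (Fin q → ℝ) → ℝ → Matrix (Fin (i.val + 1)) (Fin q) ℝ

/-- `z_i = x_i - α_{i-1}`, for a given sequence `A` of virtual controls. -/
def zOf {n q : ℕ} (A : ℕ → Fun3 n q) (x : Fin n → ℝ) (η : Fin q → ℝ) (μ : ℝ) : Fin n → ℝ :=
  fun i => x i - A i.val x η μ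

/-- `w_i = φ_i - ∑_{j < i} (∂α_{i-1}/∂x_j) φ_j`. -/
noncomputable def wOf {n q : ℕ} (P : Setup n q) (A : ℕ → Fun3 n q) (i : Fin n)
    (x : Fin n → ℝ) (η : Fin q → ℝ) (μ : ℝ) : Fin q → ℝ :=
  P.phi i (trunc i x) - ∑ j ∈ Finset.Iio i, (A i.val).dX j x η μ • P.phi j (trunc j x)

/-- The tuning functions `τ_i = ∑_{j ≤ i} μ s_j w_j`, where `s_j = μ z_j`. -/
noncomputable def tauOf {n q : ℕ} (P : Setup n q) (A : ℕ → Fun3 n q) (i : Fin n)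
    (x : Fin n → ℝ) (η : Fin q → ℝ) (μ : ℝ) : Fin q → ℝ :=
  ∑ j ∈ Finset.Iic i, (μ * (μ * zOf A x η μ j)) • wOf P A j x η μ

/-- `ζ_i = λ + ((n + 1 - i) δ + 1/ε + δ |W_i|²) / 2` in the numbering of the text. -/
noncomputable def zeta {n q : ℕ} (P : Setup n q) (W : RegMat n q) (i : Fin n)
    (x : Fin n → ℝ) (η : Fin q → ℝ) (μ : ℝ) : ℝ :=
  P.lam + 1 / 2 * (((n : ℝ) - (i.val : ℝ)) * P.del + 1 / P.eps
    + P.del * frobSq (W i (trunc i x) η μ))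

/-- The formula for the virtual control `α_i` in terms of the earlier ones.  (In the second sum
the term of the first index vanishes, since `α_0 = 0`.) -/
noncomputable def alphaFormula {n q : ℕ} (P : Setup n q) (W : RegMat n q) (A : ℕ → Fun3 n q)
    (i : Fin n) : Fun3 n q := fun x η μ =>
  -(P.k i + zeta P W i x η μ) * zOf A x η μ i - predCoord (zOf A x η μ) i
    - wOf P A i x η μ ⬝ᵥ η
    + (A i.val).dPar x η μ (P.Gam *ᵥ tauOf P A i x η μ)
    + ∑ j ∈ Finset.Iio i,
        (A j.val).dPar x η μ (P.Gam *ᵥ ((μ * (μ * zOf A x η μ j)) • wOf P A i x η μ))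
    + ∑ j ∈ Finset.Iio i, (A i.val).dX j x η μ * succCoord x j
    + (A i.val).dMu x η μ * (P.lam * μ)

/-- The sequence `α_0 = 0, α_1, …, α_m, 0, 0, …`. -/
noncomputable def alphaStage {n q : ℕ} (P : Setup n q) (W : RegMat n q) : ℕ → ℕ → Fun3 n q
  | 0 => fun _ _ _ _ => 0
  | m + 1 =>
    if h : m + 1 < n then
      Function.update (alphaStage P W m) (m + 1)
        (alphaFormula P W (alphaStage P W m) ⟨m, Nat.lt_of_succ_lt h⟩)
    else alphaStage P W m

/-- The virtual controls `α_m`, `1 ≤ m ≤ n - 1` (and `0` for the other `m`). -/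
noncomputable def alpha {n q : ℕ} (P : Setup n q) (W : RegMat n q) (m : ℕ) : Fun3 n q :=
  alphaStage P W m m

theorem alphaStage_of_lt {n q : ℕ} (P : Setup n q) (W : RegMat n q) (m j : ℕ) (h : m < j) :
    alphaStage P W m j = fun _ _ _ => 0 := by
  induction m with
  | zero => rfl
  | succ m ih =>
    rw [alphaStage]
    split_ifs
    · rw [Function.update_of_ne (by omega)]
      exact ih (by omega)
    · exact ih (by omega)

theorem alphaStage_eq_alpha {n q : ℕ} (P : Setup n q) (W : RegMat n q) (m j : ℕ) (h : j ≤ m) :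
    alphaStage P W m j = alpha P W j := by
  induction m with
  | zero =>
    obtain rfl : j = 0 := by omega
    rfl
  | succ m ih =>
    rcases Nat.lt_or_ge m j with hj | hj
    · obtain rfl : j = m + 1 := by omega
      rfl
    · rw [alphaStage]
      split_ifs
      · rw [Function.update_of_ne (by omega)]
        exact ih hj
      · exact ih hj

theorem alpha_zero {n q : ℕ} (P : Setup n q) (W : RegMat n q) :
    alpha P W 0 = fun _ _ _ => 0 := rfl

theorem zOf_congr {n q : ℕ} {A B : ℕ → Fun3 n q} (x : Fin n → ℝ) (η : Fin q → ℝ) (μ : ℝ)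
    {j : Fin n} (h : A j.val = B j.val) : zOf A x η μ j = zOf B x η μ j := by
  simp [zOf, h]

theorem wOf_congr {n q : ℕ} (P : Setup n q) {A B : ℕ → Fun3 n q} (x : Fin n → ℝ)
    (η : Fin q → ℝ) (μ : ℝ) {j : Fin n} (h : A j.val = B j.val) :
    wOf P A j x η μ = wOf P B j x η μ := by
  simp [wOf, h]

theorem alphaFormula_congr {n q : ℕ} (P : Setup n q) (W : RegMat n q) {A B : ℕ → Fun3 n q}
    (i : Fin n) (h : ∀ j ≤ i.val, A j = B j) :
    alphaFormula P W A i = alphaFormula P W B i := by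
  have hp : ∀ x η μ, predCoord (zOf A x η μ) i = predCoord (zOf B x η μ) i := by
    intro x η μ
    unfold predCoord
    split_ifs
    · exact zOf_congr x η μ (h _ (Nat.sub_le _ _))
    · rfl
  have ht : ∀ x η μ, tauOf P A i x η μ = tauOf P B i x η μ := by
    intro x η μ
    refine Finset.sum_congr rfl fun j hj => ?_
    have hj' : j.val ≤ i.val := by simpa using hj
    rw [zOf_congr x η μ (h _ hj'), wOf_congr P x η μ (h _ hj')]
  funext x η μ
  unfold alphaFormula
  rw [hp, ht, zOf_congr x η μ (h _ le_rfl), wOf_congr P x η μ (h _ le_rfl), h _ le_rfl]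
  congr 3
  refine Finset.sum_congr rfl fun j hj => ?_
  have hj' : j.val ≤ i.val := by
    have := Finset.mem_Iio.1 hj
    exact le_of_lt this
  rw [zOf_congr x η μ (h _ hj'), h _ hj']

/-- The recursion that the virtual controls satisfy. -/
theorem alpha_succ {n q : ℕ} (P : Setup n q) (W : RegMat n q) (m : ℕ) (h : m + 1 < n) :
    alpha P W (m + 1) = alphaFormula P W (alpha P W) ⟨m, Nat.lt_of_succ_lt h⟩ := by
  rw [alpha, alphaStage, dif_pos h, Function.update_self]
  exact alphaFormula_congr P W _ fun j hj => alphaStage_eq_alpha P W m j hj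

/-- The error variables `z_i = x_i - α_{i-1}`. -/
noncomputable def zErr {n q : ℕ} (P : Setup n q) (W : RegMat n q)
    (x : Fin n → ℝ) (η : Fin q → ℝ) (μ : ℝ) : Fin n → ℝ :=
  zOf (alpha P W) x η μ

/-- The scaled error variables `s_i = μ z_i`. -/
noncomputable def sErr {n q : ℕ} (P : Setup n q) (W : RegMat n q)
    (x : Fin n → ℝ) (η : Fin q → ℝ) (μ : ℝ) : Fin n → ℝ :=
  μ • zErr P W x η μ

/-- The regressor vectors `w_i`. -/
noncomputable def wReg {n q : ℕ} (P : Setup n q) (W : RegMat n q) (i : Fin n)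
    (x : Fin n → ℝ) (η : Fin q → ℝ) (μ : ℝ) : Fin q → ℝ :=
  wOf P (alpha P W) i x η μ

/-- The tuning functions `τ_i`. -/
noncomputable def tau {n q : ℕ} (P : Setup n q) (W : RegMat n q) (i : Fin n)
    (x : Fin n → ℝ) (η : Fin q → ℝ) (μ : ℝ) : Fin q → ℝ :=
  tauOf P (alpha P W) i x η μ

/-- The function `ψ`. -/
noncomputable def psi {n q : ℕ} [NeZero n] (P : Setup n q) (W : RegMat n q) : Fun3 n q :=
  fun x η μ =>
    predCoord (zErr P W x η μ) (lastIdx n) + wReg P W (lastIdx n) x η μ ⬝ᵥ η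
      - ∑ j ∈ Finset.Iio (lastIdx n), (alpha P W (n - 1)).dX j x η μ * succCoord x j
      - (alpha P W (n - 1)).dPar x η μ (P.Gam *ᵥ tau P W (lastIdx n) x η μ)
      - (alpha P W (n - 1)).dMu x η μ * (P.lam * μ)
      - ∑ j ∈ Finset.Iio (lastIdx n), (alpha P W j.val).dPar x η μ
          (P.Gam *ᵥ ((μ * sErr P W x η μ j) • wReg P W (lastIdx n) x η μ))

/-- `W_i` and `ψ̄` are smooth and bounded mappings with
`w_i = W_iᵀ (z_1, …, z_i)` and `ψ = ψ̄ᵀ (z_1, …, z_n)`. -/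
structure IsRegressorChoice {n q : ℕ} [NeZero n] (P : Setup n q) (W : RegMat n q)
    (psiBar : (Fin n → ℝ) → (Fin q → ℝ) → ℝ → (Fin n → ℝ)) : Prop where
  W_smooth : ∀ i a c, SmoothBounded fun x η μ => W i x η μ a c
  W_eq : ∀ i x η μ, 0 < μ →
    wReg P W i x η μ = (W i (trunc i x) η μ)ᵀ *ᵥ trunc i (zErr P W x η μ)
  psi_smooth : ∀ a, SmoothBounded fun x η μ => psiBar x η μ a
  psi_eq : ∀ x η μ, 0 < μ → psi P W x η μ = psiBar x η μ ⬝ᵥ zErr P W x η μ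

/-- The gain `κ = k_n + λ + (δ (|W_n|² + 1) + 1/ε + ε |ψ̄|²) / 2`. -/
noncomputable def kappaGain {n q : ℕ} [NeZero n] (P : Setup n q) (W : RegMat n q)
    (psiBar : (Fin n → ℝ) → (Fin q → ℝ) → ℝ → (Fin n → ℝ)) : Fun3 n q :=
  fun x η μ => P.k (lastIdx n) + P.lam
    + 1 / 2 * (P.del * (frobSq (W (lastIdx n) (trunc (lastIdx n) x) η μ) + 1) + 1 / P.eps
      + P.eps * ∑ a, psiBar x η μ a ^ 2)

/-- `ū = κ z_n`. -/
noncomputable def uBar {n q : ℕ} [NeZero n] (P : Setup n q) (W : RegMat n q)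
    (psiBar : (Fin n → ℝ) → (Fin q → ℝ) → ℝ → (Fin n → ℝ)) : Fun3 n q :=
  fun x η μ => kappaGain P W psiBar x η μ * zErr P W x η μ (lastIdx n)

/-! ### Assumptions on the unknown parameters, and solutions of the closed loop -/

/-- Assumption on `θ(t)`: piecewise continuous, with values in a compact set `Θ₀` contained in
some ball of radius `del`; the centre is not known. -/
structure ParameterAssumption {q : ℕ} (del : ℝ) (θ : ℝ → Fin q → ℝ) (Θ₀ : Set (Fin q → ℝ)) :
    Prop where
  piecewise : PiecewiseContinuous θ
  compact : IsCompact Θ₀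
  mem : ∀ t, 0 ≤ t → θ t ∈ Θ₀
  radius : ∃ l : Fin q → ℝ, ∀ p ∈ Θ₀, euclNorm (p - l) ≤ del

/-- Assumption on `b(t)`: piecewise continuous, with values in a compact set that excludes zero,
and of constant (unknown) sign. -/
structure CoefficientAssumption (b : ℝ → ℝ) (Ω : Set ℝ) : Prop where
  piecewise : PiecewiseContinuous b
  compact : IsCompact Ω
  zero_notMem : (0 : ℝ) ∉ Ω
  mem : ∀ t, 0 ≤ t → b t ∈ Ω
  sign : (∀ t, 0 ≤ t → 0 < b t) ∨ (∀ t, 0 ≤ t → b t < 0)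

/-- The interval `[0, T)`, with `T = ⊤` for `[0, ∞)`. -/
def timeInterval (T : EReal) : Set ℝ := {t : ℝ | 0 ≤ t ∧ (t : EReal) < T}

/-- The right-hand side of the strict-feedback system:
`ẋ_i = φ_iᵀ θ + x_{i+1}` for `i < n`, and `ẋ_n = φ_nᵀ θ + b u`. -/
def systemField {n q : ℕ} (P : Setup n q) (θ : Fin q → ℝ) (b u : ℝ) (x : Fin n → ℝ) : Fin n → ℝ :=
  fun i => P.phi i (trunc i x) ⬝ᵥ θ +
    if h : i.val + 1 < n then x ⟨i.val + 1, h⟩ else b * u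

/-- `(x, θ̂, ξ)` solves the closed loop on `[0, T)`: it is continuous and satisfies the differential
equations at all times at which `θ` and `b` are continuous.  Here `μ = e^{λt}`,
`u = 𝒩(ξ) ū`, `θ̂' = Γ τ_n`, `ξ' = μ s_n ū = κ s_n²`. -/
structure IsClosedLoopSolution {n q : ℕ} [NeZero n] (P : Setup n q) (W : RegMat n q)
    (psiBar : (Fin n → ℝ) → (Fin q → ℝ) → ℝ → (Fin n → ℝ)) (𝒩 : ℝ → ℝ)
    (θ : ℝ → Fin q → ℝ) (b : ℝ → ℝ) (T : EReal)
    (x : ℝ → Fin n → ℝ) (η : ℝ → Fin q → ℝ) (ξ : ℝ → ℝ) : Prop where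
  x_cont : ContinuousOn x (timeInterval T)
  η_cont : ContinuousOn η (timeInterval T)
  ξ_cont : ContinuousOn ξ (timeInterval T)
  x_ode : ∀ t ∈ timeInterval T, ContinuousWithinAt θ (Set.Ici 0) t →
    ContinuousWithinAt b (Set.Ici 0) t →
    HasDerivWithinAt x (systemField P (θ t) (b t)
      (𝒩 (ξ t) * uBar P W psiBar (x t) (η t) (Real.exp (P.lam * t))) (x t)) (timeInterval T) t
  η_ode : ∀ t ∈ timeInterval T, ContinuousWithinAt θ (Set.Ici 0) t →
    ContinuousWithinAt b (Set.Ici 0) t →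
    HasDerivWithinAt η (P.Gam *ᵥ tau P W (lastIdx n) (x t) (η t) (Real.exp (P.lam * t)))
      (timeInterval T) t
  ξ_ode : ∀ t ∈ timeInterval T, ContinuousWithinAt θ (Set.Ici 0) t →
    ContinuousWithinAt b (Set.Ici 0) t →
    HasDerivWithinAt ξ (Real.exp (P.lam * t)
      * sErr P W (x t) (η t) (Real.exp (P.lam * t)) (lastIdx n)
      * uBar P W psiBar (x t) (η t) (Real.exp (P.lam * t))) (timeInterval T) t

/-- All closed-loop signals along `(x, θ̂, ξ)` are bounded by `B` on `[0, T)`: the state, the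
estimate, `ξ`, `𝒩(ξ)`, the control `u`, `ū`, `κ`, `ξ'`, and all `z_i, s_i, w_i, τ_i, α_i`. -/
structure SignalsBoundedBy {n q : ℕ} [NeZero n] (P : Setup n q) (W : RegMat n q)
    (psiBar : (Fin n → ℝ) → (Fin q → ℝ) → ℝ → (Fin n → ℝ)) (𝒩 : ℝ → ℝ) (T : EReal)
    (x : ℝ → Fin n → ℝ) (η : ℝ → Fin q → ℝ) (ξ : ℝ → ℝ) (B : ℝ) : Prop where
  state : ∀ t ∈ timeInterval T, euclNorm (x t) ≤ B
  estimate : ∀ t ∈ timeInterval T, euclNorm (η t) ≤ B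
  xi : ∀ t ∈ timeInterval T, |ξ t| ≤ B
  nussbaum : ∀ t ∈ timeInterval T, |𝒩 (ξ t)| ≤ B
  control : ∀ t ∈ timeInterval T,
    |𝒩 (ξ t) * uBar P W psiBar (x t) (η t) (Real.exp (P.lam * t))| ≤ B
  ubar : ∀ t ∈ timeInterval T, |uBar P W psiBar (x t) (η t) (Real.exp (P.lam * t))| ≤ B
  kappa : ∀ t ∈ timeInterval T, |kappaGain P W psiBar (x t) (η t) (Real.exp (P.lam * t))| ≤ B
  xi_rate : ∀ t ∈ timeInterval T,
    |Real.exp (P.lam * t) * sErr P W (x t) (η t) (Real.exp (P.lam * t)) (lastIdx n)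
      * uBar P W psiBar (x t) (η t) (Real.exp (P.lam * t))| ≤ B
  errors : ∀ t ∈ timeInterval T, euclNorm (zErr P W (x t) (η t) (Real.exp (P.lam * t))) ≤ B
  scaled_errors : ∀ t ∈ timeInterval T,
    euclNorm (sErr P W (x t) (η t) (Real.exp (P.lam * t))) ≤ B
  regressors : ∀ t ∈ timeInterval T, ∀ i,
    euclNorm (wReg P W i (x t) (η t) (Real.exp (P.lam * t))) ≤ B
  tuning : ∀ t ∈ timeInterval T, ∀ i,
    euclNorm (tau P W i (x t) (η t) (Real.exp (P.lam * t))) ≤ B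
  virtual : ∀ t ∈ timeInterval T, ∀ m : ℕ,
    |alpha P W m (x t) (η t) (Real.exp (P.lam * t))| ≤ B

/-! ### Parametric integrals and division of smooth functions vanishing at the origin -/

/-! The Lyapunov function is V = (|s|² + (θ̂ - l)ᵀΓ⁻¹(θ̂ - l))/2, where l is the unknown constant
centre of the parameter ball. Since the comparison point is l and not θ(t), no derivative of θ
appears. In V' the error dynamics contribute w_iᵀ(θ - θ̂) and the update law contributes w_iᵀ(θ̂ -
l), which add up to w_iᵀ(θ - l) with |θ - l| ≤ δ. The tuning terms cancel by skew-symmetry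
(`sum_tuning_eq_zero`) and the neighbour terms telescope (`sum_succCoord_eq_sum_predCoord`). Because
w_i = W_iᵀz and ψ = ψ̄ᵀz, what remains is quadratic in s, and Young's inequality absorbs it into ζ_i
and κ. This gives `lyapunov_rate_le`: V' ≤ -∑ k_i s_i² + (1 + b𝒩(ξ)) ξ'.

As ξ' ≥ 0, the unknown b𝒩 may be replaced by a fixed continuous majorant h
(`EnhancedNussbaum.exists_majorant`), so V - ∫₀^ξ (h + 1) is nonincreasing. The enhanced Nussbaum
conditions make this integral arbitrarily negative at arbitrarily large ξ. Since V ≥ 0, ξ cannot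
cross such a level; hence ξ, V, s and θ̂ are bounded, uniformly for bounded initial data
(`exists_uniform_bound`). Triangular inversion of x ↦ z then bounds μx, which is decay of x at rate
λ.

For all of this μ must enter only through μx. The class `StateLinear` (combinations of the x_k with
coefficients smooth in x, θ̂, μx) contains φ_i by Hadamard's lemma and is preserved by the
backstepping recursion. This bounds all signals and also yields W_i and ψ̄.

Existence: clamp the state to a box, solve the resulting globally Lipschitz problem by Picard
iteration, and use the a priori bound to see that the clamp is never active. Convergence of θ̂: its
rate is O(|s|²), hence dominated by the decrease of the energy. -/

theorem hasFDerivAt_intervalIntegral_param {E G : Type} [NormedAddCommGroup E] [NormedSpace ℝ E]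
    [ProperSpace E] [NormedAddCommGroup G] [NormedSpace ℝ G] [CompleteSpace G]
    {F : E × ℝ → G} (hF : ContDiff ℝ 1 F) (p : E) :
    HasFDerivAt (fun p => ∫ s in (0 : ℝ)..1, F (p, s))
      (∫ s in (0 : ℝ)..1, (fderiv ℝ F (p, s)).comp (ContinuousLinearMap.inl ℝ E ℝ)) p := by
  have hd : Continuous fun z : E × ℝ =>
      (fderiv ℝ F z).comp (ContinuousLinearMap.inl ℝ E ℝ) :=
    (hF.continuous_fderiv one_ne_zero).clm_comp continuous_const
  obtain ⟨C, hC⟩ := ((isCompact_closedBall p 1).prod (isCompact_Icc (a := (0 : ℝ)) (b := 1))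
    ).exists_bound_of_continuousOn hd.continuousOn
  refine (intervalIntegral.hasFDerivAt_integral_of_dominated_of_fderiv_le (μ := MeasureTheory.volume)
    (F := fun p s => F (p, s))
    (F' := fun p s => (fderiv ℝ F (p, s)).comp (ContinuousLinearMap.inl ℝ E ℝ))
    (bound := fun _ => C) (Metric.closedBall_mem_nhds p one_pos) ?_ ?_ ?_ ?_ ?_ ?_)
  · refine Filter.Eventually.of_forall fun y => ?_
    exact (hF.continuous.comp (by fun_prop : Continuous fun s : ℝ => (y, s))).aestronglyMeasurable
  · exact (hF.continuous.comp (by fun_prop : Continuous fun s : ℝ => (p, s))).intervalIntegrable _ _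
  · exact (hd.comp (by fun_prop : Continuous fun s : ℝ => (p, s))).aestronglyMeasurable
  · refine Filter.Eventually.of_forall fun s hs y hy => hC (y, s) ⟨hy, ?_⟩
    rw [Set.uIoc_of_le zero_le_one] at hs
    exact ⟨hs.1.le, hs.2⟩
  · exact intervalIntegrable_const
  · refine Filter.Eventually.of_forall fun s _ y _ => ?_
    exact ((hF.differentiable one_ne_zero (y, s)).hasFDerivAt).comp y (hasFDerivAt_prodMk_left y s)

/-- Induction on the order of smoothness: the derivative is again a parametric integral, of an
operator-valued integrand. The codomain is therefore quantified inside the induction. -/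
theorem contDiff_intervalIntegral_param {E : Type} [NormedAddCommGroup E] [NormedSpace ℝ E]
    [ProperSpace E] (m : ℕ) : ∀ {G : Type} [NormedAddCommGroup G] [NormedSpace ℝ G]
    [CompleteSpace G] {F : E × ℝ → G}, ContDiff ℝ ∞ F →
    ContDiff ℝ m (fun p => ∫ s in (0 : ℝ)..1, F (p, s)) := by
  induction m with
  | zero =>
    intro G _ _ _ F hF
    refine contDiff_zero.2 (continuous_iff_continuousAt.2 fun p => ?_)
    exact (hasFDerivAt_intervalIntegral_param (hF.of_le (by norm_cast)) p).continuousAt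
  | succ m ih =>
    intro G _ _ _ F hF
    have h1 : ContDiff ℝ 1 F := hF.of_le (by norm_cast)
    have := (contDiff_succ_iff_hasFDerivAt (𝕜 := ℝ) (n := m)
      (f := fun p => ∫ s in (0 : ℝ)..1, F (p, s))).2
      ⟨_, ih (F := fun z => (fderiv ℝ F z).comp (ContinuousLinearMap.inl ℝ E ℝ)) ?_,
        hasFDerivAt_intervalIntegral_param h1⟩
    · exact_mod_cast this
    · exact (hF.fderiv_right (m := ∞) (by norm_cast)).clm_comp contDiff_const

theorem clm_pi_apply {ι : Type} [Fintype ι] [DecidableEq ι] (L : (ι → ℝ) →L[ℝ] ℝ) (v : ι → ℝ) :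
    L v = ∑ k, L (Pi.single k 1) * v k := by
  conv_lhs => rw [← Finset.univ_sum_single v, map_sum]
  refine Finset.sum_congr rfl fun k _ => ?_
  have : (Pi.single k (v k) : ι → ℝ) = v k • Pi.single k 1 := by
    rw [← Pi.single_smul]; simp
  rw [this, map_smul, smul_eq_mul, mul_comm]

/-- Hadamard's lemma: integrate d/ds f(sy) from 0 to 1. The coefficients are the averages of the
partial derivatives of f along the segment from 0 to y. -/
theorem exists_smooth_coeff_of_zero {m : ℕ} {f : (Fin m → ℝ) → ℝ} (hf : ContDiff ℝ ∞ f)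
    (h0 : f 0 = 0) :
    ∃ g : Fin m → (Fin m → ℝ) → ℝ, (∀ k, ContDiff ℝ ∞ (g k)) ∧
      ∀ y, f y = ∑ k, g k y * y k := by
  have hd : ContDiff ℝ ∞ (fderiv ℝ f) := hf.fderiv_right (m := ∞) (by norm_cast)
  refine ⟨fun k y => ∫ s in (0 : ℝ)..1, fderiv ℝ f (s • y) (Pi.single k 1), fun k => ?_,
    fun y => ?_⟩
  · refine contDiff_infty.2 fun j => contDiff_intervalIntegral_param j
      (F := fun z : (Fin m → ℝ) × ℝ => fderiv ℝ f (z.2 • z.1) (Pi.single k 1)) ?_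
    exact (hd.comp (contDiff_snd.smul contDiff_fst)).clm_apply contDiff_const
  · have hc : ∀ k, Continuous fun s : ℝ => fderiv ℝ f (s • y) (Pi.single k 1) := fun k =>
      ((hd.continuous.comp (by fun_prop : Continuous fun s : ℝ => s • y)).clm_apply
        continuous_const)
    have h1 : ∀ s ∈ Set.uIcc (0 : ℝ) 1, HasDerivAt (fun s : ℝ => f (s • y))
        (∑ k, fderiv ℝ f (s • y) (Pi.single k 1) * y k) s := by
      intro s _
      have h2 := ((hf.differentiable (by simp) (s • y)).hasFDerivAt).comp_hasDerivAt s
        ((hasDerivAt_id s).smul_const y)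
      refine h2.congr_deriv ?_
      rw [one_smul, clm_pi_apply]
    have h3 := intervalIntegral.integral_eq_sub_of_hasDerivAt h1
      ((continuous_finsetSum _ fun k _ => (hc k).mul continuous_const).intervalIntegrable _ _)
    simp only [one_smul, zero_smul, h0, sub_zero] at h3
    rw [← h3, intervalIntegral.integral_finsetSum (f := fun k (s : ℝ) =>
      fderiv ℝ f (s • y) (Pi.single k 1) * y k)
      fun k _ => ((hc k).mul continuous_const).intervalIntegrable _ _]
    simp

/-! ### Smooth bounded functions -/

namespace SmoothBounded

variable {n q : ℕ} {f g : Fun3 n q}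

theorem const (c : ℝ) : SmoothBounded (fun (_ : Fin n → ℝ) (_ : Fin q → ℝ) (_ : ℝ) => c) :=
  ⟨fun _ => c, contDiff_const, fun _ _ _ => rfl⟩

theorem coord (k : Fin n) :
    SmoothBounded (fun (x : Fin n → ℝ) (_ : Fin q → ℝ) (_ : ℝ) => x k) :=
  ⟨fun z => z.1 k, by fun_prop, fun _ _ _ => rfl⟩

theorem param (a : Fin q) :
    SmoothBounded (fun (_ : Fin n → ℝ) (η : Fin q → ℝ) (_ : ℝ) => η a) :=
  ⟨fun z => z.2.1 a, by fun_prop, fun _ _ _ => rfl⟩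

theorem scaled_coord (k : Fin n) :
    SmoothBounded (fun (x : Fin n → ℝ) (_ : Fin q → ℝ) (μ : ℝ) => μ * x k) :=
  ⟨fun z => z.2.2 k, by fun_prop, fun _ _ _ => rfl⟩

theorem of_smooth {h : (Fin n → ℝ) → ℝ} (hh : ContDiff ℝ ∞ h) :
    SmoothBounded (fun (x : Fin n → ℝ) (_ : Fin q → ℝ) (_ : ℝ) => h x) :=
  ⟨fun z => h z.1, hh.comp contDiff_fst, fun _ _ _ => rfl⟩

theorem add (hf : SmoothBounded f) (hg : SmoothBounded g) :
    SmoothBounded fun x η μ => f x η μ + g x η μ := by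
  obtain ⟨F, hF, hf⟩ := hf
  obtain ⟨G, hG, hg⟩ := hg
  exact ⟨fun z => F z + G z, hF.add hG, fun x η μ => by simp only [hf, hg]⟩

theorem mul (hf : SmoothBounded f) (hg : SmoothBounded g) :
    SmoothBounded fun x η μ => f x η μ * g x η μ := by
  obtain ⟨F, hF, hf⟩ := hf
  obtain ⟨G, hG, hg⟩ := hg
  exact ⟨fun z => F z * G z, hF.mul hG, fun x η μ => by simp only [hf, hg]⟩

theorem neg (hf : SmoothBounded f) : SmoothBounded fun x η μ => -f x η μ := by
  obtain ⟨F, hF, hf⟩ := hf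
  exact ⟨fun z => -F z, hF.neg, fun x η μ => by simp only [hf]⟩

theorem sub (hf : SmoothBounded f) (hg : SmoothBounded g) :
    SmoothBounded fun x η μ => f x η μ - g x η μ := by
  simpa only [sub_eq_add_neg] using hf.add hg.neg

theorem sum {ι : Type} {s : Finset ι} {F : ι → Fun3 n q} (h : ∀ i ∈ s, SmoothBounded (F i)) :
    SmoothBounded fun x η μ => ∑ i ∈ s, F i x η μ := by
  classical
  induction s using Finset.induction_on with
  | empty => simpa using const 0
  | insert a s ha ih =>
    simp only [Finset.sum_insert ha]
    exact (h a (Finset.mem_insert_self a s)).add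
      (ih fun i hi => h i (Finset.mem_insert_of_mem hi))

theorem sq (hf : SmoothBounded f) : SmoothBounded fun x η μ => f x η μ ^ 2 := by
  simpa only [pow_two] using hf.mul hf

/-- Precomposition with a linear map of the state. -/
theorem comp_linear {m : ℕ} (hf : SmoothBounded f) (L : (Fin m → ℝ) →L[ℝ] (Fin n → ℝ)) :
    SmoothBounded fun x η μ => f (L x) η μ := by
  obtain ⟨F, hF, hf⟩ := hf
  refine ⟨fun z => F (L z.1, z.2.1, L z.2.2), by fun_prop, fun x η μ => by simp only [hf, map_smul]⟩

/-- A continuous function is bounded on a box. The bound does not involve μ itself, so it is uniform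
in time once x, θ̂ and μx are bounded. -/
theorem bounded (hf : SmoothBounded f) (R : ℝ) :
    ∃ B, ∀ x η μ, (∀ k, |x k| ≤ R) → (∀ a, |η a| ≤ R) → (∀ k, |μ * x k| ≤ R) →
      |f x η μ| ≤ B := by
  obtain ⟨F, hF, hf⟩ := hf
  obtain ⟨B, hB⟩ := (isCompact_Icc (a := ((fun _ => -R, fun _ => -R, fun _ => -R) :
    (Fin n → ℝ) × (Fin q → ℝ) × (Fin n → ℝ))) (b := (fun _ => R, fun _ => R, fun _ => R))
    ).exists_bound_of_continuousOn hF.continuous.continuousOn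
  refine ⟨B, fun x η μ hx hη hs => ?_⟩
  rw [hf, ← Real.norm_eq_abs]
  refine hB _ ⟨⟨fun k => (abs_le.1 (hx k)).1, fun a => (abs_le.1 (hη a)).1,
    fun k => (abs_le.1 (hs k)).1⟩, ⟨fun k => (abs_le.1 (hx k)).2, fun a => (abs_le.1 (hη a)).2,
    fun k => (abs_le.1 (hs k)).2⟩⟩

theorem contDiff (hf : SmoothBounded f) :
    ContDiff ℝ ∞ fun z : (Fin n → ℝ) × (Fin q → ℝ) × ℝ => f z.1 z.2.1 z.2.2 := by
  obtain ⟨F, hF, hf⟩ := hf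
  simp only [hf]
  fun_prop

end SmoothBounded

/-! ### Smooth bounded functions that are combinations of the state -/

/-- Combinations of the coordinates of the state with smooth bounded coefficients. -/
def StateLinear {n q : ℕ} (f : Fun3 n q) : Prop :=
  ∃ G : Fin n → Fun3 n q, (∀ k, SmoothBounded (G k)) ∧
    ∀ x η μ, f x η μ = ∑ k, G k x η μ * x k

namespace StateLinear

variable {n q : ℕ} {f g : Fun3 n q}

theorem zero : StateLinear (fun (_ : Fin n → ℝ) (_ : Fin q → ℝ) (_ : ℝ) => 0) :=
  ⟨fun _ _ _ _ => 0, fun _ => SmoothBounded.const 0, fun _ _ _ => by simp⟩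

theorem add (hf : StateLinear f) (hg : StateLinear g) :
    StateLinear fun x η μ => f x η μ + g x η μ := by
  obtain ⟨F, hF, hf⟩ := hf
  obtain ⟨G, hG, hg⟩ := hg
  exact ⟨fun k x η μ => F k x η μ + G k x η μ, fun k => (hF k).add (hG k), fun x η μ => by
    simp only [hf, hg, add_mul, Finset.sum_add_distrib]⟩

theorem mul_left (hf : SmoothBounded f) (hg : StateLinear g) :
    StateLinear fun x η μ => f x η μ * g x η μ := by
  obtain ⟨G, hG, hg⟩ := hg
  exact ⟨fun k x η μ => f x η μ * G k x η μ, fun k => hf.mul (hG k), fun x η μ => by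
    simp only [hg, mul_assoc, Finset.mul_sum]⟩

theorem mul_right (hf : StateLinear f) (hg : SmoothBounded g) :
    StateLinear fun x η μ => f x η μ * g x η μ := by
  simpa only [mul_comm] using mul_left hg hf

theorem neg (hf : StateLinear f) : StateLinear fun x η μ => -f x η μ := by
  simpa using mul_left (SmoothBounded.const (-1)) hf

theorem sub (hf : StateLinear f) (hg : StateLinear g) :
    StateLinear fun x η μ => f x η μ - g x η μ := by
  simpa only [sub_eq_add_neg] using hf.add hg.neg

theorem sum {ι : Type} {s : Finset ι} {F : ι → Fun3 n q} (h : ∀ i ∈ s, StateLinear (F i)) :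
    StateLinear fun x η μ => ∑ i ∈ s, F i x η μ := by
  classical
  induction s using Finset.induction_on with
  | empty => simpa using zero
  | insert a s ha ih =>
    simp only [Finset.sum_insert ha]
    exact (h a (Finset.mem_insert_self a s)).add
      (ih fun i hi => h i (Finset.mem_insert_of_mem hi))

theorem coord (k : Fin n) :
    StateLinear (fun (x : Fin n → ℝ) (_ : Fin q → ℝ) (_ : ℝ) => x k) :=
  ⟨fun l _ _ _ => if l = k then 1 else 0, fun _ => SmoothBounded.const _,
    fun _ _ _ => by simp⟩

theorem smoothBounded (hf : StateLinear f) : SmoothBounded f := by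
  obtain ⟨F, hF, hf⟩ := hf
  have : f = fun x η μ => ∑ k, F k x η μ * x k := by
    funext x η μ
    exact hf x η μ
  rw [this]
  exact SmoothBounded.sum fun k _ => (hF k).mul (SmoothBounded.coord k)

/-- The coordinate x_k present in every term absorbs the factor μ. -/
theorem scaled (hf : StateLinear f) : SmoothBounded fun x η μ => μ * f x η μ := by
  obtain ⟨F, hF, hf⟩ := hf
  simp only [hf, Finset.mul_sum, mul_left_comm _ (F _ _ _ _)]
  exact SmoothBounded.sum fun k _ => (hF k).mul (SmoothBounded.scaled_coord k)

/-- Differentiating a coefficient g(x, θ̂, μx) in its last slot produces a bare factor μ, which is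
admissible only because it meets x_k. Differentiating x_k itself removes the state factor, so the
result is smooth bounded but in general not `StateLinear`. -/
theorem dX (hf : StateLinear f) (j : Fin n) : SmoothBounded (f.dX j) := by
  obtain ⟨F, hF, hf⟩ := hf
  choose g hg hFg using hF
  have hd : ∀ k, ContDiff ℝ ∞ (fderiv ℝ (g k)) := fun k =>
    (hg k).fderiv_right (m := ∞) (by norm_cast)
  have key : f.dX j = fun x η μ => ∑ k,
      ((fderiv ℝ (g k) (x, η, μ • x) (Pi.single j 1, 0, 0) * x k
        + fderiv ℝ (g k) (x, η, μ • x) (0, 0, Pi.single j 1) * (μ * x k))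
        + F k x η μ * (Pi.single j 1 : Fin n → ℝ) k) := by
    funext x η μ
    have h1 : ∀ k, HasFDerivAt (fun y => g k (y, η, μ • y) * y k)
        (g k (x, η, μ • x) • (ContinuousLinearMap.proj (R := ℝ) (φ := fun _ : Fin n => ℝ) k) +
          x k • (fderiv ℝ (g k) (x, η, μ • x)).comp
            ((ContinuousLinearMap.id ℝ _).prod ((0 : (Fin n → ℝ) →L[ℝ] (Fin q → ℝ)).prod
              (μ • ContinuousLinearMap.id ℝ _)))) x := fun k =>
      ((((hg k).differentiable (by simp) (x, η, μ • x)).hasFDerivAt).comp x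
        ((hasFDerivAt_id x).prodMk ((hasFDerivAt_const η x).prodMk
          ((hasFDerivAt_id x).const_smul μ)))).mul' (hasFDerivAt_apply k x) |>.congr_fderiv (by
            ext; simp [mul_comm])
    have h2 := HasFDerivAt.fun_sum (u := Finset.univ) fun k _ => h1 k
    have h3 : (fun y => f y η μ) = fun y => ∑ k, g k (y, η, μ • y) * y k := by
      funext y
      simp only [hf, hFg]
    rw [Fun3.dX, h3, h2.fderiv]
    simp only [sum_apply]
    refine Finset.sum_congr rfl fun k _ => ?_
    -- The direction is split so that the factor μ comes out of the derivative in the last slot.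
    have h4 : ((Pi.single j 1, 0, μ • Pi.single j 1) :
        (Fin n → ℝ) × (Fin q → ℝ) × (Fin n → ℝ)) =
        (Pi.single j 1, 0, 0) + μ • (0, 0, Pi.single j 1) := by simp
    simp [hFg, h4, -Prod.mk_add_mk, -Prod.smul_mk]
    ring
  rw [key]
  refine SmoothBounded.sum fun k _ => (SmoothBounded.add ?_ ?_).add
    (SmoothBounded.mul ⟨g k, hg k, hFg k⟩ (SmoothBounded.const _))
  · exact SmoothBounded.mul ⟨_, (hd k).clm_apply contDiff_const, fun _ _ _ => rfl⟩
      (SmoothBounded.coord k)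
  · exact SmoothBounded.mul ⟨_, (hd k).clm_apply contDiff_const, fun _ _ _ => rfl⟩
      (SmoothBounded.scaled_coord k)

theorem dPar_const (hf : StateLinear f) (v : Fin q → ℝ) :
    StateLinear fun x η μ => f.dPar x η μ v := by
  obtain ⟨F, hF, hf⟩ := hf
  choose g hg hFg using hF
  have hd : ∀ k, ContDiff ℝ ∞ (fderiv ℝ (g k)) := fun k =>
    (hg k).fderiv_right (m := ∞) (by norm_cast)
  refine ⟨fun k x η μ => fderiv ℝ (g k) (x, η, μ • x) (0, v, 0), fun k =>
    ⟨fun z => fderiv ℝ (g k) z (0, v, 0), (hd k).clm_apply contDiff_const, fun _ _ _ => rfl⟩,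
    fun x η μ => ?_⟩
  have h1 : ∀ k, HasFDerivAt (fun y => g k (x, y, μ • x) * x k)
      (x k • (fderiv ℝ (g k) (x, η, μ • x)).comp
        ((0 : (Fin q → ℝ) →L[ℝ] (Fin n → ℝ)).prod ((ContinuousLinearMap.id ℝ _).prod
          (0 : (Fin q → ℝ) →L[ℝ] (Fin n → ℝ))))) η := fun k =>
    ((((hg k).differentiable (by simp) (x, η, μ • x)).hasFDerivAt).comp η
      ((hasFDerivAt_const x η).prodMk ((hasFDerivAt_id η).prodMk
        (hasFDerivAt_const (μ • x) η)))).mul_const (x k)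
  have h2 := HasFDerivAt.fun_sum (u := Finset.univ) fun k _ => h1 k
  have h3 : (fun y => f x y μ) = fun y => ∑ k, g k (x, y, μ • x) * x k := by
    funext y
    simp only [hf, hFg]
  simp only [Fun3.dPar]
  rw [h3, h2.fderiv]
  simp [mul_comm]

theorem dPar {v : (Fin n → ℝ) → (Fin q → ℝ) → ℝ → Fin q → ℝ} (hf : StateLinear f)
    (hv : ∀ a, SmoothBounded fun x η μ => v x η μ a) :
    StateLinear fun x η μ => f.dPar x η μ (v x η μ) := by
  have : (fun x η μ => f.dPar x η μ (v x η μ)) =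
      fun x η μ => ∑ a, f.dPar x η μ (Pi.single a 1) * v x η μ a := by
    funext x η μ
    exact clm_pi_apply _ _
  rw [this]
  exact sum fun a _ => (hf.dPar_const _).mul_right (hv a)

/-- The derivative in μ is the derivative of g in direction x in its last slot. The extra factor μ,
which comes from μ' = λμ, turns this direction into the admissible μx. -/
theorem dMu (hf : StateLinear f) (c : ℝ) :
    StateLinear fun x η μ => f.dMu x η μ * (c * μ) := by
  obtain ⟨F, hF, hf⟩ := hf
  choose g hg hFg using hF
  have hd : ∀ k, ContDiff ℝ ∞ (fderiv ℝ (g k)) := fun k =>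
    (hg k).fderiv_right (m := ∞) (by norm_cast)
  refine ⟨fun k x η μ => c * fderiv ℝ (g k) (x, η, μ • x) (0, 0, μ • x), fun k =>
    (SmoothBounded.const c).mul
      ⟨fun z => fderiv ℝ (g k) z (0, 0, z.2.2), (hd k).clm_apply (by fun_prop), fun _ _ _ => rfl⟩,
    fun x η μ => ?_⟩
  have h1 : ∀ k, HasDerivAt (fun ν => g k (x, η, ν • x) * x k)
      (fderiv ℝ (g k) (x, η, μ • x) (0, 0, x) * x k) μ := fun k =>
    ((((hg k).differentiable (by simp) (x, η, μ • x)).hasFDerivAt).comp_hasDerivAt μ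
      ((hasDerivAt_const μ x).prodMk ((hasDerivAt_const μ η).prodMk
        (by simpa using (hasDerivAt_id μ).smul_const x)))).mul_const (x k)
  have h2 := HasDerivAt.fun_sum (u := Finset.univ) fun k _ => h1 k
  have h3 : (fun ν => f x η ν) = fun ν => ∑ k, g k (x, η, ν • x) * x k := by
    funext ν
    simp only [hf, hFg]
  have h4 : ∀ k, fderiv ℝ (g k) (x, η, μ • x) (0, 0, μ • x) =
      μ * fderiv ℝ (g k) (x, η, μ • x) (0, 0, x) := fun k => by
    rw [← smul_eq_mul, ← map_smul]; simp
  simp only [Fun3.dMu]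
  rw [h3, h2.deriv, Finset.sum_mul]
  refine Finset.sum_congr rfl fun k _ => ?_
  rw [h4]; ring

end StateLinear

/-! ### The virtual controls are combinations of the state -/

section Regularity

variable {n q : ℕ} {P : Setup n q} {W : RegMat n q} {A : ℕ → Fun3 n q}

/-- `trunc` as a continuous linear map. -/
def truncCLM {n : ℕ} (i : Fin n) : (Fin n → ℝ) →L[ℝ] (Fin (i.val + 1) → ℝ) :=
  ContinuousLinearMap.pi fun j => ContinuousLinearMap.proj (Fin.castLE i.isLt j)

theorem stateLinear_phi (hP : P.Admissible) (i : Fin n) (a : Fin q) :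
    StateLinear fun x (_ : Fin q → ℝ) (_ : ℝ) => P.phi i (trunc i x) a := by
  obtain ⟨g, hg, h⟩ := exists_smooth_coeff_of_zero (f := fun y => P.phi i y a)
    (contDiff_pi.1 (hP.phi_smooth i) a) (by simp [hP.phi_zero i])
  simp only [h]
  refine StateLinear.sum fun k _ => StateLinear.mul_left (SmoothBounded.of_smooth ?_)
    (StateLinear.coord (Fin.castLE i.isLt k))
  exact (hg k).comp (truncCLM i).contDiff

theorem stateLinear_zOf (hA : ∀ j, StateLinear (A j)) (i : Fin n) :
    StateLinear fun x η μ => zOf A x η μ i :=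
  (StateLinear.coord i).sub (hA i.val)

theorem stateLinear_predCoord (hA : ∀ j, StateLinear (A j)) (i : Fin n) :
    StateLinear fun x η μ => predCoord (zOf A x η μ) i := by
  unfold predCoord
  split_ifs
  · exact stateLinear_zOf hA _
  · exact StateLinear.zero

theorem stateLinear_succCoord (j : Fin n) :
    StateLinear fun x (_ : Fin q → ℝ) (_ : ℝ) => succCoord x j := by
  unfold succCoord
  split_ifs
  · exact StateLinear.coord _
  · exact StateLinear.zero

theorem stateLinear_wOf (hP : P.Admissible) (hA : ∀ j, StateLinear (A j)) (i : Fin n)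
    (a : Fin q) : StateLinear fun x η μ => wOf P A i x η μ a := by
  simp only [wOf, Pi.sub_apply, Finset.sum_apply, Pi.smul_apply, smul_eq_mul]
  exact (stateLinear_phi hP i a).sub (StateLinear.sum fun j _ =>
    StateLinear.mul_left ((hA _).dX j) (stateLinear_phi hP j a))

/-- Both factors z_j and w_i are combinations of the state, so each absorbs one of the two powers of
μ. -/
theorem smoothBounded_scaled_wOf (hP : P.Admissible) (hA : ∀ j, StateLinear (A j)) (i j : Fin n)
    (a : Fin q) :
    SmoothBounded fun x η μ => ((μ * (μ * zOf A x η μ j)) • wOf P A i x η μ) a := by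
  have := (stateLinear_zOf hA j).scaled.mul (stateLinear_wOf hP hA i a).scaled
  refine Eq.subst (motive := SmoothBounded) ?_ this
  funext x η μ
  simp only [Pi.smul_apply, smul_eq_mul]
  ring

theorem smoothBounded_tauOf (hP : P.Admissible) (hA : ∀ j, StateLinear (A j)) (i : Fin n)
    (a : Fin q) : SmoothBounded fun x η μ => tauOf P A i x η μ a := by
  simp only [tauOf, Finset.sum_apply]
  exact SmoothBounded.sum fun j _ => smoothBounded_scaled_wOf hP hA j j a

theorem smoothBounded_mulVec {v : (Fin n → ℝ) → (Fin q → ℝ) → ℝ → Fin q → ℝ}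
    (M : Matrix (Fin q) (Fin q) ℝ) (hv : ∀ a, SmoothBounded fun x η μ => v x η μ a) (a : Fin q) :
    SmoothBounded fun x η μ => (M *ᵥ v x η μ) a := by
  simp only [Matrix.mulVec, dotProduct]
  exact SmoothBounded.sum fun c _ => (SmoothBounded.const _).mul (hv c)

theorem smoothBounded_frobSq (hW : ∀ i a c, SmoothBounded fun x η μ => W i x η μ a c)
    (i : Fin n) : SmoothBounded fun x η μ => frobSq (W i (trunc i x) η μ) :=
  SmoothBounded.sum fun a _ => SmoothBounded.sum fun c _ =>
    ((hW i a c).comp_linear (truncCLM i)).sq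

theorem smoothBounded_zeta (hW : ∀ i a c, SmoothBounded fun x η μ => W i x η μ a c)
    (i : Fin n) : SmoothBounded (zeta P W i) :=
  (SmoothBounded.const _).add ((SmoothBounded.const _).mul ((SmoothBounded.const _).add
    ((SmoothBounded.const _).mul (smoothBounded_frobSq hW i))))

theorem stateLinear_alphaFormula (hP : P.Admissible)
    (hW : ∀ i a c, SmoothBounded fun x η μ => W i x η μ a c)
    (hA : ∀ j, StateLinear (A j)) (i : Fin n) : StateLinear (alphaFormula P W A i) := by
  refine ((((((StateLinear.mul_left ?_ (stateLinear_zOf hA i)).sub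
    (stateLinear_predCoord hA i)).sub ?_).add ((hA i.val).dPar
      (smoothBounded_mulVec P.Gam (smoothBounded_tauOf hP hA i)))).add
    (StateLinear.sum fun j _ => (hA j.val).dPar (smoothBounded_mulVec P.Gam
      fun a => smoothBounded_scaled_wOf hP hA i j a))).add
    (StateLinear.sum fun j _ => StateLinear.mul_left ((hA i.val).dX j)
      (stateLinear_succCoord j))).add ((hA i.val).dMu P.lam)
  · exact ((SmoothBounded.const _).add (smoothBounded_zeta hW i)).neg
  · exact StateLinear.sum fun a _ => (stateLinear_wOf hP hA i a).mul_right (SmoothBounded.param a)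

theorem stateLinear_alphaStage (hP : P.Admissible)
    (hW : ∀ i a c, SmoothBounded fun x η μ => W i x η μ a c) (m j : ℕ) :
    StateLinear (alphaStage P W m j) := by
  induction m generalizing j with
  | zero => exact StateLinear.zero
  | succ m ih =>
    rw [alphaStage]
    split_ifs
    · rcases eq_or_ne j (m + 1) with rfl | hj
      · rw [Function.update_self]
        exact stateLinear_alphaFormula hP hW ih _
      · rw [Function.update_of_ne hj]
        exact ih j
    · exact ih j

theorem stateLinear_alpha (hP : P.Admissible)
    (hW : ∀ i a c, SmoothBounded fun x η μ => W i x η μ a c) (m : ℕ) :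
    StateLinear (alpha P W m) := stateLinear_alphaStage hP hW m m

theorem alpha_of_ge (P : Setup n q) (W : RegMat n q) {m : ℕ} (h : n ≤ m) :
    alpha P W m = fun _ _ _ => 0 := by
  cases m with
  | zero => rfl
  | succ m =>
    rw [alpha, alphaStage, dif_neg (by omega)]
    exact alphaStage_of_lt P W m _ (Nat.lt_succ_self m)

theorem stateLinear_psi [NeZero n] (hP : P.Admissible)
    (hW : ∀ i a c, SmoothBounded fun x η μ => W i x η μ a c) : StateLinear (psi P W) := by
  have hA := stateLinear_alpha (P := P) (W := W) hP hW
  refine (((((stateLinear_predCoord hA _).add (StateLinear.sum fun a _ =>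
    (stateLinear_wOf hP hA _ a).mul_right (SmoothBounded.param a))).sub
    (StateLinear.sum fun j _ => StateLinear.mul_left ((hA _).dX j) (stateLinear_succCoord j))).sub
    ((hA _).dPar (smoothBounded_mulVec P.Gam (smoothBounded_tauOf hP hA _)))).sub
    ((hA _).dMu P.lam)).sub (StateLinear.sum fun j _ => (hA _).dPar
      (smoothBounded_mulVec P.Gam fun a => smoothBounded_scaled_wOf hP hA _ j a))

/-! ### Dependence on the first coordinates only -/

/-- The function depends on the state through its first `m` coordinates only. -/
def DependsOnFirst {β : Type} (m : ℕ) (f : (Fin n → ℝ) → (Fin q → ℝ) → ℝ → β) : Prop :=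
  ∀ x y η μ, (∀ k : Fin n, k.val < m → x k = y k) → f x η μ = f y η μ

theorem DependsOnFirst.mono {β : Type} {m m' : ℕ} {f : (Fin n → ℝ) → (Fin q → ℝ) → ℝ → β}
    (hf : DependsOnFirst m f) (h : m ≤ m') : DependsOnFirst m' f :=
  fun x y η μ hxy => hf x y η μ fun k hk => hxy k (hk.trans_le h)

theorem DependsOnFirst.dX {m : ℕ} {f : Fun3 n q} (hf : DependsOnFirst m f) (j : Fin n) :
    DependsOnFirst m (f.dX j) := by
  intro x y η μ hxy
  -- The shift y - x vanishes in the first m coordinates, so `f` is invariant under it, and the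
  -- derivatives at x and at y coincide.
  have h : (fun z => f z η μ) = fun z => f (z + (y - x)) η μ := by
    funext z
    refine hf _ _ _ _ fun k hk => ?_
    simp [hxy k hk]
  simp only [Fun3.dX]
  conv_lhs => rw [h, fderiv_comp_add_right (f := fun z => f z η μ), add_sub_cancel]

theorem DependsOnFirst.dX_eq_zero {m : ℕ} {f : Fun3 n q} (hf : DependsOnFirst m f)
    (hs : StateLinear f) {j : Fin n} (hj : m ≤ j.val) (x : Fin n → ℝ) (η : Fin q → ℝ) (μ : ℝ) :
    f.dX j x η μ = 0 := by
  have hd : DifferentiableAt ℝ (fun y => f y η μ) x :=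
    ((hs.smoothBounded.contDiff.comp (by fun_prop : ContDiff ℝ ∞ fun y : Fin n → ℝ =>
      (y, η, μ))).differentiable (by simp)) x
  have h1 := hd.hasFDerivAt.comp_hasDerivAt_of_eq (0 : ℝ)
    (((hasDerivAt_id (0 : ℝ)).smul_const (Pi.single j 1 : Fin n → ℝ)).const_add x) (by simp)
  have h2 : ((fun y => f y η μ) ∘ fun t : ℝ => x + id t • (Pi.single j 1 : Fin n → ℝ)) =
      fun _ => f x η μ := by
    funext t
    refine hf _ _ _ _ fun k hk => ?_
    have : k ≠ j := by
      rintro rfl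
      omega
    simp [this]
  rw [h2] at h1
  have := h1.unique (hasDerivAt_const _ _)
  simpa [Fun3.dX] using this

theorem DependsOnFirst.dPar {m : ℕ} {f : Fun3 n q} (hf : DependsOnFirst m f)
    {v : (Fin n → ℝ) → (Fin q → ℝ) → ℝ → Fin q → ℝ} (hv : DependsOnFirst m v) :
    DependsOnFirst m fun x η μ => f.dPar x η μ (v x η μ) := by
  intro x y η μ hxy
  simp only [Fun3.dPar]
  rw [hv x y η μ hxy, show (fun z => f x z μ) = fun z => f y z μ from
    funext fun z => hf x y z μ hxy]

theorem DependsOnFirst.dMu {m : ℕ} {f : Fun3 n q} (hf : DependsOnFirst m f) :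
    DependsOnFirst m f.dMu := by
  intro x y η μ hxy
  simp only [Fun3.dMu]
  rw [show (fun z => f x η z) = fun z => f y η z from funext fun z => hf x y η z hxy]

theorem trunc_congr {i : Fin n} {x y : Fin n → ℝ} {m : ℕ} (hi : i.val < m)
    (hxy : ∀ k : Fin n, k.val < m → x k = y k) : trunc i x = trunc i y :=
  funext fun k => hxy _ (by
    have := k.isLt
    simp only [Fin.val_castLE]
    omega)

theorem dependsOnFirst_zOf {i : Fin n} (hA : DependsOnFirst i.val (A i.val)) :
    DependsOnFirst (i.val + 1) fun x η μ => zOf A x η μ i := by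
  intro x y η μ hxy
  simp only [zOf]
  rw [hxy i (Nat.lt_succ_self _), (hA.mono (Nat.le_succ _)) x y η μ hxy]

theorem dependsOnFirst_wOf {i : Fin n} (hA : DependsOnFirst i.val (A i.val)) :
    DependsOnFirst (i.val + 1) (wOf P A i) := by
  intro x y η μ hxy
  simp only [wOf]
  rw [trunc_congr (Nat.lt_succ_self _) hxy]
  congr 1
  refine Finset.sum_congr rfl fun j hj => ?_
  have hji : j.val + 1 ≤ i.val + 1 := by
    have := Finset.mem_Iio.1 hj
    have : j.val < i.val := this
    omega
  rw [((hA.dX j).mono (Nat.le_succ _)) x y η μ hxy,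
    trunc_congr (i := j) hji hxy]

theorem dependsOnFirst_tauOf {i : Fin n}
    (hA : ∀ j : Fin n, j ≤ i → DependsOnFirst j.val (A j.val)) :
    DependsOnFirst (i.val + 1) (tauOf P A i) := by
  intro x y η μ hxy
  simp only [tauOf]
  refine Finset.sum_congr rfl fun j hj => ?_
  have hj := Finset.mem_Iic.1 hj
  have hji : j.val + 1 ≤ i.val + 1 := Nat.succ_le_succ hj
  have hz : zOf A x η μ j = zOf A y η μ j :=
    ((dependsOnFirst_zOf (hA j hj)).mono hji) x y η μ hxy
  rw [hz, ((dependsOnFirst_wOf (hA j hj)).mono hji) x y η μ hxy]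

theorem dependsOnFirst_alphaFormula {i : Fin n}
    (hA : ∀ j : Fin n, j ≤ i → DependsOnFirst j.val (A j.val)) :
    DependsOnFirst (i.val + 1) (alphaFormula P W A i) := by
  intro x y η μ hxy
  have hz : ∀ j : Fin n, j ≤ i → zOf A x η μ j = zOf A y η μ j := fun j hj =>
    ((dependsOnFirst_zOf (hA j hj)).mono (Nat.succ_le_succ hj)) x y η μ hxy
  have hw := dependsOnFirst_wOf (P := P) (hA i le_rfl) x y η μ hxy
  have hp : predCoord (zOf A x η μ) i = predCoord (zOf A y η μ) i := by
    unfold predCoord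
    split_ifs
    · exact hz _ (Nat.sub_le _ _)
    · rfl
  have hAi := (hA i le_rfl).mono (Nat.le_succ _)
  have ht : DependsOnFirst (i.val + 1) fun x η μ => P.Gam *ᵥ tauOf P A i x η μ := by
    intro x y η μ hxy
    simp only [dependsOnFirst_tauOf (P := P) hA x y η μ hxy]
  have hd : (A i.val).dPar x η μ (P.Gam *ᵥ tauOf P A i x η μ) =
      (A i.val).dPar y η μ (P.Gam *ᵥ tauOf P A i y η μ) := (hAi.dPar ht) x y η μ hxy
  unfold alphaFormula
  rw [hz i le_rfl, hp, hw, hd, hAi.dMu x y η μ hxy]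
  have hzeta : zeta P W i x η μ = zeta P W i y η μ := by
    simp only [zeta]
    rw [trunc_congr (Nat.lt_succ_self _) hxy]
  rw [hzeta]
  congr 1
  refine congrArg₂ (· + ·) (congrArg₂ (· + ·) rfl ?_) ?_
  · refine Finset.sum_congr rfl fun j hj => ?_
    have hj : j < i := Finset.mem_Iio.1 hj
    rw [hz j hj.le]
    exact ((((hA j hj.le).mono (Nat.le_of_lt hj)).mono (Nat.le_succ _)).dPar
      (v := fun _ _ _ => P.Gam *ᵥ ((μ * (μ * zOf A y η μ j)) • wOf P A i y η μ))
      fun _ _ _ _ _ => rfl) x y η μ hxy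
  · refine Finset.sum_congr rfl fun j hj => ?_
    have hj := Finset.mem_Iio.1 hj
    rw [hAi.dX j x y η μ hxy]
    congr 1
    unfold succCoord
    split_ifs
    · exact hxy _ (Nat.succ_lt_succ hj)
    · rfl

theorem dependsOnFirst_alpha (P : Setup n q) (W : RegMat n q) (m : ℕ) :
    DependsOnFirst m (alpha P W m) := by
  induction m using Nat.strong_induction_on with
  | _ m ih =>
    rcases Nat.lt_or_ge m n with h | h
    · cases m with
      | zero => exact fun _ _ _ _ _ => rfl
      | succ m =>
        rw [alpha_succ P W m h]
        exact dependsOnFirst_alphaFormula (i := ⟨m, Nat.lt_of_succ_lt h⟩)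
          fun j hj => ih _ (Nat.lt_succ_of_le hj)
    · rw [alpha_of_ge P W h]
      exact fun _ _ _ _ _ => rfl

/-- Set all but the first `m` coordinates to zero. -/
def cutCLM (n m : ℕ) : (Fin n → ℝ) →L[ℝ] (Fin n → ℝ) :=
  ContinuousLinearMap.pi fun k => if k.val < m then ContinuousLinearMap.proj k else 0

theorem cutCLM_apply (m : ℕ) (x : Fin n → ℝ) (k : Fin n) :
    cutCLM n m x k = if k.val < m then x k else 0 := by
  simp only [cutCLM, ContinuousLinearMap.coe_pi']
  split_ifs <;> rfl

theorem dependsOnFirst_cut {β : Type} (m : ℕ) (f : (Fin n → ℝ) → (Fin q → ℝ) → ℝ → β) :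
    DependsOnFirst m fun x η μ => f (cutCLM n m x) η μ := by
  intro x y η μ hxy
  have : cutCLM n m x = cutCLM n m y := by
    funext k
    rw [cutCLM_apply, cutCLM_apply]
    split_ifs with h
    exacts [hxy k h, rfl]
  simp only [this]

/-- Evaluating any representation at the state with its later coordinates set to zero does not
change `f`, and it removes both the later summands and the dependence of the coefficients on later
coordinates. -/
theorem DependsOnFirst.exists_coeff {m : ℕ} {f : Fun3 n q} (hf : DependsOnFirst m f)
    (hs : StateLinear f) : ∃ G : Fin n → Fun3 n q, (∀ k, SmoothBounded (G k)) ∧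
      (∀ k, DependsOnFirst m (G k)) ∧
      ∀ x η μ, f x η μ = ∑ k, if k.val < m then G k x η μ * x k else 0 := by
  obtain ⟨G, hG, h⟩ := hs
  refine ⟨fun k x η μ => G k (cutCLM n m x) η μ, fun k => (hG k).comp_linear _,
    fun k => dependsOnFirst_cut m (G k), fun x η μ => ?_⟩
  rw [hf x (cutCLM n m x) η μ fun k hk => by rw [cutCLM_apply, if_pos hk], h]
  refine Finset.sum_congr rfl fun k _ => ?_
  rw [cutCLM_apply]
  split_ifs <;> simp

end Regularity

/-! ### Existence of the regressor matrices -/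

section Existence

variable {n q : ℕ} {P : Setup n q} {W : RegMat n q}

/-- Combinations of `z_1, …, z_m` with smooth bounded coefficients that depend on the first `m`
coordinates. -/
def ErrorCombination (P : Setup n q) (W : RegMat n q) (m : ℕ) (f : Fun3 n q) : Prop :=
  ∃ G : Fin n → Fun3 n q, (∀ k, SmoothBounded (G k)) ∧ (∀ k, DependsOnFirst m (G k)) ∧
    (∀ k x η μ, m ≤ k.val → G k x η μ = 0) ∧
    ∀ x η μ, f x η μ = ∑ k, G k x η μ * zErr P W x η μ k

theorem ErrorCombination.mono {m m' : ℕ} {f : Fun3 n q} (hf : ErrorCombination P W m f)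
    (h : m ≤ m') : ErrorCombination P W m' f := by
  obtain ⟨G, h1, h2, h3, h4⟩ := hf
  exact ⟨G, h1, fun k => (h2 k).mono h, fun k x η μ hk => h3 k x η μ (h.trans hk), h4⟩

theorem ErrorCombination.zero (m : ℕ) : ErrorCombination P W m fun _ _ _ => 0 :=
  ⟨fun _ _ _ _ => 0, fun _ => SmoothBounded.const 0, fun _ _ _ _ _ _ => rfl,
    fun _ _ _ _ _ => rfl, fun _ _ _ => by simp⟩

theorem ErrorCombination.add {m : ℕ} {f g : Fun3 n q} (hf : ErrorCombination P W m f)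
    (hg : ErrorCombination P W m g) :
    ErrorCombination P W m fun x η μ => f x η μ + g x η μ := by
  obtain ⟨G, h1, h2, h3, h4⟩ := hf
  obtain ⟨H, k1, k2, k3, k4⟩ := hg
  refine ⟨fun k x η μ => G k x η μ + H k x η μ, fun k => (h1 k).add (k1 k),
    fun k x y η μ hxy => ?_, fun k x η μ hk => ?_, fun x η μ => ?_⟩
  · simp only [h2 k x y η μ hxy, k2 k x y η μ hxy]
  · simp only [h3 k x η μ hk, k3 k x η μ hk, add_zero]
  · simp only [h4, k4, add_mul, Finset.sum_add_distrib]

theorem ErrorCombination.mul_left {m : ℕ} {f g : Fun3 n q} (hf : SmoothBounded f)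
    (hfd : DependsOnFirst m f) (hg : ErrorCombination P W m g) :
    ErrorCombination P W m fun x η μ => f x η μ * g x η μ := by
  obtain ⟨H, k1, k2, k3, k4⟩ := hg
  refine ⟨fun k x η μ => f x η μ * H k x η μ, fun k => hf.mul (k1 k),
    fun k x y η μ hxy => ?_, fun k x η μ hk => ?_, fun x η μ => ?_⟩
  · simp only [hfd x y η μ hxy, k2 k x y η μ hxy]
  · simp only [k3 k x η μ hk, mul_zero]
  · simp only [k4, mul_assoc, Finset.mul_sum]

theorem ErrorCombination.sum {m : ℕ} {ι : Type} {s : Finset ι} {F : ι → Fun3 n q}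
    (h : ∀ i ∈ s, ErrorCombination P W m (F i)) :
    ErrorCombination P W m fun x η μ => ∑ i ∈ s, F i x η μ := by
  classical
  induction s using Finset.induction_on with
  | empty => simpa using ErrorCombination.zero m
  | insert a s ha ih =>
    simp only [Finset.sum_insert ha]
    exact (h a (Finset.mem_insert_self a s)).add
      (ih fun i hi => h i (Finset.mem_insert_of_mem hi))

theorem ErrorCombination.zErr (k : Fin n) :
    ErrorCombination P W (k.val + 1) fun x η μ => zErr P W x η μ k := by
  refine ⟨fun l _ _ _ => if l = k then 1 else 0, fun _ => SmoothBounded.const _,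
    fun _ _ _ _ _ _ => rfl, fun l _ _ _ hl => if_neg ?_, fun x η μ => by simp⟩
  rintro rfl
  omega

theorem ErrorCombination.of_coord {m : ℕ} {f : Fun3 n q} (hf : DependsOnFirst m f)
    (hs : StateLinear f)
    (hx : ∀ k : Fin n, k.val < m → ErrorCombination P W (k.val + 1) fun x _ _ => x k) :
    ErrorCombination P W m f := by
  obtain ⟨G, hG, hGd, h⟩ := hf.exists_coeff hs
  have : f = fun x η μ => ∑ k, if k.val < m then G k x η μ * x k else 0 := by
    funext x η μ
    exact h x η μ
  rw [this]
  refine ErrorCombination.sum fun k _ => ?_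
  split_ifs with hk
  · exact ErrorCombination.mul_left (hG k) (hGd k) ((hx k hk).mono hk)
  · exact ErrorCombination.zero m

/-- Triangular inversion of x ↦ z: each coordinate is its error variable plus a virtual control, and
the latter is a combination of strictly earlier coordinates. Only smoothness of `W` is needed, not
`W_eq`, so the lemma is available while the matrices are still being built. -/
theorem ErrorCombination.coord (hP : P.Admissible)
    (hW : ∀ i a c, SmoothBounded fun x η μ => W i x η μ a c) (k : Fin n) :
    ErrorCombination P W (k.val + 1) fun x _ _ => x k := by
  obtain ⟨k, hk⟩ := k
  induction k using Nat.strong_induction_on with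
  | _ k ih =>
    have h1 : ErrorCombination P W k (alpha P W k) :=
      ErrorCombination.of_coord (dependsOnFirst_alpha P W k) (stateLinear_alpha hP hW k)
        fun l hl => ih l.val hl l.isLt
    have h2 := (ErrorCombination.zErr (P := P) (W := W) ⟨k, hk⟩).add (h1.mono (Nat.le_succ k))
    refine Eq.subst (motive := ErrorCombination P W (k + 1)) ?_ h2
    funext x η μ
    simp [_root_.zErr, zOf]

/-- Extension of a vector by zeros. -/
def extendCLM (n m : ℕ) : (Fin m → ℝ) →L[ℝ] (Fin n → ℝ) :=
  ContinuousLinearMap.pi fun k => if h : k.val < m then ContinuousLinearMap.proj ⟨k.val, h⟩ else 0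

theorem extendCLM_trunc {i k : Fin n} (hk : k.val < i.val + 1) (x : Fin n → ℝ) :
    extendCLM n (i.val + 1) (trunc i x) k = x k := by
  simp only [extendCLM, ContinuousLinearMap.coe_pi', dif_pos hk]
  rfl

theorem sum_trunc (i : Fin n) (f : Fin n → ℝ) (hf : ∀ k : Fin n, i.val + 1 ≤ k.val → f k = 0) :
    ∑ k, f k = ∑ a, f (Fin.castLE i.isLt a) := by
  rw [show ∑ a, f (Fin.castLE i.isLt a) = ∑ k ∈ Finset.univ.map (Fin.castLEEmb i.isLt), f k by
    rw [Finset.sum_map]; rfl]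
  refine (Finset.sum_subset (Finset.subset_univ _) fun k _ hk => hf k ?_).symm
  by_contra h
  exact hk (Finset.mem_map.2 ⟨⟨k.val, by omega⟩, Finset.mem_univ _, rfl⟩)

theorem exists_regressor_matrix (hP : P.Admissible)
    (hW : ∀ i a c, SmoothBounded fun x η μ => W i x η μ a c) (i : Fin n) :
    ∃ M : (Fin (i.val + 1) → ℝ) → (Fin q → ℝ) → ℝ → Matrix (Fin (i.val + 1)) (Fin q) ℝ,
      (∀ a c, SmoothBounded fun x η μ => M x η μ a c) ∧
      ∀ x η μ, wReg P W i x η μ = (M (trunc i x) η μ)ᵀ *ᵥ trunc i (zErr P W x η μ) := by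
  have h : ∀ c, ErrorCombination P W (i.val + 1) fun x η μ => wReg P W i x η μ c := fun c =>
    ErrorCombination.of_coord
      (fun x y η μ hxy => congrFun (dependsOnFirst_wOf (dependsOnFirst_alpha P W i.val)
        x y η μ hxy) c)
      (stateLinear_wOf hP (stateLinear_alpha hP hW) i c)
      fun k _ => ErrorCombination.coord hP hW k
  choose G h1 h2 h3 h4 using h
  refine ⟨fun y η μ => Matrix.of fun a c =>
      G c (Fin.castLE i.isLt a) (extendCLM n (i.val + 1) y) η μ,
    fun a c => (h1 c _).comp_linear _, fun x η μ => ?_⟩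
  funext c
  -- Coefficients of later error variables vanish, and the others do not see later coordinates;
  -- hence x may be replaced by the zero extension of its truncation.
  rw [show wReg P W i x η μ c = _ from h4 c x η μ, sum_trunc i _ fun k hk => by rw [h3 c k x η μ hk, zero_mul]]
  simp only [Matrix.mulVec, dotProduct, Matrix.transpose_apply, Matrix.of_apply, trunc]
  refine Finset.sum_congr rfl fun a _ => ?_
  rw [h2 c _ x (extendCLM n (i.val + 1) (trunc i x)) η μ fun k hk => (extendCLM_trunc hk x).symm]

theorem alphaStage_congr {W W' : RegMat n q} (m : ℕ) (h : ∀ i : Fin n, i.val < m → W i = W' i) :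
    alphaStage P W m = alphaStage P W' m := by
  induction m with
  | zero => rfl
  | succ m ih =>
    rw [alphaStage, alphaStage, ih fun i hi => h i (Nat.lt_succ_of_lt hi)]
    split_ifs with hm
    · congr 1
      funext x η μ
      simp only [alphaFormula, zeta, h ⟨m, Nat.lt_of_succ_lt hm⟩ (Nat.lt_succ_self m)]
    · rfl

theorem alpha_congr {W W' : RegMat n q} (m : ℕ) (h : ∀ i : Fin n, i.val < m → W i = W' i) :
    alpha P W m = alpha P W' m := congrFun (alphaStage_congr m h) m

/-- The matrices and the virtual controls are mutually recursive, but in a triangular way: w at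
index m involves only the entries of `W` of index below m. The matrices can thus be corrected one
index at a time without spoiling the identities already obtained. -/
theorem exists_regressor_matrices (hP : P.Admissible) (m : ℕ) :
    ∃ W : RegMat n q, (∀ i a c, SmoothBounded fun x η μ => W i x η μ a c) ∧
      ∀ i : Fin n, i.val < m → ∀ x η μ,
        wReg P W i x η μ = (W i (trunc i x) η μ)ᵀ *ᵥ trunc i (zErr P W x η μ) := by
  induction m with
  | zero => exact ⟨fun _ _ _ _ => 0, fun _ _ _ => SmoothBounded.const 0, fun _ hi => by omega⟩
  | succ m ih =>
    obtain ⟨W, hW, h⟩ := ih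
    by_cases hm : m < n
    · obtain ⟨M, hM, hMe⟩ := exists_regressor_matrix hP hW ⟨m, hm⟩
      have hal : ∀ j ≤ m, alpha P (Function.update W ⟨m, hm⟩ M) j = alpha P W j := fun j hj =>
        alpha_congr j fun i hi => Function.update_of_ne (by
          rintro rfl
          simp only at hi
          omega) _ _
      refine ⟨Function.update W ⟨m, hm⟩ M, fun i => ?_, fun i hi x η μ => ?_⟩
      · rcases eq_or_ne i ⟨m, hm⟩ with rfl | hne
        · simpa only [Function.update_self] using hM
        · simpa only [Function.update_of_ne hne] using hW i
      · have hi' : i.val ≤ m := Nat.le_of_lt_succ hi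
        have hw : wReg P (Function.update W ⟨m, hm⟩ M) i x η μ = wReg P W i x η μ :=
          wOf_congr P x η μ (hal _ hi')
        have hz : trunc i (zErr P (Function.update W ⟨m, hm⟩ M) x η μ) =
            trunc i (zErr P W x η μ) := by
          funext a
          exact zOf_congr x η μ (hal _ (by
            have := a.isLt
            simp only [Fin.val_castLE]
            omega))
        rw [hw, hz]
        rcases eq_or_ne i ⟨m, hm⟩ with rfl | hne
        · rw [Function.update_self, hMe]
        · rw [Function.update_of_ne hne, h i (lt_of_le_of_ne hi' fun h => hne (Fin.ext h))]
    · exact ⟨W, hW, fun i _ => h i (by omega)⟩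

theorem exists_isRegressorChoice [NeZero n] (hP : P.Admissible) :
    ∃ (W : RegMat n q) (psiBar : (Fin n → ℝ) → (Fin q → ℝ) → ℝ → (Fin n → ℝ)),
      IsRegressorChoice P W psiBar := by
  obtain ⟨W, hW, h⟩ := exists_regressor_matrices (q := q) hP n
  have hpsi : ErrorCombination P W n (psi P W) := ErrorCombination.of_coord
    (fun x y η μ hxy => by rw [show x = y from funext fun k => hxy k k.isLt])
    (stateLinear_psi hP hW) fun k _ => ErrorCombination.coord hP hW k
  obtain ⟨G, hG, _, _, hsum⟩ := hpsi
  exact ⟨W, fun x η μ k => G k x η μ, hW, fun i x η μ _ => h i i.isLt x η μ, hG,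
    fun x η μ _ => hsum x η μ⟩

end Existence

/-! ### The derivative of the Lyapunov function -/

section Lyapunov

variable {n q : ℕ} {P : Setup n q} {W : RegMat n q}
  {psiBar : (Fin n → ℝ) → (Fin q → ℝ) → ℝ → (Fin n → ℝ)}

/-- The time derivative of `z_i` along the closed loop. -/
noncomputable def errField [NeZero n] (P : Setup n q) (W : RegMat n q) (θ : Fin q → ℝ) (b u : ℝ)
    (x : Fin n → ℝ) (η : Fin q → ℝ) (μ : ℝ) (i : Fin n) : ℝ :=
  systemField P θ b u x i - (∑ j ∈ Finset.Iio i, (alpha P W i.val).dX j x η μ *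
      systemField P θ b u x j
    + (alpha P W i.val).dPar x η μ (P.Gam *ᵥ tau P W (lastIdx n) x η μ)
    + (alpha P W i.val).dMu x η μ * (P.lam * μ))

theorem le_lastIdx [NeZero n] (i : Fin n) : i ≤ lastIdx n := Fin.mk_le_of_le_val (by
  have := i.isLt
  simp only [lastIdx]
  omega)

theorem lt_of_ne_lastIdx [NeZero n] {i : Fin n} (h : i ≠ lastIdx n) : i.val + 1 < n := by
  have h1 : i.val ≠ n - 1 := fun h2 => h (Fin.ext h2)
  have := i.isLt
  omega

/-- Both sides add the products over adjacent pairs. This cancels the coupling to z_{i+1} against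
the term -z_{i-1} placed in the virtual controls. -/
theorem sum_succCoord_eq_sum_predCoord {n : ℕ} (s : Fin n → ℝ) :
    ∑ i, s i * succCoord s i = ∑ i, s i * predCoord s i := by
  have h1 : ∀ i : Fin n, s i * succCoord s i =
      ∑ j : Fin n, if j.val = i.val + 1 then s i * s j else 0 := by
    intro i
    unfold succCoord
    split_ifs with h
    · rw [Finset.sum_eq_single ⟨i.val + 1, h⟩ (fun j _ hj => if_neg fun h => hj (Fin.ext h))
        (by simp), if_pos rfl]
    · rw [mul_zero, Finset.sum_eq_zero fun j _ => if_neg (by omega)]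
  have h2 : ∀ i : Fin n, s i * predCoord s i =
      ∑ j : Fin n, if i.val = j.val + 1 then s j * s i else 0 := by
    intro i
    unfold predCoord
    split_ifs with h
    · rw [Finset.sum_eq_single ⟨i.val - 1, by omega⟩ (fun j _ hj => if_neg fun h => hj (Fin.ext (by
        simp only
        omega))) (by simp), if_pos (by simp only; omega), mul_comm]
    · rw [mul_zero, Finset.sum_eq_zero fun j _ => if_neg (by omega)]
  simp only [h1, h2]
  exact Finset.sum_comm

theorem systemField_of_ne [NeZero n] {θ : Fin q → ℝ} {b u : ℝ} {x : Fin n → ℝ} {i : Fin n}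
    (h : i ≠ lastIdx n) :
    systemField P θ b u x i = P.phi i (trunc i x) ⬝ᵥ θ + succCoord x i := by
  simp only [systemField, succCoord, dif_pos (lt_of_ne_lastIdx h)]

theorem systemField_last [NeZero n] {θ : Fin q → ℝ} {b u : ℝ} {x : Fin n → ℝ} :
    systemField P θ b u x (lastIdx n) =
      P.phi (lastIdx n) (trunc (lastIdx n) x) ⬝ᵥ θ + b * u := by
  have : ¬ (lastIdx n).val + 1 < n := by
    simp only [lastIdx]
    omega
  simp only [systemField, dif_neg this]

theorem wReg_dotProduct (i : Fin n) (θ : Fin q → ℝ) (x : Fin n → ℝ) (η : Fin q → ℝ) (μ : ℝ) :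
    wReg P W i x η μ ⬝ᵥ θ = P.phi i (trunc i x) ⬝ᵥ θ -
      ∑ j ∈ Finset.Iio i, (alpha P W i.val).dX j x η μ * (P.phi j (trunc j x) ⬝ᵥ θ) := by
  simp only [wReg, wOf, sub_dotProduct, sum_dotProduct, smul_dotProduct, smul_eq_mul]

/-- The virtual control leaves the parameter error, damping, neighbour coupling, the mismatch τ_i -
τ_n (the update law uses the last tuning function) and a compensating sum. In the last equation no
virtual control is available, and `psi` collects whatever the input has to dominate. -/
theorem errField_eq [NeZero n] (θ : Fin q → ℝ) (b u : ℝ) (x : Fin n → ℝ) (η : Fin q → ℝ) (μ : ℝ)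
    (i : Fin n) :
    errField P W θ b u x η μ i = wReg P W i x η μ ⬝ᵥ (θ - η)
      + (if i = lastIdx n then b * u + psi P W x η μ else
          succCoord (zErr P W x η μ) i - (P.k i + zeta P W i x η μ) * zErr P W x η μ i)
      - predCoord (zErr P W x η μ) i
      + (alpha P W i.val).dPar x η μ
          (P.Gam *ᵥ (tau P W i x η μ - tau P W (lastIdx n) x η μ))
      + ∑ j ∈ Finset.Iio i, (alpha P W j.val).dPar x η μ
          (P.Gam *ᵥ ((μ * sErr P W x η μ j) • wReg P W i x η μ)) := by
  have hsum : ∑ j ∈ Finset.Iio i, (alpha P W i.val).dX j x η μ * systemField P θ b u x j =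
      ∑ j ∈ Finset.Iio i, (alpha P W i.val).dX j x η μ * (P.phi j (trunc j x) ⬝ᵥ θ) +
      ∑ j ∈ Finset.Iio i, (alpha P W i.val).dX j x η μ * succCoord x j := by
    rw [← Finset.sum_add_distrib]
    refine Finset.sum_congr rfl fun j hj => ?_
    rw [systemField_of_ne ((Finset.mem_Iio.1 hj).trans_le (le_lastIdx i)).ne, mul_add]
  have hdp : (alpha P W i.val).dPar x η μ
      (P.Gam *ᵥ (tau P W i x η μ - tau P W (lastIdx n) x η μ)) =
      (alpha P W i.val).dPar x η μ (P.Gam *ᵥ tau P W i x η μ) -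
      (alpha P W i.val).dPar x η μ (P.Gam *ᵥ tau P W (lastIdx n) x η μ) := by
    simp only [Fun3.dPar, Matrix.mulVec_sub, map_sub]
  rw [errField, hsum, hdp, dotProduct_sub, wReg_dotProduct i θ]
  by_cases hi : i = lastIdx n
  · rw [if_pos hi]
    subst hi
    rw [systemField_last]
    simp only [psi]
    have : (lastIdx n).val = n - 1 := rfl
    rw [this]
    ring
  · rw [if_neg hi, systemField_of_ne hi]
    have hz : succCoord (zErr P W x η μ) i = succCoord x i - alpha P W (i.val + 1) x η μ := by
      simp only [succCoord, dif_pos (lt_of_ne_lastIdx hi)]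
      rfl
    have hal := congrFun (congrFun (congrFun (alpha_succ P W i.val (lt_of_ne_lastIdx hi)) x) η) μ
    rw [hz, hal]
    simp only [alphaFormula, zErr, sErr, wReg, tau, Pi.smul_apply, smul_eq_mul]
    ring

theorem dPar_smul (f : Fun3 n q) (x : Fin n → ℝ) (η : Fin q → ℝ) (μ c : ℝ) (v : Fin q → ℝ) :
    f.dPar x η μ (P.Gam *ᵥ (c • v)) = c * f.dPar x η μ (P.Gam *ᵥ v) := by
  simp only [Fun3.dPar, Matrix.mulVec_smul, map_smul, smul_eq_mul]

theorem tau_eq (i : Fin n) (x : Fin n → ℝ) (η : Fin q → ℝ) (μ : ℝ) :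
    tau P W i x η μ = ∑ j ∈ Finset.Iic i, (μ * sErr P W x η μ j) • wReg P W j x η μ := rfl

theorem Iic_lastIdx [NeZero n] : Finset.Iic (lastIdx n) = Finset.univ :=
  Finset.eq_univ_iff_forall.2 fun i => Finset.mem_Iic.2 (le_lastIdx i)

theorem dPar_tau_sub [NeZero n] (f : Fun3 n q) (i : Fin n) (x : Fin n → ℝ) (η : Fin q → ℝ) (μ : ℝ) :
    f.dPar x η μ (P.Gam *ᵥ (tau P W i x η μ - tau P W (lastIdx n) x η μ)) =
      -∑ j ∈ Finset.Ioi i, μ * sErr P W x η μ j *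
        f.dPar x η μ (P.Gam *ᵥ wReg P W j x η μ) := by
  have h : tau P W i x η μ - tau P W (lastIdx n) x η μ =
      -∑ j ∈ Finset.Ioi i, (μ * sErr P W x η μ j) • wReg P W j x η μ := by
    rw [tau_eq, tau_eq, Iic_lastIdx, sub_eq_iff_eq_add, neg_add_eq_sub, eq_sub_iff_add_eq,
      ← Finset.sum_union]
    · congr 1
      ext j
      simpa using le_or_gt j i
    · exact Finset.disjoint_left.2 fun j h1 h2 =>
        absurd (Finset.mem_Iic.1 h1) (not_le.2 (Finset.mem_Ioi.1 h2))
  rw [h]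
  simp only [← dPar_smul]
  simp only [Fun3.dPar, Matrix.mulVec_neg, map_neg, Matrix.mulVec_sum, map_sum]

/-- For i < j the product r_i r_j d_ij occurs with a minus sign in row i and with a plus sign in row
j. The first is the mismatch of tuning functions, the second the compensating sum in the virtual
control. -/
theorem sum_tuning_eq_zero (d : Fin n → Fin n → ℝ) (r : Fin n → ℝ) :
    ∑ i, r i * (-∑ j ∈ Finset.Ioi i, r j * d i j + ∑ j ∈ Finset.Iio i, r j * d j i) = 0 := by
  have h1 : ∀ i, ∑ j ∈ Finset.Ioi i, r j * d i j = ∑ j, if i < j then r j * d i j else 0 := by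
    intro i
    rw [← Finset.sum_filter]
    congr 1
    ext j
    simp
  have h2 : ∀ i, ∑ j ∈ Finset.Iio i, r j * d j i = ∑ j, if j < i then r j * d j i else 0 := by
    intro i
    rw [← Finset.sum_filter]
    congr 1
    ext j
    simp
  simp only [h1, h2, mul_add, mul_neg, Finset.sum_add_distrib, Finset.sum_neg_distrib,
    Finset.mul_sum, mul_ite, mul_zero]
  rw [neg_add_eq_zero, Finset.sum_comm]
  refine Finset.sum_congr rfl fun i _ => Finset.sum_congr rfl fun j _ => ?_
  split_ifs
  · ring
  · rfl

/-- Cauchy–Schwarz over the entries of the matrix, followed by 4AB ≤ (A + B)² with A = |M|²a² and B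
= |v|². Comparing squares avoids the root of `frobSq`. -/
theorem mul_transpose_mulVec_dotProduct_le {m : ℕ} (M : Matrix (Fin m) (Fin q) ℝ)
    (v : Fin m → ℝ) (p : Fin q → ℝ) (a : ℝ) {δ : ℝ} (hδ : 0 ≤ δ) (hp : euclNorm p ≤ δ) :
    a * ((Mᵀ *ᵥ v) ⬝ᵥ p) ≤ δ / 2 * (frobSq M * a ^ 2 + ∑ j, v j ^ 2) := by
  have hp2 : ∑ c, p c ^ 2 ≤ δ ^ 2 := (Real.sqrt_le_left hδ).1 hp
  have hF : 0 ≤ frobSq M := Finset.sum_nonneg fun _ _ => Finset.sum_nonneg fun _ _ => sq_nonneg _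
  have hv : 0 ≤ ∑ j, v j ^ 2 := Finset.sum_nonneg fun _ _ => sq_nonneg _
  have h1 : (Mᵀ *ᵥ v) ⬝ᵥ p = ∑ z : Fin m × Fin q, M z.1 z.2 * (v z.1 * p z.2) := by
    rw [Fintype.sum_prod_type, Finset.sum_comm]
    simp only [Matrix.mulVec, dotProduct, Matrix.transpose_apply, Finset.sum_mul, mul_assoc]
  have h2 : ((Mᵀ *ᵥ v) ⬝ᵥ p) ^ 2 ≤ frobSq M * ((∑ j, v j ^ 2) * ∑ c, p c ^ 2) := by
    rw [h1]
    refine (Finset.sum_mul_sq_le_sq_mul_sq _ _ _).trans_eq ?_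
    simp only [frobSq, Fintype.sum_prod_type, mul_pow, Finset.sum_mul_sum]
  have h3 : (a * ((Mᵀ *ᵥ v) ⬝ᵥ p)) ^ 2 ≤ (δ / 2 * (frobSq M * a ^ 2 + ∑ j, v j ^ 2)) ^ 2 := by
    calc _ = a ^ 2 * ((Mᵀ *ᵥ v) ⬝ᵥ p) ^ 2 := by ring
      _ ≤ a ^ 2 * (frobSq M * ((∑ j, v j ^ 2) * δ ^ 2)) := by gcongr; exact h2.trans (by gcongr)
      _ ≤ _ := by
        have := mul_nonneg (sq_nonneg δ) (sq_nonneg (frobSq M * a ^ 2 - ∑ j, v j ^ 2))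
        nlinarith
  exact (le_abs_self _).trans (abs_le_of_sq_le_sq h3 (by positivity))

/-- The square s_j² occurs once for every i ≥ j. This count is the multiple of δ in ζ. -/
theorem sum_sum_trunc_sq (s : Fin n → ℝ) :
    ∑ i, ∑ a, trunc i s a ^ 2 = ∑ j : Fin n, ((n : ℝ) - j.val) * s j ^ 2 := by
  have h1 : ∀ i : Fin n, ∑ a, trunc i s a ^ 2 = ∑ j, if j ≤ i then s j ^ 2 else 0 := by
    intro i
    rw [sum_trunc i _ fun k hk => if_neg (by rw [Fin.le_def]; omega)]
    refine Finset.sum_congr rfl fun a _ => ?_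
    rw [if_pos (by
      rw [Fin.le_def]
      have := a.isLt
      simp only [Fin.val_castLE]
      omega)]
    rfl
  simp only [h1]
  rw [Finset.sum_comm]
  refine Finset.sum_congr rfl fun j _ => ?_
  rw [← Finset.sum_filter, Finset.sum_const, nsmul_eq_mul]
  congr 1
  rw [show (Finset.univ.filter fun i => j ≤ i) = Finset.Ici j by ext; simp, Fin.card_Ici,
    Nat.cast_sub j.isLt.le]

/-- After the cancellations only the terms with θ - l and with ψ are estimated. The gains ζ_i are
exactly what these estimates cost for i < n. In the last equation the same cost is -k_n + κ, and the
term κ s_n² is kept on the right since it equals ξ'. -/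
theorem lyapunov_rate_le [NeZero n] (hP : P.Admissible) (hc : IsRegressorChoice P W psiBar)
    {θ l : Fin q → ℝ} (hθ : euclNorm (θ - l) ≤ P.del) (b u : ℝ) (x : Fin n → ℝ) (η : Fin q → ℝ)
    {μ : ℝ} (hμ : 0 < μ) :
    ∑ i, sErr P W x η μ i * (P.lam * sErr P W x η μ i + μ * errField P W θ b u x η μ i)
        + tau P W (lastIdx n) x η μ ⬝ᵥ (η - l) ≤
      -∑ i, P.k i * sErr P W x η μ i ^ 2
        + kappaGain P W psiBar x η μ * sErr P W x η μ (lastIdx n) ^ 2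
        + μ * sErr P W x η μ (lastIdx n) * (b * u) := by
  set s := sErr P W x η μ with hs
  have hsz : ∀ i, s i = μ * zErr P W x η μ i := fun i => rfl
  set L := lastIdx n with hL
  have hpred : ∀ i, μ * predCoord (zErr P W x η μ) i = predCoord s i := by
    intro i
    unfold predCoord
    split_ifs
    · rfl
    · simp
  have hsucc : ∀ i, μ * succCoord (zErr P W x η μ) i = succCoord s i := by
    intro i
    unfold succCoord
    split_ifs
    · rfl
    · simp
  have hsuccL : succCoord s L = 0 := by
    unfold succCoord
    rw [dif_neg]
    simp only [hL, lastIdx]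
    omega
  have htau : tau P W L x η μ ⬝ᵥ (η - l) = ∑ i, s i * μ * (wReg P W i x η μ ⬝ᵥ (η - l)) := by
    rw [tau_eq, Iic_lastIdx, sum_dotProduct]
    simp only [smul_dotProduct, smul_eq_mul, ← hs, mul_comm μ]
  have hskew := sum_tuning_eq_zero (fun i j => (alpha P W i.val).dPar x η μ
    (P.Gam *ᵥ wReg P W j x η μ)) (fun i => μ * s i)
  have hmain : ∑ i, s i * (P.lam * s i + μ * errField P W θ b u x η μ i)
        + tau P W L x η μ ⬝ᵥ (η - l) =
      ∑ i, (P.lam * s i ^ 2 + s i * (μ * (wReg P W i x η μ ⬝ᵥ (θ - l)))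
        + if i = L then μ * s i * (b * u) + s i * (μ * psi P W x η μ)
          else -(P.k i + zeta P W i x η μ) * s i ^ 2) := by
    -- The vanishing tuning sum and the vanishing telescoping sum are inserted in place of 0, so
    -- that the identity can be verified for each i separately.
    rw [← sub_eq_zero, htau, ← Finset.sum_add_distrib, ← Finset.sum_sub_distrib, ← hskew,
      ← sub_eq_zero, ← Finset.sum_sub_distrib]
    have htel := sub_eq_zero.2 (sum_succCoord_eq_sum_predCoord s)
    rw [← Finset.sum_sub_distrib] at htel
    rw [← htel]
    refine Finset.sum_congr rfl fun i _ => ?_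
    rw [errField_eq, dPar_tau_sub]
    simp only [dPar_smul, ← hs, ← hpred, ← hL]
    have hdot : wReg P W i x η μ ⬝ᵥ (θ - l) = wReg P W i x η μ ⬝ᵥ (θ - η) +
      wReg P W i x η μ ⬝ᵥ (η - l) := by rw [← dotProduct_add, sub_add_sub_cancel]
    rw [hdot]
    split_ifs with hi
    · rw [hi, hsuccL]
      ring
    · rw [← hsucc, hsz]
      ring
  have hδ := hP.del_pos
  have hε := hP.eps_pos
  have hw : ∀ i, s i * (μ * (wReg P W i x η μ ⬝ᵥ (θ - l))) ≤
      P.del / 2 * (frobSq (W i (trunc i x) η μ) * s i ^ 2 + ∑ a, trunc i s a ^ 2) := by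
    intro i
    have h1 : μ * (wReg P W i x η μ ⬝ᵥ (θ - l)) =
        ((W i (trunc i x) η μ)ᵀ *ᵥ trunc i s) ⬝ᵥ (θ - l) := by
      rw [hc.W_eq i x η μ hμ, ← smul_eq_mul, ← smul_dotProduct, ← Matrix.mulVec_smul]
      rfl
    rw [h1]
    exact mul_transpose_mulVec_dotProduct_le _ _ _ _ hδ.le hθ
  have hpsi : s L * (μ * psi P W x η μ) ≤
      1 / 2 * (P.eps * ∑ a, psiBar x η μ a ^ 2) * s L ^ 2 + 1 / (2 * P.eps) * ∑ i, s i ^ 2 := by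
    have h1 : μ * psi P W x η μ = ∑ i, psiBar x η μ i * s i := by
      rw [hc.psi_eq x η μ hμ, dotProduct, Finset.mul_sum]
      exact Finset.sum_congr rfl fun i _ => by rw [hsz]; ring
    rw [h1, Finset.mul_sum, Finset.mul_sum, Finset.mul_sum, Finset.mul_sum, Finset.sum_mul,
      ← Finset.sum_add_distrib]
    refine Finset.sum_le_sum fun i _ => ?_
    -- Young's inequality with weight ε, one component of ψ̄ at a time.
    have h2 : 0 ≤ 1 / (2 * P.eps) * (P.eps * (psiBar x η μ i * s L) - s i) ^ 2 := by positivity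
    have h3 : 1 / (2 * P.eps) * (P.eps * (psiBar x η μ i * s L) - s i) ^ 2 =
        1 / 2 * (P.eps * psiBar x η μ i ^ 2) * s L ^ 2 + 1 / (2 * P.eps) * s i ^ 2
          - s L * (psiBar x η μ i * s i) := by
      field_simp
      ring
    linarith
  rw [hmain]
  -- At the last index the multiple of δ equals 1; this is the summand 1 in δ(|W_n|² + 1) in κ.
  have hLval : ((n : ℝ) - (L.val : ℝ)) = 1 := by
    have : L.val + 1 = n := by
      have := NeZero.pos n
      simp only [hL, lastIdx]
      omega
    rw [sub_eq_iff_eq_add, add_comm]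
    exact_mod_cast this.symm
  have hsplit : ∑ i, (P.lam * s i ^ 2 + s i * (μ * (wReg P W i x η μ ⬝ᵥ (θ - l)))
        + if i = L then μ * s i * (b * u) + s i * (μ * psi P W x η μ)
          else -(P.k i + zeta P W i x η μ) * s i ^ 2) ≤
      ∑ i, (P.lam * s i ^ 2 + P.del / 2 * (frobSq (W i (trunc i x) η μ) * s i ^ 2)
        + P.del / 2 * (((n : ℝ) - i.val) * s i ^ 2) + 1 / (2 * P.eps) * s i ^ 2
        + if i = L then μ * s i * (b * u)
            + 1 / 2 * (P.eps * ∑ a, psiBar x η μ a ^ 2) * s i ^ 2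
          else -(P.k i + zeta P W i x η μ) * s i ^ 2) := by
    have e1 : ∀ f g : Fin n → ℝ, ∑ i, (if i = L then f i else g i) =
        f L + ∑ i, (if i = L then 0 else g i) := by
      intro f g
      have : ∀ i, (if i = L then f i else g i) =
          (if i = L then f i else 0) + (if i = L then 0 else g i) := by
        intro i
        split_ifs <;> simp
      simp only [this, Finset.sum_add_distrib, Finset.sum_ite_eq', Finset.mem_univ, if_true]
    have e2 := Finset.sum_le_sum fun i (_ : i ∈ Finset.univ) => hw i
    simp only [mul_add, Finset.sum_add_distrib] at e2
    rw [← Finset.mul_sum (f := fun i => ∑ a, trunc i s a ^ 2), sum_sum_trunc_sq,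
      Finset.mul_sum] at e2
    simp only [Finset.sum_add_distrib]
    rw [e1 (fun i => μ * s i * (b * u) + s i * (μ * psi P W x η μ)),
      e1 (fun i => μ * s i * (b * u) + 1 / 2 * (P.eps * ∑ a, psiBar x η μ a ^ 2) * s i ^ 2)]
    rw [Finset.mul_sum (f := fun i => s i ^ 2) (a := 1 / (2 * P.eps))] at hpsi
    linarith
  refine hsplit.trans (le_of_eq ?_)
  have e3 : kappaGain P W psiBar x η μ * s L ^ 2 + μ * s L * (b * u) =
      ∑ i, if i = L then kappaGain P W psiBar x η μ * s i ^ 2 + μ * s i * (b * u) else 0 := by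
    simp only [Finset.sum_ite_eq', Finset.mem_univ, if_true]
  have heps : 1 / (2 * P.eps) = 1 / 2 * (1 / P.eps) := by rw [one_div_mul_one_div]
  rw [add_assoc, e3, ← Finset.sum_neg_distrib, ← Finset.sum_add_distrib]
  refine Finset.sum_congr rfl fun i _ => ?_
  split_ifs with hi
  · rw [hi]
    unfold kappaGain
    rw [← hL, hLval]
    rw [heps]
    ring
  · simp only [zeta]
    rw [heps]
    ring

end Lyapunov

/-! ### Monotonicity with finitely many exceptional points -/

/-- Induction on the exceptional set: the interval is cut at an exceptional interior point, and
continuity makes both closed halves available. -/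
theorem le_of_deriv_nonpos_off_finite {f : ℝ → ℝ} {S : Set ℝ} (hS : S.Finite) {a b : ℝ}
    (hab : a ≤ b) (hc : ContinuousOn f (Set.Icc a b))
    (hd : ∀ t ∈ Set.Ioo a b, t ∉ S → ∃ f' ≤ 0, HasDerivAt f f' t) : f b ≤ f a := by
  induction S, hS using Set.Finite.induction_on generalizing a b with
  | empty =>
    refine antitoneOn_of_deriv_nonpos (convex_Icc a b) hc ?_ ?_ (Set.left_mem_Icc.2 hab)
      (Set.right_mem_Icc.2 hab) hab
    · intro t ht
      rw [interior_Icc] at ht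
      obtain ⟨f', -, h⟩ := hd t ht (Set.notMem_empty t)
      exact h.differentiableAt.differentiableWithinAt
    · intro t ht
      rw [interior_Icc] at ht
      obtain ⟨f', h0, h⟩ := hd t ht (Set.notMem_empty t)
      rwa [h.deriv]
  | @insert c S _ _ ih =>
    by_cases hcm : c ∈ Set.Ioo a b
    · refine (ih hcm.2.le (hc.mono (Set.Icc_subset_Icc_left hcm.1.le)) fun t ht htS => ?_).trans
        (ih hcm.1.le (hc.mono (Set.Icc_subset_Icc_right hcm.2.le)) fun t ht htS => ?_)
      · refine hd t ⟨hcm.1.trans ht.1, ht.2⟩ fun h => ?_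
        rcases Set.mem_insert_iff.1 h with h | h
        exacts [ht.1.ne' h, htS h]
      · refine hd t ⟨ht.1, ht.2.trans hcm.2⟩ fun h => ?_
        rcases Set.mem_insert_iff.1 h with h | h
        exacts [ht.2.ne h, htS h]
    · refine ih hab hc fun t ht htS => hd t ht fun h => ?_
      rcases Set.mem_insert_iff.1 h with h | h
      exacts [hcm (h ▸ ht), htS h]

theorem timeInterval_mem_nhds {T : EReal} {t : ℝ} (ht : t ∈ timeInterval T) (h0 : 0 < t) :
    timeInterval T ∈ 𝓝 t := by
  have h1 : IsOpen {t : ℝ | (t : EReal) < T} :=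
    isOpen_lt continuous_coe_real_ereal continuous_const
  filter_upwards [h1.mem_nhds ht.2, lt_mem_nhds h0] with s hs hs0
  exact ⟨hs0.le, hs⟩

theorem Icc_subset_timeInterval {T : EReal} {s t : ℝ} (hs : 0 ≤ s) (ht : t ∈ timeInterval T) :
    Set.Icc s t ⊆ timeInterval T := fun _ hr =>
  ⟨hs.trans hr.1, lt_of_le_of_lt (EReal.coe_le_coe_iff.2 hr.2) ht.2⟩

/-- Times at which both time-varying parameters are continuous. -/
def RegularTime {E : Type} [TopologicalSpace E] (θ : ℝ → E) (b : ℝ → ℝ) (t : ℝ) : Prop :=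
  ContinuousWithinAt θ (Set.Ici 0) t ∧ ContinuousWithinAt b (Set.Ici 0) t

theorem finite_not_regularTime {E : Type} [TopologicalSpace E] {θ : ℝ → E} {b : ℝ → ℝ}
    (hθ : PiecewiseContinuous θ) (hb : PiecewiseContinuous b) (T : ℝ) :
    {t : ℝ | 0 ≤ t ∧ t ≤ T ∧ ¬ RegularTime θ b t}.Finite := by
  refine ((hθ.finite_disc T).union (hb.finite_disc T)).subset ?_
  rintro t ⟨h0, h1, h2⟩
  rcases not_and_or.1 h2 with h | h
  exacts [Or.inl ⟨h0, h1, h⟩, Or.inr ⟨h0, h1, h⟩]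

theorem antitoneOn_timeInterval {E : Type} [TopologicalSpace E] {θ : ℝ → E} {b : ℝ → ℝ}
    (hθ : PiecewiseContinuous θ) (hb : PiecewiseContinuous b) {T : EReal} {f : ℝ → ℝ}
    (hc : ContinuousOn f (timeInterval T))
    (hd : ∀ t ∈ timeInterval T, 0 < t → RegularTime θ b t → ∃ f' ≤ 0, HasDerivAt f f' t) :
    AntitoneOn f (timeInterval T) := by
  intro s hs t ht hst
  refine le_of_deriv_nonpos_off_finite (finite_not_regularTime hθ hb t) hst
    (hc.mono (Icc_subset_timeInterval hs.1 ht)) fun r hr hrS => ?_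
  have hr0 : 0 < r := hs.1.trans_lt hr.1
  refine hd r (Icc_subset_timeInterval hs.1 ht ⟨hr.1.le, hr.2.le⟩) hr0 ?_
  by_contra h
  exact hrS ⟨hr0.le, hr.2.le, h⟩

/-! ### Chain rule -/

section Chain

variable {n q : ℕ} {P : Setup n q} {W : RegMat n q}

theorem hasDerivAt_fun3 {f : Fun3 n q} (hf : StateLinear f) {x : ℝ → Fin n → ℝ}
    {η : ℝ → Fin q → ℝ} {ν : ℝ → ℝ} {x' : Fin n → ℝ} {η' : Fin q → ℝ} {ν' t : ℝ}
    (hx : HasDerivAt x x' t) (hη : HasDerivAt η η' t) (hν : HasDerivAt ν ν' t) :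
    HasDerivAt (fun t => f (x t) (η t) (ν t))
      (∑ j, f.dX j (x t) (η t) (ν t) * x' j + f.dPar (x t) (η t) (ν t) η'
        + f.dMu (x t) (η t) (ν t) * ν') t := by
  have hF : HasFDerivAt (fun z : (Fin n → ℝ) × (Fin q → ℝ) × ℝ => f z.1 z.2.1 z.2.2) _
      (x t, η t, ν t) :=
    (hf.smoothBounded.contDiff.differentiable (by simp) _).hasFDerivAt
  set L := fderiv ℝ (fun z : (Fin n → ℝ) × (Fin q → ℝ) × ℝ => f z.1 z.2.1 z.2.2)
    (x t, η t, ν t) with hL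
  have h1 := (HasFDerivAt.comp (f := fun y => (y, η t, ν t)) (x t) hF
    ((hasFDerivAt_id (x t)).prodMk (hasFDerivAt_const (η t, ν t) (x t)))).fderiv
  have h2 := (HasFDerivAt.comp (f := fun y => (x t, y, ν t)) (η t) hF ((hasFDerivAt_const (x t) (η t)).prodMk
    ((hasFDerivAt_id (η t)).prodMk (hasFDerivAt_const (ν t) (η t))))).fderiv
  have h3 := (HasFDerivAt.comp_hasDerivAt (f := fun y => (x t, η t, y)) (ν t) hF ((hasDerivAt_const (ν t) (x t)).prodMk
    ((hasDerivAt_const (ν t) (η t)).prodMk (hasDerivAt_id (ν t))))).deriv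
  have h4 := HasFDerivAt.comp_hasDerivAt (f := fun t => (x t, η t, ν t)) t hF (hx.prodMk (hη.prodMk hν))
  refine h4.congr_deriv ?_
  have e1 : ∑ j, f.dX j (x t) (η t) (ν t) * x' j = L (x', 0, 0) := by
    have : ∑ j, f.dX j (x t) (η t) (ν t) * x' j =
        fderiv ℝ (fun y => f y (η t) (ν t)) (x t) x' := (clm_pi_apply _ _).symm
    rw [this]
    exact (congrArg (fun M => M x') h1).trans rfl
  have e2 : f.dPar (x t) (η t) (ν t) η' = L (0, η', 0) :=
    (congrArg (fun M => M η') h2).trans rfl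
  have e3 : f.dMu (x t) (η t) (ν t) * ν' = L (0, 0, ν') := by
    have : f.dMu (x t) (η t) (ν t) = L (0, 0, 1) := h3
    rw [this, mul_comm, ← smul_eq_mul, ← map_smul]
    simp
  rw [e1, e2, e3, ← map_add, ← map_add]
  simp

theorem continuousOn_fun3 {f : Fun3 n q} (hf : SmoothBounded f) {x : ℝ → Fin n → ℝ}
    {η : ℝ → Fin q → ℝ} {ν : ℝ → ℝ} {s : Set ℝ} (hx : ContinuousOn x s)
    (hη : ContinuousOn η s) (hν : ContinuousOn ν s) :
    ContinuousOn (fun t => f (x t) (η t) (ν t)) s :=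
  hf.contDiff.continuous.comp_continuousOn (hx.prodMk (hη.prodMk hν))

theorem hasDerivAt_zErr [NeZero n] (hP : P.Admissible)
    (hW : ∀ i a c, SmoothBounded fun x η μ => W i x η μ a c) {θ : Fin q → ℝ} {b u : ℝ}
    {x : ℝ → Fin n → ℝ} {η : ℝ → Fin q → ℝ} {t : ℝ}
    (hx : HasDerivAt x (systemField P θ b u (x t)) t)
    (hη : HasDerivAt η (P.Gam *ᵥ tau P W (lastIdx n) (x t) (η t) (Real.exp (P.lam * t))) t)
    (i : Fin n) :
    HasDerivAt (fun t => zErr P W (x t) (η t) (Real.exp (P.lam * t)) i)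
      (errField P W θ b u (x t) (η t) (Real.exp (P.lam * t)) i) t := by
  have hν : HasDerivAt (fun t => Real.exp (P.lam * t)) (P.lam * Real.exp (P.lam * t)) t := by
    simpa [mul_comm] using ((hasDerivAt_id t).const_mul P.lam).exp
  have h1 := hasDerivAt_fun3 (stateLinear_alpha (W := W) hP hW i.val) hx hη hν
  refine ((hasDerivAt_pi.1 hx i).sub h1).congr_deriv ?_
  rw [errField]
  congr 3
  -- `errField` sums only over j < i; the remaining partial derivatives vanish because the virtual
  -- control does not depend on those coordinates.
  symm
  refine Finset.sum_subset (Finset.subset_univ _) fun j _ hj => ?_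
  rw [(dependsOnFirst_alpha P W i.val).dX_eq_zero (stateLinear_alpha hP hW i.val)
    (by simpa using hj), zero_mul]

end Chain

/-! ### The Nussbaum gain -/

/-- When the ratio exceeds 2C/c, half of c∫M already pays for C∫Q. The other half grows faster than
linearly and beats the contribution ξ of the constant 1. -/
theorem frequently_integral_lt {M Q : ℝ → ℝ} (hM : Continuous M) (hQ : Continuous Q)
    (hQ0 : ∀ τ, 0 ≤ Q τ)
    (hmean : Filter.Tendsto (fun ξ : ℝ => (1 / ξ) * ∫ τ in (0 : ℝ)..ξ, M τ)
      Filter.atTop Filter.atTop)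
    (hratio : Filter.limsup (fun ξ : ℝ => (((∫ τ in (0 : ℝ)..ξ, M τ) /
      (∫ τ in (0 : ℝ)..ξ, Q τ) : ℝ) : EReal)) Filter.atTop = ⊤)
    {c C : ℝ} (hc : 0 < c) (hC : 0 ≤ C) (R : ℝ) :
    ∃ᶠ ξ in Filter.atTop, ∫ τ in (0 : ℝ)..ξ, (C * Q τ - c * M τ + 1) < -R := by
  have h1 : ∃ᶠ ξ in Filter.atTop, ((2 * C / c : ℝ) : EReal) <
      (((∫ τ in (0 : ℝ)..ξ, M τ) / (∫ τ in (0 : ℝ)..ξ, Q τ) : ℝ) : EReal) :=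
    Filter.frequently_lt_of_lt_limsup (by isBoundedDefault)
      (hratio ▸ EReal.coe_lt_top _)
  -- With this threshold (c/2)∫M exceeds (2 + |R|)ξ, so the integral is below -(1 + |R|)ξ, and ξ ≥ 1
  -- finishes.
  refine (h1.and_eventually ((hmean.eventually_gt_atTop (2 / c * (2 + |R|))).and
    (Filter.eventually_ge_atTop 1))).mono ?_
  rintro ξ ⟨h2, h3, hξ⟩
  have hξ0 : 0 < ξ := by linarith
  have h2 := EReal.coe_lt_coe_iff.1 h2
  have hQi : 0 ≤ ∫ τ in (0 : ℝ)..ξ, Q τ :=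
    intervalIntegral.integral_nonneg hξ0.le fun τ _ => hQ0 τ
  -- If ∫Q were 0, the quotient would be 0 by convention and could not exceed 2C/c ≥ 0.
  have hQp : 0 < ∫ τ in (0 : ℝ)..ξ, Q τ := by
    refine lt_of_le_of_ne hQi fun h => ?_
    rw [← h, div_zero] at h2
    exact absurd h2 (not_lt.2 (by positivity))
  have hCQ : Continuous fun τ => C * Q τ - c * M τ := by fun_prop
  rw [intervalIntegral.integral_add (hCQ.intervalIntegrable _ _) intervalIntegrable_const,
    intervalIntegral.integral_sub ((hQ.const_mul C).intervalIntegrable _ _)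
      ((hM.const_mul c).intervalIntegrable _ _),
    intervalIntegral.integral_const_mul, intervalIntegral.integral_const_mul,
    intervalIntegral.integral_const]
  set IQ := ∫ τ in (0 : ℝ)..ξ, Q τ
  set IM := ∫ τ in (0 : ℝ)..ξ, M τ
  have h4 : C * IQ ≤ c / 2 * IM := by
    rw [lt_div_iff₀ hQp, div_mul_eq_mul_div, div_lt_iff₀ hc] at h2
    linarith
  have h5 : (2 + |R|) * ξ < c / 2 * IM := by
    rw [one_div, inv_mul_eq_div, lt_div_iff₀ hξ0, div_mul_eq_mul_div, div_mul_eq_mul_div,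
      div_lt_iff₀ hc] at h3
    linarith
  simp only [sub_zero, smul_eq_mul, mul_one]
  have h6 : (1 + |R|) * 1 ≤ (1 + |R|) * ξ := by gcongr
  linarith [neg_abs_le R, le_abs_self R]

/-- With c ≤ |b| ≤ C, positive b gives b𝒩 ≤ C𝒩⁺ - c𝒩⁻, and negative b gives the same with 𝒩⁺ and 𝒩⁻
exchanged. Each sign uses one of the two halves of the enhanced Nussbaum property, which is why the
sign need not be known. -/
theorem EnhancedNussbaum.exists_majorant {𝒩 : ℝ → ℝ} (hN : EnhancedNussbaum 𝒩) {b : ℝ → ℝ}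
    {Ω : Set ℝ} (hb : CoefficientAssumption b Ω) :
    ∃ h : ℝ → ℝ, Continuous h ∧ (∀ t, 0 ≤ t → ∀ ξ, 0 ≤ ξ → b t * 𝒩 ξ ≤ h ξ) ∧
      ∀ R, ∃ᶠ ξ in Filter.atTop, ∫ τ in (0 : ℝ)..ξ, (h τ + 1) < -R := by
  obtain ⟨C, hC⟩ := hb.compact.isBounded.exists_norm_le
  have hC0 : 0 ≤ C := (norm_nonneg _).trans (hC _ (hb.mem 0 le_rfl))
  obtain ⟨c, hc, hcΩ⟩ := Metric.mem_nhds_iff.1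
    (hb.compact.isClosed.isOpen_compl.mem_nhds hb.zero_notMem)
  have hcb : ∀ t, 0 ≤ t → c ≤ |b t| := by
    intro t ht
    by_contra h
    exact hcΩ (by simpa [Real.norm_eq_abs] using h) (hb.mem t ht)
  have hCb : ∀ t, 0 ≤ t → |b t| ≤ C := fun t ht => hC _ (hb.mem t ht)
  -- Only the values on [0, ∞) are controlled; the constant extension to the left is continuous on
  -- the whole line and leaves the integrals from 0 to ξ ≥ 0 unchanged.
  have hcont : Continuous fun τ => 𝒩 (max 0 τ) :=
    hN.smooth.continuousOn.comp_continuous (by fun_prop) fun τ => le_max_left 0 τ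
  have hint : ∀ ξ : ℝ, 0 ≤ ξ → ∀ F : ℝ → ℝ, ∫ τ in (0 : ℝ)..ξ, F (𝒩 τ) =
      ∫ τ in (0 : ℝ)..ξ, F (𝒩 (max 0 τ)) := by
    intro ξ hξ F
    refine intervalIntegral.integral_congr fun τ hτ => ?_
    rw [Set.uIcc_of_le hξ] at hτ
    simp only [max_eq_right hτ.1]
  have hp : Continuous fun τ => max 0 (𝒩 (max 0 τ)) :=
    continuous_const.max hcont
  have hm : Continuous fun τ => max 0 (-𝒩 (max 0 τ)) :=
    continuous_const.max hcont.neg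
  have hpm : ∀ v : ℝ, v = max 0 v - max 0 (-v) := fun v => by
    rcases le_total 0 v with h | h
    · rw [max_eq_right h, max_eq_left (by linarith), sub_zero]
    · rw [max_eq_left h, max_eq_right (by linarith)]
      ring
  have hev := Filter.eventually_ge_atTop (0 : ℝ)
  rcases hb.sign with hs | hs
  · refine ⟨fun τ => C * max 0 (𝒩 (max 0 τ)) - c * max 0 (-𝒩 (max 0 τ)),
      (hp.const_mul C).sub (hm.const_mul c), ?_,
      fun R => frequently_integral_lt hm hp (fun τ => le_max_left _ _) ?_ ?_ hc hC0 R⟩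
    · intro t ht ξ hξ
      simp only [max_eq_right hξ]
      have h1 := hcb t ht
      have h2 := hCb t ht
      rw [abs_of_pos (hs t ht)] at h1 h2
      calc b t * 𝒩 ξ = b t * max 0 (𝒩 ξ) - b t * max 0 (-𝒩 ξ) := by
            rw [← mul_sub, ← hpm]
        _ ≤ _ := by gcongr
    · refine hN.neg_mean.congr' ?_
      filter_upwards [hev] with ξ hξ
      rw [hint ξ hξ fun v => max 0 (-v)]
    · rw [← hN.neg_ratio]
      refine Filter.limsup_congr ?_
      filter_upwards [hev] with ξ hξ
      rw [hint ξ hξ fun v => max 0 (-v), hint ξ hξ fun v => max 0 v]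
  · refine ⟨fun τ => C * max 0 (-𝒩 (max 0 τ)) - c * max 0 (𝒩 (max 0 τ)),
      (hm.const_mul C).sub (hp.const_mul c), ?_,
      fun R => frequently_integral_lt hp hm (fun τ => le_max_left _ _) ?_ ?_ hc hC0 R⟩
    · intro t ht ξ hξ
      simp only [max_eq_right hξ]
      have h1 := hcb t ht
      have h2 := hCb t ht
      rw [abs_of_neg (hs t ht)] at h1 h2
      calc b t * 𝒩 ξ = -b t * max 0 (-𝒩 ξ) - -b t * max 0 (𝒩 ξ) := by
            conv_lhs => rw [hpm (𝒩 ξ)]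
            ring
        _ ≤ _ := by gcongr
    · refine hN.pos_mean.congr' ?_
      filter_upwards [hev] with ξ hξ
      rw [hint ξ hξ fun v => max 0 v]
    · rw [← hN.pos_ratio]
      refine Filter.limsup_congr ?_
      filter_upwards [hev] with ξ hξ
      rw [hint ξ hξ fun v => max 0 (-v), hint ξ hξ fun v => max 0 v]

/-! ### Coercivity of a positive definite quadratic form -/

theorem Matrix.PosDef.exists_sq_le {q : ℕ} {M : Matrix (Fin q) (Fin q) ℝ} (hM : M.PosDef) :
    ∃ c : ℝ, 0 ≤ c ∧ ∀ (p : Fin q → ℝ) (a : Fin q), p a ^ 2 ≤ c * (p ⬝ᵥ (M *ᵥ p)) := by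
  have hcont : Continuous fun p : Fin q → ℝ => p ⬝ᵥ (M *ᵥ p) := by
    simp only [dotProduct, Matrix.mulVec]
    fun_prop
  -- A positive lower bound on the unit sphere, valid also for q = 0, where the sphere is empty;
  -- homogeneity then extends it to all vectors.
  obtain ⟨c, hc, h⟩ := (isCompact_sphere (0 : Fin q → ℝ) 1).exists_forall_le' (a := 0)
    hcont.continuousOn fun p hp => by
      simpa using hM.dotProduct_mulVec_pos (x := p) (by
        rintro rfl
        simp at hp)
  refine ⟨c⁻¹, by positivity, fun p a => ?_⟩
  rcases eq_or_ne p 0 with rfl | hp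
  · simp
  have hp0 : 0 < ‖p‖ := norm_pos_iff.2 hp
  have h1 := h (‖p‖⁻¹ • p) (by simp [norm_smul, hp0.ne'])
  rw [Matrix.mulVec_smul, dotProduct_smul, smul_dotProduct, smul_eq_mul, smul_eq_mul] at h1
  have h2 : c * ‖p‖ ^ 2 ≤ p ⬝ᵥ (M *ᵥ p) := by
    calc c * ‖p‖ ^ 2 ≤ ‖p‖⁻¹ * (‖p‖⁻¹ * p ⬝ᵥ (M *ᵥ p)) * ‖p‖ ^ 2 := by gcongr
      _ = p ⬝ᵥ (M *ᵥ p) := by field_simp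
  have h3 : p a ^ 2 ≤ ‖p‖ ^ 2 := by
    rw [← sq_abs, ← Real.norm_eq_abs]
    gcongr
    exact norm_le_pi_norm p a
  rw [inv_mul_eq_div, le_div_iff₀ hc]
  linarith [mul_le_mul_of_nonneg_left h3 hc.le]

/-! ### The Lyapunov function along solutions -/

section Energy

variable {n q : ℕ} {P : Setup n q} {W : RegMat n q}
  {psiBar : (Fin n → ℝ) → (Fin q → ℝ) → ℝ → (Fin n → ℝ)} {𝒩 : ℝ → ℝ}
  {θ : ℝ → Fin q → ℝ} {Θ₀ : Set (Fin q → ℝ)} {b : ℝ → ℝ} {Ω : Set ℝ}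

/-- The Lyapunov function `(|s|² + (θ̂ - l)ᵀ Γ⁻¹ (θ̂ - l)) / 2`. -/
noncomputable def lyapunovFn (P : Setup n q) (W : RegMat n q) (l : Fin q → ℝ) : Fun3 n q :=
  fun x η μ => 1 / 2 * ∑ i, sErr P W x η μ i ^ 2 + 1 / 2 * ((η - l) ⬝ᵥ (P.Gam⁻¹ *ᵥ (η - l)))

theorem smoothBounded_sErr (hP : P.Admissible)
    (hW : ∀ i a c, SmoothBounded fun x η μ => W i x η μ a c) (i : Fin n) :
    SmoothBounded fun x η μ => sErr P W x η μ i :=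
  (stateLinear_zOf (stateLinear_alpha hP hW) i).scaled

theorem smoothBounded_lyapunovFn (hP : P.Admissible)
    (hW : ∀ i a c, SmoothBounded fun x η μ => W i x η μ a c) (l : Fin q → ℝ) :
    SmoothBounded (lyapunovFn P W l) := by
  have hη : ∀ a, SmoothBounded fun (_ : Fin n → ℝ) (η : Fin q → ℝ) (_ : ℝ) => (η - l) a :=
    fun a => (SmoothBounded.param a).sub (SmoothBounded.const _)
  exact ((SmoothBounded.const _).mul (SmoothBounded.sum fun i _ =>
    (smoothBounded_sErr hP hW i).sq)).add ((SmoothBounded.const _).mul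
      (SmoothBounded.sum fun a _ => (hη a).mul (smoothBounded_mulVec _ hη a)))

theorem half_sum_sq_le_lyapunovFn (hP : P.Admissible) (l : Fin q → ℝ) (x : Fin n → ℝ)
    (η : Fin q → ℝ) (μ : ℝ) : 1 / 2 * ∑ i, sErr P W x η μ i ^ 2 ≤ lyapunovFn P W l x η μ := by
  have := hP.Gam_pos.inv.posSemidef.dotProduct_mulVec_nonneg (η - l)
  simp only [star_trivial] at this
  simp only [lyapunovFn]
  linarith

theorem half_quadratic_le_lyapunovFn (l : Fin q → ℝ) (x : Fin n → ℝ) (η : Fin q → ℝ) (μ : ℝ) :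
    1 / 2 * ((η - l) ⬝ᵥ (P.Gam⁻¹ *ᵥ (η - l))) ≤ lyapunovFn P W l x η μ := by
  have : 0 ≤ ∑ i, sErr P W x η μ i ^ 2 := Finset.sum_nonneg fun _ _ => sq_nonneg _
  simp only [lyapunovFn]
  linarith

theorem lyapunovFn_nonneg (hP : P.Admissible) (l : Fin q → ℝ) (x : Fin n → ℝ)
    (η : Fin q → ℝ) (μ : ℝ) : 0 ≤ lyapunovFn P W l x η μ :=
  (mul_nonneg (by norm_num) (Finset.sum_nonneg fun _ _ => sq_nonneg _)).trans
    (half_sum_sq_le_lyapunovFn hP l x η μ)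

theorem hasDerivAt_quadratic {M : Matrix (Fin q) (Fin q) ℝ} {v : ℝ → Fin q → ℝ}
    {v' : Fin q → ℝ} {t : ℝ} (hv : HasDerivAt v v' t) :
    HasDerivAt (fun t => v t ⬝ᵥ (M *ᵥ v t)) (v' ⬝ᵥ (M *ᵥ v t) + v t ⬝ᵥ (M *ᵥ v')) t := by
  have hv := hasDerivAt_pi.1 hv
  have := HasDerivAt.fun_sum (u := Finset.univ) fun i _ => (hv i).fun_mul
    (HasDerivAt.fun_sum (u := Finset.univ) fun j _ => (hv j).const_mul (M i j))
  refine this.congr_deriv ?_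
  rw [Finset.sum_add_distrib]
  rfl

/-- Since μ' = λμ, one has s_i' = λ s_i + μ z_i'. The matrix Γ⁻¹ in the quadratic form cancels Γ in
the update law. -/
theorem hasDerivAt_lyapunovFn [NeZero n] (hP : P.Admissible)
    (hW : ∀ i a c, SmoothBounded fun x η μ => W i x η μ a c) (l : Fin q → ℝ) {p : Fin q → ℝ}
    {c u : ℝ} {x : ℝ → Fin n → ℝ} {η : ℝ → Fin q → ℝ} {t : ℝ}
    (hx : HasDerivAt x (systemField P p c u (x t)) t)
    (hη : HasDerivAt η (P.Gam *ᵥ tau P W (lastIdx n) (x t) (η t) (Real.exp (P.lam * t))) t) :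
    HasDerivAt (fun t => lyapunovFn P W l (x t) (η t) (Real.exp (P.lam * t)))
      (∑ i, sErr P W (x t) (η t) (Real.exp (P.lam * t)) i *
          (P.lam * sErr P W (x t) (η t) (Real.exp (P.lam * t)) i +
            Real.exp (P.lam * t) * errField P W p c u (x t) (η t) (Real.exp (P.lam * t)) i)
        + tau P W (lastIdx n) (x t) (η t) (Real.exp (P.lam * t)) ⬝ᵥ (η t - l)) t := by
  have hν : HasDerivAt (fun t => Real.exp (P.lam * t)) (P.lam * Real.exp (P.lam * t)) t := by
    simpa [mul_comm] using ((hasDerivAt_id t).const_mul P.lam).exp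
  have h1 := fun i => (hν.fun_mul (hasDerivAt_zErr hP hW hx hη i)).fun_pow 2
  have h2 := (HasDerivAt.fun_sum (u := Finset.univ) fun i _ => h1 i).const_mul (1 / 2)
  have h3 := (hasDerivAt_quadratic (M := P.Gam⁻¹) (hη.sub_const l)).const_mul (1 / 2)
  refine (h2.fun_add h3).congr_deriv ?_
  have hu : IsUnit P.Gam.det := (Matrix.isUnit_iff_isUnit_det _).1 hP.Gam_pos.isUnit
  have hsym : P.Gamᵀ = P.Gam := by
    simpa using hP.Gam_pos.isHermitian.eq
  set τ := tau P W (lastIdx n) (x t) (η t) (Real.exp (P.lam * t))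
  have e1 : (η t - l) ⬝ᵥ (P.Gam⁻¹ *ᵥ (P.Gam *ᵥ τ)) = τ ⬝ᵥ (η t - l) := by
    rw [Matrix.mulVec_mulVec, Matrix.nonsing_inv_mul _ hu, Matrix.one_mulVec, dotProduct_comm]
  have e2 : (P.Gam *ᵥ τ) ⬝ᵥ (P.Gam⁻¹ *ᵥ (η t - l)) = τ ⬝ᵥ (η t - l) := by
    rw [dotProduct_comm, Matrix.dotProduct_mulVec, ← Matrix.mulVec_transpose, hsym,
      Matrix.mulVec_mulVec, Matrix.mul_nonsing_inv _ hu, Matrix.one_mulVec, dotProduct_comm]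
  rw [e1, e2, Finset.mul_sum]
  congr 1
  · refine Finset.sum_congr rfl fun i _ => ?_
    simp only [sErr, Pi.smul_apply, smul_eq_mul]
    ring
  · ring

variable [NeZero n] {T : EReal} {x : ℝ → Fin n → ℝ} {η : ℝ → Fin q → ℝ} {ξ : ℝ → ℝ}

theorem kappaGain_nonneg (hP : P.Admissible) (x : Fin n → ℝ) (η : Fin q → ℝ) (μ : ℝ) :
    0 ≤ kappaGain P W psiBar x η μ := by
  have := hP.k_pos (lastIdx n)
  have := hP.lam_pos
  have := hP.del_pos
  have := hP.eps_pos
  have : 0 ≤ frobSq (W (lastIdx n) (trunc (lastIdx n) x) η μ) :=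
    Finset.sum_nonneg fun _ _ => Finset.sum_nonneg fun _ _ => sq_nonneg _
  unfold kappaGain
  positivity

theorem nussbaum_rate_eq (x : Fin n → ℝ) (η : Fin q → ℝ) (μ : ℝ) :
    μ * sErr P W x η μ (lastIdx n) * uBar P W psiBar x η μ =
      kappaGain P W psiBar x η μ * sErr P W x η μ (lastIdx n) ^ 2 := by
  simp only [sErr, uBar, Pi.smul_apply, smul_eq_mul]
  ring

theorem nussbaum_rate_nonneg (hP : P.Admissible) (x : Fin n → ℝ) (η : Fin q → ℝ) (μ : ℝ) :
    0 ≤ μ * sErr P W x η μ (lastIdx n) * uBar P W psiBar x η μ := by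
  rw [nussbaum_rate_eq]
  exact mul_nonneg (kappaGain_nonneg hP x η μ) (sq_nonneg _)

theorem IsClosedLoopSolution.monotoneOn_ξ (hP : P.Admissible)
    (hθ : ParameterAssumption P.del θ Θ₀) (hb : CoefficientAssumption b Ω)
    (hs : IsClosedLoopSolution P W psiBar 𝒩 θ b T x η ξ) : MonotoneOn ξ (timeInterval T) := by
  have := antitoneOn_timeInterval hθ.piecewise hb.piecewise (f := fun t => -ξ t) hs.ξ_cont.neg
    fun t ht h0 hr => ⟨_, neg_nonpos.2 (nussbaum_rate_nonneg hP (x t) (η t) _),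
      ((hs.ξ_ode t ht hr.1 hr.2).hasDerivAt (timeInterval_mem_nhds ht h0)).fun_neg⟩
  intro r hr t ht hrt
  exact neg_le_neg_iff.1 (this hr ht hrt)

theorem zero_mem_timeInterval {T : EReal} {t : ℝ} (ht : t ∈ timeInterval T) :
    (0 : ℝ) ∈ timeInterval T :=
  Icc_subset_timeInterval le_rfl ht ⟨le_rfl, ht.1⟩

theorem IsClosedLoopSolution.ξ_nonneg (hP : P.Admissible)
    (hθ : ParameterAssumption P.del θ Θ₀) (hb : CoefficientAssumption b Ω)
    (hs : IsClosedLoopSolution P W psiBar 𝒩 θ b T x η ξ) (h0 : 0 ≤ ξ 0) {t : ℝ}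
    (ht : t ∈ timeInterval T) : 0 ≤ ξ t :=
  h0.trans (hs.monotoneOn_ξ hP hθ hb (zero_mem_timeInterval ht) ht ht.1)

/-- The Lyapunov function minus the work of the Nussbaum gain. -/
noncomputable def energy (P : Setup n q) (W : RegMat n q) (l : Fin q → ℝ) (h : ℝ → ℝ)
    (x : ℝ → Fin n → ℝ) (η : ℝ → Fin q → ℝ) (ξ : ℝ → ℝ) (t : ℝ) : ℝ :=
  lyapunovFn P W l (x t) (η t) (Real.exp (P.lam * t)) - ∫ τ in (0 : ℝ)..ξ t, (h τ + 1)

/-- The term κ s_n² equals ξ' and is matched by the summand 1 in the integrand; the input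
contributes b𝒩(ξ)ξ' ≤ h(ξ)ξ', where ξ' ≥ 0 is essential. -/
theorem IsClosedLoopSolution.hasDerivAt_energy (hP : P.Admissible)
    (hc : IsRegressorChoice P W psiBar) (hθ : ParameterAssumption P.del θ Θ₀)
    (hb : CoefficientAssumption b Ω) {l : Fin q → ℝ}
    (hl : ∀ p ∈ Θ₀, euclNorm (p - l) ≤ P.del) {h : ℝ → ℝ} (hh : Continuous h)
    (hbh : ∀ t, 0 ≤ t → ∀ ξ, 0 ≤ ξ → b t * 𝒩 ξ ≤ h ξ)
    (hs : IsClosedLoopSolution P W psiBar 𝒩 θ b T x η ξ) (h0 : 0 ≤ ξ 0) {t : ℝ}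
    (ht : t ∈ timeInterval T) (ht0 : 0 < t) (hr : RegularTime θ b t) :
    ∃ E' ≤ -∑ i, P.k i * sErr P W (x t) (η t) (Real.exp (P.lam * t)) i ^ 2,
      HasDerivAt (energy P W l h x η ξ) E' t := by
  have hnhds := timeInterval_mem_nhds ht ht0
  have hx := (hs.x_ode t ht hr.1 hr.2).hasDerivAt hnhds
  have hη := (hs.η_ode t ht hr.1 hr.2).hasDerivAt hnhds
  have hξ := (hs.ξ_ode t ht hr.1 hr.2).hasDerivAt hnhds
  have hξ0 := hs.ξ_nonneg hP hθ hb h0 ht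
  have h1 := hasDerivAt_lyapunovFn hP hc.W_smooth l hx hη
  have hH : HasDerivAt (fun ζ => ∫ τ in (0 : ℝ)..ζ, (h τ + 1)) (h (ξ t) + 1) (ξ t) :=
    (hh.add continuous_const).integral_hasStrictDerivAt 0 (ξ t) |>.hasDerivAt
  refine ⟨_, ?_, h1.fun_sub (hH.comp t hξ)⟩
  have h2 := lyapunov_rate_le hP hc (hl _ (hθ.mem t ht.1)) (b t)
    (𝒩 (ξ t) * uBar P W psiBar (x t) (η t) (Real.exp (P.lam * t))) (x t) (η t)
    (Real.exp_pos (P.lam * t))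
  have h3 := mul_le_mul_of_nonneg_right (hbh t ht.1 _ hξ0)
    (nussbaum_rate_nonneg (W := W) (psiBar := psiBar) hP (x t) (η t) (Real.exp (P.lam * t)))
  have h4 := nussbaum_rate_eq (P := P) (W := W) (psiBar := psiBar) (x t) (η t)
    (Real.exp (P.lam * t))
  rw [← h4] at h2
  set r := Real.exp (P.lam * t) * sErr P W (x t) (η t) (Real.exp (P.lam * t)) (lastIdx n) *
    uBar P W psiBar (x t) (η t) (Real.exp (P.lam * t)) with hr
  have h5 : Real.exp (P.lam * t) * sErr P W (x t) (η t) (Real.exp (P.lam * t)) (lastIdx n) *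
      (b t * (𝒩 (ξ t) * uBar P W psiBar (x t) (η t) (Real.exp (P.lam * t)))) =
      b t * 𝒩 (ξ t) * r := by
    rw [hr]
    ring
  rw [h5] at h2
  linarith

theorem IsClosedLoopSolution.continuousOn_energy (hP : P.Admissible)
    (hc : IsRegressorChoice P W psiBar) (l : Fin q → ℝ) {h : ℝ → ℝ} (hh : Continuous h)
    (hs : IsClosedLoopSolution P W psiBar 𝒩 θ b T x η ξ) :
    ContinuousOn (energy P W l h x η ξ) (timeInterval T) := by
  have hH : Continuous fun ζ => ∫ τ in (0 : ℝ)..ζ, (h τ + 1) :=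
    continuous_iff_continuousAt.2 fun ζ =>
      ((hh.add continuous_const).integral_hasStrictDerivAt 0 ζ).hasDerivAt.continuousAt
  exact (continuousOn_fun3 (smoothBounded_lyapunovFn hP hc.W_smooth l) hs.x_cont hs.η_cont
    (by fun_prop)).sub (hH.comp_continuousOn hs.ξ_cont)

theorem IsClosedLoopSolution.antitoneOn_energy (hP : P.Admissible)
    (hc : IsRegressorChoice P W psiBar) (hθ : ParameterAssumption P.del θ Θ₀)
    (hb : CoefficientAssumption b Ω) {l : Fin q → ℝ}
    (hl : ∀ p ∈ Θ₀, euclNorm (p - l) ≤ P.del) {h : ℝ → ℝ} (hh : Continuous h)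
    (hbh : ∀ t, 0 ≤ t → ∀ ξ, 0 ≤ ξ → b t * 𝒩 ξ ≤ h ξ)
    (hs : IsClosedLoopSolution P W psiBar 𝒩 θ b T x η ξ) (h0 : 0 ≤ ξ 0) :
    AntitoneOn (energy P W l h x η ξ) (timeInterval T) := by
  refine antitoneOn_timeInterval hθ.piecewise hb.piecewise (hs.continuousOn_energy hP hc l hh)
    fun t ht ht0 hr => ?_
  obtain ⟨E', hE, hd⟩ := hs.hasDerivAt_energy hP hc hθ hb hl hh hbh h0 ht ht0 hr
  refine ⟨E', hE.trans (neg_nonpos.2 (Finset.sum_nonneg fun i _ => ?_)), hd⟩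
  exact mul_nonneg (hP.k_pos i).le (sq_nonneg _)

/-! ### A priori bounds -/

omit [NeZero n] in
-- Recursion along the coordinates: μx_i is s_i plus μ times a virtual control, which is a
-- combination of the earlier, already bounded, scaled coordinates.
theorem exists_scaled_state_bound (hP : P.Admissible)
    (hW : ∀ i a c, SmoothBounded fun x η μ => W i x η μ a c) (R : ℝ) (m : ℕ) :
    ∃ R', ∀ x η μ, 1 ≤ μ → (∀ i, |sErr P W x η μ i| ≤ R) → (∀ a, |η a| ≤ R) →
      ∀ i : Fin n, i.val < m → |μ * x i| ≤ R' := by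
  induction m with
  | zero => exact ⟨0, fun _ _ _ _ _ _ i hi => absurd hi (Nat.not_lt_zero _)⟩
  | succ m ih =>
    obtain ⟨R', hR'⟩ := ih
    obtain ⟨G, hG, hGd, hGs⟩ := (dependsOnFirst_alpha P W m).exists_coeff
      (stateLinear_alpha hP hW m)
    -- The coefficients are evaluated at the cut state, as nothing is known yet about later
    -- coordinates. The 0 in the radius accommodates the zero entries.
    choose B hB using fun k => (hG k).bounded (max (max R R') 0)
    refine ⟨max R' (R + ∑ k, |B k| * |R'|), fun x η μ hμ hsx hη i hi => ?_⟩
    have hx := hR' x η μ hμ hsx hη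
    have hcut : ∀ k, |cutCLM n m x k| ≤ max (max R R') 0 ∧
        |μ * cutCLM n m x k| ≤ max (max R R') 0 := by
      intro k
      rw [cutCLM_apply]
      split_ifs with hk
      · have h1 : |μ * x k| ≤ max (max R R') 0 :=
          (hx k hk).trans ((le_max_right _ _).trans (le_max_left _ _))
        refine ⟨le_trans ?_ h1, h1⟩
        rw [abs_mul, abs_of_pos (a := μ) (by linarith)]
        exact le_mul_of_one_le_left (abs_nonneg _) hμ
      · simp
    rcases Nat.lt_succ_iff_lt_or_eq.1 hi with hi | hi
    · exact (hx i hi).trans (le_max_left _ _)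
    · have h1 : μ * x i = sErr P W x η μ i + μ * alpha P W m x η μ := by
        simp only [sErr, zErr, zOf, Pi.smul_apply, smul_eq_mul, hi]
        ring
      rw [h1]
      refine (abs_add_le _ _).trans ((add_le_add (hsx i) ?_).trans (le_max_right _ _))
      rw [hGs, Finset.mul_sum]
      refine (Finset.abs_sum_le_sum_abs _ _).trans (Finset.sum_le_sum fun k _ => ?_)
      split_ifs with hk
      · rw [mul_left_comm, abs_mul, hGd k x (cutCLM n m x) η μ fun j hj => by
          rw [cutCLM_apply, if_pos hj]]
        refine mul_le_mul ?_ ((hx k hk).trans (le_abs_self _)) (abs_nonneg _) (abs_nonneg _)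
        exact (hB k _ _ _ (fun j => (hcut j).1)
          (fun a => (hη a).trans ((le_max_left _ _).trans (le_max_left _ _)))
          (fun j => (hcut j).2)).trans (le_abs_self _)
      · rw [mul_zero, abs_zero]
        positivity

/-- Bounds for the scaled state, the estimate and the argument of the Nussbaum function. -/
def BoundedTrajectory (P : Setup n q) (T : EReal) (x : ℝ → Fin n → ℝ) (η : ℝ → Fin q → ℝ)
    (ξ : ℝ → ℝ) (R : ℝ) : Prop :=
  ∀ t ∈ timeInterval T, (∀ i, |Real.exp (P.lam * t) * x t i| ≤ R) ∧ (∀ i, |x t i| ≤ R) ∧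
    (∀ a, |η t a| ≤ R) ∧ 0 ≤ ξ t ∧ ξ t ≤ R

/-- All constants are fixed from `R₀` before the solution and its interval are chosen. This
uniformity later serves both global existence and the continuous decay constant. -/
theorem exists_uniform_bound (hP : P.Admissible) (hN : EnhancedNussbaum 𝒩)
    (hc : IsRegressorChoice P W psiBar) (hθ : ParameterAssumption P.del θ Θ₀)
    (hb : CoefficientAssumption b Ω) (R₀ : ℝ) :
    ∃ R, ∀ (T : EReal) (x : ℝ → Fin n → ℝ) (η : ℝ → Fin q → ℝ) (ξ : ℝ → ℝ),
      IsClosedLoopSolution P W psiBar 𝒩 θ b T x η ξ → 0 ≤ ξ 0 → (∀ i, |x 0 i| ≤ R₀) →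
      (∀ a, |η 0 a| ≤ R₀) → ξ 0 ≤ R₀ → BoundedTrajectory P T x η ξ R := by
  obtain ⟨l, hl⟩ := hθ.radius
  obtain ⟨h, hh, hbh, hfreq⟩ := hN.exists_majorant hb
  set H : ℝ → ℝ := fun ζ => ∫ τ in (0 : ℝ)..ζ, (h τ + 1) with hHdef
  have hH : Continuous H := continuous_iff_continuousAt.2 fun ζ =>
    ((hh.add continuous_const).integral_hasStrictDerivAt 0 ζ).hasDerivAt.continuousAt
  obtain ⟨B₁, hB₁⟩ := (smoothBounded_lyapunovFn hP hc.W_smooth l).bounded R₀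
  obtain ⟨B₂, hB₂⟩ := (isCompact_Icc (a := 0) (b := R₀)).exists_bound_of_continuousOn
    hH.continuousOn
  -- A barrier for ξ: it lies above every admissible ξ(0), and at ξ = ζ the energy inequality would
  -- force V < 0.
  obtain ⟨ζ, hζ, hζR⟩ := ((hfreq (B₁ + B₂)).and_eventually
    (Filter.eventually_gt_atTop R₀)).exists
  obtain ⟨B₃, hB₃⟩ := (isCompact_Icc (a := 0) (b := ζ)).exists_bound_of_continuousOn
    hH.continuousOn
  obtain ⟨c, hc0, hcq⟩ := hP.Gam_pos.inv.exists_sq_le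
  set V := B₁ + B₂ + B₃
  set R₁ := max (Real.sqrt (2 * V)) (Real.sqrt (c * (2 * V)) + ‖l‖)
  obtain ⟨R₂, hR₂⟩ := exists_scaled_state_bound hP hc.W_smooth R₁ n
  refine ⟨max (max R₁ R₂) ζ, fun T x η ξ hs h0 hx0 hη0 hξ0 t ht => ?_⟩
  have h00 := zero_mem_timeInterval ht
  have hE := hs.antitoneOn_energy hP hc hθ hb hl hh hbh h0
  have hE0 : energy P W l h x η ξ 0 ≤ B₁ + B₂ := by
    -- At time 0 the scaling variable is 1, so the scaled state has the same bound as the state.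
    have h1 := hB₁ (x 0) (η 0) (Real.exp (P.lam * 0)) hx0 hη0 (by simpa using hx0)
    have h2 := hB₂ (ξ 0) ⟨h0, hξ0⟩
    rw [Real.norm_eq_abs] at h2
    have h3 := le_abs_self (lyapunovFn P W l (x 0) (η 0) (Real.exp (P.lam * 0)))
    have h4 := neg_abs_le (H (ξ 0))
    change _ - H (ξ 0) ≤ _
    linarith
  have hV : ∀ r ∈ timeInterval T, lyapunovFn P W l (x r) (η r) (Real.exp (P.lam * r)) ≤
      B₁ + B₂ + H (ξ r) := by
    intro r hr
    have h1 : lyapunovFn P W l (x r) (η r) (Real.exp (P.lam * r)) - H (ξ r) ≤ _ :=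
      (hE h00 hr hr.1).trans hE0
    linarith
  have hξζ : ξ t ≤ ζ := by
    by_contra hlt
    obtain ⟨r, hr, hrζ⟩ := intermediate_value_Icc ht.1
      (hs.ξ_cont.mono (Icc_subset_timeInterval le_rfl ht))
      (show ζ ∈ Set.Icc (ξ 0) (ξ t) from ⟨hξ0.trans hζR.le, (not_le.1 hlt).le⟩)
    have h1 := hV r (Icc_subset_timeInterval le_rfl ht hr)
    have h2 := lyapunovFn_nonneg (W := W) hP l (x r) (η r) (Real.exp (P.lam * r))
    have h3 : H ζ < -(B₁ + B₂) := hζ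
    rw [hrζ] at h1
    linarith
  have hξt := hs.ξ_nonneg hP hθ hb h0 ht
  have hVt : lyapunovFn P W l (x t) (η t) (Real.exp (P.lam * t)) ≤ V := by
    have h1 := hB₃ (ξ t) ⟨hξt, hξζ⟩
    rw [Real.norm_eq_abs] at h1
    have h2 := hV t ht
    have h3 := le_abs_self (H (ξ t))
    linarith
  have hst : ∀ i, |sErr P W (x t) (η t) (Real.exp (P.lam * t)) i| ≤ R₁ := by
    intro i
    refine (Real.abs_le_sqrt ?_).trans (le_max_left _ _)
    have h1 := half_sum_sq_le_lyapunovFn (W := W) hP l (x t) (η t) (Real.exp (P.lam * t))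
    have h2 := Finset.single_le_sum (f := fun i =>
      sErr P W (x t) (η t) (Real.exp (P.lam * t)) i ^ 2) (fun _ _ => sq_nonneg _)
      (Finset.mem_univ i)
    linarith
  have hηt : ∀ a, |η t a| ≤ R₁ := by
    intro a
    refine le_trans ?_ (le_max_right _ _)
    have h1 : η t a = (η t - l) a + l a := by simp
    rw [h1]
    refine (abs_add_le _ _).trans (add_le_add (Real.abs_le_sqrt ((hcq _ a).trans ?_))
      (norm_le_pi_norm l a))
    have h2 := half_quadratic_le_lyapunovFn (P := P) (W := W) l (x t) (η t)
      (Real.exp (P.lam * t))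
    exact mul_le_mul_of_nonneg_left (by linarith) hc0
  have hμ : 1 ≤ Real.exp (P.lam * t) := Real.one_le_exp (mul_nonneg hP.lam_pos.le ht.1)
  have hμx : ∀ i, |Real.exp (P.lam * t) * x t i| ≤ max (max R₁ R₂) ζ := fun i =>
    (hR₂ (x t) (η t) _ hμ hst hηt i i.isLt).trans ((le_max_right _ _).trans (le_max_left _ _))
  refine ⟨hμx, fun i => le_trans ?_ (hμx i),
    fun a => (hηt a).trans ((le_max_left _ _).trans (le_max_left _ _)), hξt,
    hξζ.trans (le_max_right _ _)⟩
  rw [abs_mul, abs_of_pos (Real.exp_pos _)]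
  exact le_mul_of_one_le_left (abs_nonneg _) hμ

end Energy

/-! ### Global solutions of Carathéodory equations with bounded Lipschitz right-hand side -/

section Picard

variable {E : Type} [NormedAddCommGroup E] [NormedSpace ℝ E] [CompleteSpace E]

/-- The Picard iterates of `y' = F(t, y)`, `y(0) = y₀`. -/
noncomputable def picardIterate (F : ℝ → E → E) (y₀ : E) : ℕ → ℝ → E
  | 0 => fun _ => y₀
  | m + 1 => fun t => y₀ + ∫ s in (0 : ℝ)..t, F s (picardIterate F y₀ m s)

/-- Picard iteration measured with the weight exp(2Kt): integrating K exp(2Ks) returns half the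
weight, so successive differences shrink by 1/2 on every [0, T]. At negative times the field
vanishes and all iterates equal `y₀`, so estimates on (-∞, T] suffice. -/
theorem exists_integral_solution {F : ℝ → E → E}
    (hneg : ∀ t < 0, ∀ y, F t y = 0)
    (hL : ∀ T, ∃ K, ∀ t ≤ T, ∀ y z, ‖F t y - F t z‖ ≤ K * ‖y - z‖)
    (hB : ∀ T, ∃ C, ∀ t ≤ T, ∀ y, ‖F t y‖ ≤ C)
    (hM : ∀ y : ℝ → E, Continuous y →
      MeasureTheory.AEStronglyMeasurable (fun t => F t (y t)) MeasureTheory.volume) (y₀ : E) :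
    ∃ y : ℝ → E, Continuous y ∧ (∀ t, y t = y₀ + ∫ s in (0 : ℝ)..t, F s (y s)) ∧
      ∀ a c, IntervalIntegrable (fun t => F t (y t)) MeasureTheory.volume a c := by
  have hint : ∀ y : ℝ → E, Continuous y → ∀ a c,
      IntervalIntegrable (fun t => F t (y t)) MeasureTheory.volume a c := by
    intro y hy a c
    obtain ⟨C, hC⟩ := hB (max a c)
    refine (intervalIntegrable_const (c := C)).mono_fun' (hM y hy).restrict ?_
    refine (MeasureTheory.ae_restrict_iff' measurableSet_uIoc).2
      (Filter.Eventually.of_forall fun t ht => hC t ht.2 _)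
  set Y := picardIterate F y₀ with hY
  have hYs : ∀ m t, Y (m + 1) t = y₀ + ∫ s in (0 : ℝ)..t, F s (Y m s) := fun _ _ => rfl
  have hYc : ∀ m, Continuous (Y m) := by
    intro m
    induction m with
    | zero => exact continuous_const
    | succ m ih => exact continuous_const.add (intervalIntegral.continuous_primitive (hint _ ih) 0)
  have hzero : ∀ y : ℝ → E, ∀ t ≤ 0, ∫ s in (0 : ℝ)..t, F s (y s) = 0 := by
    intro y t ht
    refine intervalIntegral.integral_zero_ae ?_
    filter_upwards [MeasureTheory.Measure.ae_ne MeasureTheory.volume (0 : ℝ)] with s hs hst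
    rw [Set.uIoc_of_ge ht] at hst
    exact hneg s (lt_of_le_of_ne hst.2 hs) _
  have hYneg : ∀ m, ∀ t ≤ 0, Y m t = y₀ := by
    intro m t ht
    cases m with
    | zero => rfl
    | succ m => rw [hYs, hzero _ t ht, add_zero]
  have hgeom : ∀ T, ∃ C, ∀ t ≤ T, ∀ m, dist (Y m t) (Y (m + 1) t) ≤ C * (1 / 2) ^ m := by
    intro T
    obtain ⟨K', hK'⟩ := hL T
    obtain ⟨C, hC⟩ := hB T
    set K := max K' 1
    have hK0 : 0 < K := lt_max_of_lt_right one_pos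
    have hK : ∀ t ≤ T, ∀ y z, ‖F t y - F t z‖ ≤ K * ‖y - z‖ := fun t ht y z =>
      (hK' t ht y z).trans (by gcongr; exact le_max_left _ _)
    have hC0 : 0 ≤ C := (norm_nonneg _).trans (hC T le_rfl y₀)
    have key : ∀ m, ∀ t, 0 ≤ t → t ≤ T →
        ‖Y (m + 1) t - Y m t‖ ≤ C * |T| * (1 / 2) ^ m * Real.exp (2 * K * t) := by
      intro m
      induction m with
      | zero =>
        intro t ht htT
        have h1 : ‖∫ s in (0 : ℝ)..t, F s (Y 0 s)‖ ≤ C * |t - 0| :=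
          intervalIntegral.norm_integral_le_of_norm_le_const fun s hs => hC s (by
            rw [Set.uIoc_of_le ht] at hs
            exact hs.2.trans htT) _
        have h2 : Y (0 + 1) t - Y 0 t = ∫ s in (0 : ℝ)..t, F s (Y 0 s) := by
          rw [hYs]
          exact add_sub_cancel_left _ _
        rw [h2, pow_zero, mul_one]
        have h3 : |t - 0| ≤ |T| := by
          rw [sub_zero, abs_of_nonneg ht, abs_of_nonneg (ht.trans htT)]
          exact htT
        have h4 : 1 ≤ Real.exp (2 * K * t) := Real.one_le_exp (by positivity)
        calc _ ≤ C * |t - 0| := h1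
          _ ≤ C * |T| := by gcongr
          _ ≤ _ := le_mul_of_one_le_right (by positivity) h4
      | succ m ih =>
        intro t ht htT
        have h2 : Y (m + 1 + 1) t - Y (m + 1) t =
            ∫ s in (0 : ℝ)..t, (F s (Y (m + 1) s) - F s (Y m s)) := by
          rw [intervalIntegral.integral_sub (hint _ (hYc _) _ _) (hint _ (hYc _) _ _), hYs, hYs]
          exact add_sub_add_left_eq_sub _ _ _
        rw [h2]
        set D := C * |T| * (1 / 2) ^ m with hD
        have hD0 : 0 ≤ D := by positivity
        have hcont : Continuous fun s => K * (D * Real.exp (2 * K * s)) := by fun_prop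
        have h3 : ‖∫ s in (0 : ℝ)..t, (F s (Y (m + 1) s) - F s (Y m s))‖ ≤
            ∫ s in (0 : ℝ)..t, K * (D * Real.exp (2 * K * s)) := by
          refine intervalIntegral.norm_integral_le_of_norm_le ht
            (Filter.Eventually.of_forall fun s hs => ?_) (hcont.intervalIntegrable _ _)
          refine (hK s (hs.2.trans htT) _ _).trans ?_
          gcongr
          exact ih s hs.1.le (hs.2.trans htT)
        have h4 : ∫ s in (0 : ℝ)..t, K * (D * Real.exp (2 * K * s)) =
            D / 2 * Real.exp (2 * K * t) - D / 2 * Real.exp (2 * K * 0) := by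
          refine intervalIntegral.integral_eq_sub_of_hasDerivAt (f := fun s =>
            D / 2 * Real.exp (2 * K * s)) (fun s _ => ?_) (hcont.intervalIntegrable _ _)
          refine ((((hasDerivAt_id s).const_mul (2 * K)).exp).const_mul (D / 2)).congr_deriv ?_
          simp only [id, mul_one]
          ring
        refine h3.trans (h4.trans_le ?_)
        have h5 : 0 ≤ D / 2 * Real.exp (2 * K * 0) := by positivity
        have h6 : C * |T| * (1 / 2) ^ (m + 1) = D / 2 := by
          rw [hD, pow_succ]
          ring
        rw [h6]
        linarith
    refine ⟨C * |T| * Real.exp (2 * K * |T|), fun t ht m => ?_⟩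
    rcases le_total t 0 with h | h
    · rw [hYneg _ t h, hYneg _ t h, dist_self]
      positivity
    · rw [dist_comm, dist_eq_norm]
      refine (key m t h ht).trans ?_
      rw [mul_right_comm]
      gcongr
      exact ht.trans (le_abs_self T)
  have hlim : ∀ t, ∃ z, Filter.Tendsto (fun m => Y m t) Filter.atTop (𝓝 z) := by
    intro t
    obtain ⟨C, hC⟩ := hgeom t
    exact cauchySeq_tendsto_of_complete
      (cauchySeq_of_le_geometric (1 / 2) C (by norm_num) (hC t le_rfl))
  choose y hy using hlim
  have hunif : ∀ T, TendstoUniformlyOn Y y Filter.atTop (Set.Iic T) := by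
    intro T
    obtain ⟨C, hC⟩ := hgeom T
    rw [Metric.tendstoUniformlyOn_iff]
    intro ε hε
    have h1 : Filter.Tendsto (fun m : ℕ => C * (1 / 2 : ℝ) ^ m / (1 - 1 / 2)) Filter.atTop
        (𝓝 0) := by
      simpa using ((tendsto_pow_atTop_nhds_zero_of_lt_one (r := (1 / 2 : ℝ)) (by norm_num)
        (by norm_num)).const_mul C).div_const (1 - 1 / 2)
    filter_upwards [h1.eventually_lt_const hε] with m hm t ht
    rw [dist_comm]
    exact (dist_le_of_le_geometric_of_tendsto (1 / 2) C (by norm_num) (hC t ht) (hy t) m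
      ).trans_lt hm
  have hyc : Continuous y := continuous_iff_continuousAt.2 fun t =>
    ((hunif (t + 1)).continuousOn (Filter.Frequently.of_forall fun m =>
      (hYc m).continuousOn)).continuousAt (Iic_mem_nhds (lt_add_one t))
  refine ⟨y, hyc, fun t => ?_, hint y hyc⟩
  -- The recursion passes to the limit by dominated convergence, using the bound on the field for
  -- domination and its Lipschitz constant for pointwise convergence.
  refine tendsto_nhds_unique ((hy t).comp (Filter.tendsto_add_atTop_nat 1)) ?_
  refine Filter.Tendsto.const_add y₀ ?_
  obtain ⟨C, hC⟩ := hB (max 0 t)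
  obtain ⟨K, hK⟩ := hL (max 0 t)
  refine intervalIntegral.tendsto_integral_filter_of_dominated_convergence (fun _ => C)
    (Filter.Eventually.of_forall fun m => (hM _ (hYc m)).restrict)
    (Filter.Eventually.of_forall fun m => Filter.Eventually.of_forall fun s hs => hC s hs.2 _)
    intervalIntegrable_const (Filter.Eventually.of_forall fun s hs => ?_)
  rw [tendsto_iff_norm_sub_tendsto_zero]
  refine squeeze_zero (fun _ => norm_nonneg _) (fun m => hK s hs.2 _ _) ?_
  simpa using (tendsto_iff_norm_sub_tendsto_zero.1 (hy s)).const_mul K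

/-- Existence of a global solution when the right-hand side is continuous along continuous curves
at all times outside a countable set. -/
theorem exists_global_solution {G : ℝ → E → E} {S : Set ℝ} (hS : S.Countable)
    (hL : ∀ T, ∃ K, ∀ t, 0 ≤ t → t ≤ T → ∀ y z, ‖G t y - G t z‖ ≤ K * ‖y - z‖)
    (hB : ∀ T, ∃ C, ∀ t, 0 ≤ t → t ≤ T → ∀ y, ‖G t y‖ ≤ C)
    (hG : ∀ y : ℝ → E, Continuous y → ∀ t, 0 ≤ t → t ∉ S →
      ContinuousWithinAt (fun t => G t (y t)) (Set.Ici 0) t) (y₀ : E) :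
    ∃ y : ℝ → E, Continuous y ∧ y 0 = y₀ ∧ ∀ t, 0 ≤ t → t ∉ S →
      HasDerivWithinAt y (G t (y t)) (Set.Ici 0) t := by
  -- Continuity off a countable, hence null, set gives measurability. The indicator extends the
  -- field by zero to negative times.
  have hM : ∀ y : ℝ → E, Continuous y → MeasureTheory.AEStronglyMeasurable
      (Set.indicator (Set.Ici 0) fun t => G t (y t)) MeasureTheory.volume := by
    intro y hy
    have hmeas : MeasurableSet (Set.Ici (0 : ℝ) \ S) := measurableSet_Ici.diff hS.measurableSet
    have hc : ContinuousOn (fun t => G t (y t)) (Set.Ici 0 \ S) := fun t ht =>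
      (hG y hy t ht.1 ht.2).mono Set.sdiff_subset
    refine ((aestronglyMeasurable_indicator_iff hmeas).2 (hc.aestronglyMeasurable hmeas)).congr ?_
    filter_upwards [hS.ae_notMem MeasureTheory.volume] with t ht
    by_cases h : t ∈ Set.Ici (0 : ℝ)
    · rw [Set.indicator_of_mem h, Set.indicator_of_mem (show t ∈ Set.Ici 0 \ S from ⟨h, ht⟩)]
    · rw [Set.indicator_of_notMem h, Set.indicator_of_notMem fun h' => h h'.1]
  have hpos : ∀ t, 0 ≤ t → ∀ y, Set.indicator (Set.Ici 0) (fun t => G t y) t = G t y :=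
    fun t ht y => Set.indicator_of_mem (show t ∈ Set.Ici 0 from ht) _
  have hneg : ∀ t, t < 0 → ∀ y, Set.indicator (Set.Ici 0) (fun t => G t y) t = 0 :=
    fun t ht y => Set.indicator_of_notMem (show t ∉ Set.Ici 0 from not_le.2 ht) _
  obtain ⟨y, hyc, hy, hint⟩ := exists_integral_solution
    (F := fun t y => Set.indicator (Set.Ici 0) (fun t => G t y) t) hneg
    (fun T => by
      obtain ⟨K, hK⟩ := hL T
      refine ⟨max K 0, fun t ht y z => ?_⟩
      rcases lt_or_ge t 0 with h | h
      · rw [hneg t h, hneg t h, sub_zero, norm_zero]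
        positivity
      · rw [hpos t h, hpos t h]
        exact (hK t h ht y z).trans (by gcongr; exact le_max_left _ _))
    (fun T => by
      obtain ⟨C, hC⟩ := hB T
      refine ⟨max C 0, fun t ht y => ?_⟩
      rcases lt_or_ge t 0 with h | h
      · rw [hneg t h, norm_zero]
        exact le_max_right _ _
      · rw [hpos t h]
        exact (hC t h ht y).trans (le_max_left _ _))
    (fun y hy => hM y hy) y₀
  refine ⟨y, hyc, by simpa using hy 0, fun t ht htS => ?_⟩
  set f := Set.indicator (Set.Ici 0) fun t => G t (y t) with hf
  have hfy : y = fun t => y₀ + ∫ s in (0 : ℝ)..t, f s := funext hy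
  have hft : f t = G t (y t) := Set.indicator_of_mem (show t ∈ Set.Ici 0 from ht) _
  have hfc : ContinuousWithinAt f (Set.Ici 0) t :=
    (hG y hyc t ht htS).congr (fun s hs => Set.indicator_of_mem hs _) hft
  have hmeas : ∀ l : Filter ℝ, StronglyMeasurableAtFilter f l := fun l =>
    ⟨Set.univ, Filter.univ_mem, (hM y hyc).restrict⟩
  have hint' : IntervalIntegrable f MeasureTheory.volume 0 t := hint 0 t
  rw [← hft, hfy]
  refine HasDerivWithinAt.const_add y₀ ?_
  rcases ht.eq_or_lt with rfl | ht0
  · exact intervalIntegral.integral_hasDerivWithinAt_right hint' (t := Set.Ioi 0) (hmeas _)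
      (hfc.mono Set.Ioi_subset_Ici_self)
  · exact (intervalIntegral.integral_hasDerivAt_right hint' (hmeas _)
      (hfc.continuousAt (Ici_mem_nhds ht0))).hasDerivWithinAt

end Picard

/-! ### Global existence for the closed loop -/

/-- Projection of every coordinate onto `[-B, B]`. -/
noncomputable def clampPi {ι : Type} {B : ℝ} (hB : 0 ≤ B) (v : ι → ℝ) : ι → ℝ :=
  fun i => (Set.projIcc (-B) B (neg_le_self hB) (v i) : ℝ)

/-- Projection onto `[0, B]`. -/
noncomputable def clampPos {B : ℝ} (hB : 0 ≤ B) (r : ℝ) : ℝ := (Set.projIcc 0 B hB r : ℝ)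

section Clamp

variable {ι : Type} [Fintype ι] {B : ℝ} (hB : 0 ≤ B)

theorem clampPi_of_norm_le {v : ι → ℝ} (hv : ‖v‖ ≤ B) : clampPi hB v = v := by
  funext i
  have h := abs_le.1 ((norm_le_pi_norm v i).trans hv)
  simp [clampPi, Set.projIcc_of_mem _ (show v i ∈ Set.Icc (-B) B from h)]

theorem norm_clampPi_le (v : ι → ℝ) : ‖clampPi hB v‖ ≤ B :=
  (pi_norm_le_iff_of_nonneg hB).2 fun i =>
    abs_le.2 (Set.projIcc (-B) B (neg_le_self hB) (v i)).2

theorem dist_clampPi_le (v w : ι → ℝ) : dist (clampPi hB v) (clampPi hB w) ≤ dist v w :=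
  (dist_pi_le_iff dist_nonneg).2 fun i =>
    (((LipschitzWith.projIcc (neg_le_self hB)).dist_le_mul (v i) (w i)).trans
      (by simp)).trans (dist_le_pi_dist v w i)

theorem continuous_clampPi : Continuous (clampPi hB : (ι → ℝ) → ι → ℝ) :=
  (LipschitzWith.of_dist_le_mul (K := 1) (by simpa using dist_clampPi_le hB)).continuous

theorem clampPos_mem (r : ℝ) : clampPos hB r ∈ Set.Icc 0 B := (Set.projIcc 0 B hB r).2

theorem clampPos_of_mem {r : ℝ} (hr : r ∈ Set.Icc 0 B) : clampPos hB r = r := by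
  simp [clampPos, Set.projIcc_of_mem _ hr]

theorem dist_clampPos_le (r s : ℝ) : dist (clampPos hB r) (clampPos hB s) ≤ dist r s :=
  ((LipschitzWith.projIcc hB).dist_le_mul r s).trans (by simp)

end Clamp

section ClosedLoop

variable {n q : ℕ} [NeZero n] {P : Setup n q} {W : RegMat n q}
  {psiBar : (Fin n → ℝ) → (Fin q → ℝ) → ℝ → (Fin n → ℝ)} {𝒩 : ℝ → ℝ}
  {θ : ℝ → Fin q → ℝ} {Θ₀ : Set (Fin q → ℝ)} {b : ℝ → ℝ} {Ω : Set ℝ}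

theorem smoothBounded_kappaGain (hc : IsRegressorChoice P W psiBar) :
    SmoothBounded (kappaGain P W psiBar) :=
  (SmoothBounded.const _).add ((SmoothBounded.const _).mul
    ((((SmoothBounded.const _).mul ((smoothBounded_frobSq hc.W_smooth _).add
      (SmoothBounded.const _))).add (SmoothBounded.const _)).add
      ((SmoothBounded.const _).mul (SmoothBounded.sum fun a _ => (hc.psi_smooth a).sq))))

theorem smoothBounded_uBar (hP : P.Admissible) (hc : IsRegressorChoice P W psiBar) :
    SmoothBounded (uBar P W psiBar) :=
  (smoothBounded_kappaGain hc).mul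
    (stateLinear_zOf (stateLinear_alpha hP hc.W_smooth) _).smoothBounded

theorem smoothBounded_nussbaum_rate (hP : P.Admissible) (hc : IsRegressorChoice P W psiBar) :
    SmoothBounded fun x η μ =>
      μ * sErr P W x η μ (lastIdx n) * uBar P W psiBar x η μ := by
  simp only [nussbaum_rate_eq]
  exact (smoothBounded_kappaGain hc).mul (smoothBounded_sErr hP hc.W_smooth _).sq

/-- The right-hand side of the closed loop as a function of `x`, `θ̂`, `μ`, the value `v` of the
Nussbaum function, `θ` and `b`. -/
noncomputable def closedLoopField (P : Setup n q) (W : RegMat n q)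
    (psiBar : (Fin n → ℝ) → (Fin q → ℝ) → ℝ → (Fin n → ℝ))
    (z : (Fin n → ℝ) × (Fin q → ℝ) × ℝ × ℝ × (Fin q → ℝ) × ℝ) :
    (Fin n → ℝ) × (Fin q → ℝ) × ℝ :=
  (systemField P z.2.2.2.2.1 z.2.2.2.2.2 (z.2.2.2.1 * uBar P W psiBar z.1 z.2.1 z.2.2.1) z.1,
    P.Gam *ᵥ tau P W (lastIdx n) z.1 z.2.1 z.2.2.1,
    z.2.2.1 * sErr P W z.1 z.2.1 z.2.2.1 (lastIdx n) * uBar P W psiBar z.1 z.2.1 z.2.2.1)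

/-- The value of 𝒩 is a separate argument, like θ and b: 𝒩 is smooth only on a half-line and θ, b
are only piecewise continuous, while the field is smooth in these arguments on the whole space. -/
theorem contDiff_closedLoopField (hP : P.Admissible) (hc : IsRegressorChoice P W psiBar) :
    ContDiff ℝ ∞ (closedLoopField P W psiBar) := by
  have hproj : ContDiff ℝ ∞ fun z : (Fin n → ℝ) × (Fin q → ℝ) × ℝ × ℝ × (Fin q → ℝ) × ℝ =>
    (z.1, z.2.1, z.2.2.1) := by fun_prop
  have hu := (smoothBounded_uBar hP hc).contDiff.comp hproj
  refine ContDiff.prodMk (contDiff_pi.2 fun i => ?_) (ContDiff.prodMk (contDiff_pi.2 fun a => ?_)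
    ((smoothBounded_nussbaum_rate hP hc).contDiff.comp hproj))
  · have h1 : ContDiff ℝ ∞ fun z : (Fin n → ℝ) × (Fin q → ℝ) × ℝ × ℝ × (Fin q → ℝ) × ℝ =>
        P.phi i (trunc i z.1) ⬝ᵥ z.2.2.2.2.1 := by
      have h2 : ContDiff ℝ ∞ fun z : (Fin n → ℝ) × (Fin q → ℝ) × ℝ × ℝ × (Fin q → ℝ) × ℝ =>
        P.phi i (trunc i z.1) :=
          (hP.phi_smooth i).comp ((truncCLM i).contDiff.comp contDiff_fst)
      exact ContDiff.sum fun a _ => (contDiff_pi.1 h2 a).mul (by fun_prop)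
    refine h1.add ?_
    split_ifs
    · fun_prop
    · exact ContDiff.mul (by fun_prop) (ContDiff.mul (by fun_prop) hu)
  · exact (smoothBounded_mulVec P.Gam (smoothBounded_tauOf hP
      (stateLinear_alpha hP hc.W_smooth) (lastIdx n)) a).contDiff.comp hproj

/-- The arguments of `closedLoopField` along the closed loop with the state clamped to a box. -/
noncomputable def clampedArgs (P : Setup n q) (𝒩 : ℝ → ℝ) (θ : ℝ → Fin q → ℝ) (b : ℝ → ℝ)
    {B : ℝ} (hB : 0 ≤ B) (t : ℝ) (y : (Fin n → ℝ) × (Fin q → ℝ) × ℝ) :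
    (Fin n → ℝ) × (Fin q → ℝ) × ℝ × ℝ × (Fin q → ℝ) × ℝ :=
  (clampPi hB y.1, clampPi hB y.2.1, Real.exp (P.lam * t), 𝒩 (clampPos hB y.2.2), θ t, b t)

omit [NeZero n] in
theorem exists_dist_clampedArgs_le (hN : EnhancedNussbaum 𝒩) {B : ℝ} (hB : 0 ≤ B) :
    ∃ K, 0 ≤ K ∧ ∀ t y z,
      dist (clampedArgs P 𝒩 θ b hB t y) (clampedArgs P 𝒩 θ b hB t z) ≤ K * dist y z := by
  obtain ⟨K, hK⟩ := LocallyLipschitzOn.exists_lipschitzOnWith_of_compact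
    (isCompact_Icc (a := 0) (b := B)) ((ContDiffOn.locallyLipschitzOn (convex_Ici 0)
      (hN.smooth.of_le (by norm_cast))).mono Set.Icc_subset_Ici_self)
  refine ⟨max 1 K, le_max_of_le_left zero_le_one, fun t y z => ?_⟩
  have h1 : dist y z ≤ max 1 (K : ℝ) * dist y z :=
    le_mul_of_one_le_left dist_nonneg (le_max_left _ _)
  have h0 : 0 ≤ max 1 (K : ℝ) * dist y z := dist_nonneg.trans h1
  have hy1 : dist y.1 z.1 ≤ dist y z := le_max_left _ _
  have hy2 : dist y.2.1 z.2.1 ≤ dist y z := (le_max_left _ _).trans (le_max_right _ _)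
  have hy3 : dist y.2.2 z.2.2 ≤ dist y z := (le_max_right _ _).trans (le_max_right _ _)
  simp only [clampedArgs, Prod.dist_eq, dist_self]
  refine max_le ((dist_clampPi_le hB _ _).trans (hy1.trans h1))
    (max_le ((dist_clampPi_le hB _ _).trans (hy2.trans h1)) (max_le h0 (max_le ?_ h0)))
  refine (hK.dist_le_mul _ (clampPos_mem hB _) _ (clampPos_mem hB _)).trans ?_
  exact mul_le_mul (le_max_right _ _) ((dist_clampPos_le hB _ _).trans hy3) dist_nonneg
    (le_max_of_le_left zero_le_one)

omit [NeZero n] in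
theorem exists_norm_clampedArgs_le (hN : EnhancedNussbaum 𝒩) (hlam : 0 < P.lam)
    (hθ : ParameterAssumption P.del θ Θ₀) (hb : CoefficientAssumption b Ω) {B : ℝ} (hB : 0 ≤ B)
    (T : ℝ) : ∃ R, ∀ t, 0 ≤ t → t ≤ T → ∀ y, ‖clampedArgs P 𝒩 θ b hB t y‖ ≤ R := by
  obtain ⟨R₁, hR₁⟩ := (isCompact_Icc (a := 0) (b := B)).exists_bound_of_continuousOn
    (hN.smooth.continuousOn.mono Set.Icc_subset_Ici_self)
  obtain ⟨R₂, hR₂⟩ := hθ.compact.isBounded.exists_norm_le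
  obtain ⟨R₃, hR₃⟩ := hb.compact.isBounded.exists_norm_le
  refine ⟨max B (max B (max (Real.exp (P.lam * T)) (max R₁ (max R₂ R₃)))), fun t h0 hT y => ?_⟩
  simp only [clampedArgs, Prod.norm_def]
  refine max_le_max (norm_clampPi_le hB _) (max_le_max (norm_clampPi_le hB _) (max_le_max ?_
    (max_le_max (hR₁ _ (clampPos_mem hB _)) (max_le_max (hR₂ _ (hθ.mem t h0))
      (hR₃ _ (hb.mem t h0))))))
  rw [Real.norm_eq_abs, Real.abs_exp]
  gcongr

/-- On [0, T] the clamped arguments stay in a fixed ball, where the smooth field is bounded and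
Lipschitz. The exceptional times form a countable union of finite sets. -/
theorem exists_clamped_solution (hP : P.Admissible) (hN : EnhancedNussbaum 𝒩)
    (hc : IsRegressorChoice P W psiBar) (hθ : ParameterAssumption P.del θ Θ₀)
    (hb : CoefficientAssumption b Ω) {B : ℝ} (hB : 0 ≤ B)
    (y₀ : (Fin n → ℝ) × (Fin q → ℝ) × ℝ) :
    ∃ y : ℝ → (Fin n → ℝ) × (Fin q → ℝ) × ℝ, Continuous y ∧ y 0 = y₀ ∧
      ∀ t, 0 ≤ t → RegularTime θ b t → HasDerivWithinAt y
        (closedLoopField P W psiBar (clampedArgs P 𝒩 θ b hB t (y t))) (Set.Ici 0) t := by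
  have hF := contDiff_closedLoopField hP hc
  have hS : {t : ℝ | 0 ≤ t ∧ ¬ RegularTime θ b t}.Countable := by
    refine (Set.countable_iUnion fun k : ℕ =>
      (finite_not_regularTime hθ.piecewise hb.piecewise k).countable).mono ?_
    rintro t ⟨h0, h1⟩
    obtain ⟨k, hk⟩ := exists_nat_ge t
    exact Set.mem_iUnion.2 ⟨k, h0, hk, h1⟩
  obtain ⟨K₁, hK₁, hlip⟩ := exists_dist_clampedArgs_le (P := P) (θ := θ) (b := b) hN hB
  obtain ⟨y, hyc, hy0, hy⟩ := exists_global_solution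
    (G := fun t y => closedLoopField P W psiBar (clampedArgs P 𝒩 θ b hB t y)) hS
    (fun T => by
      obtain ⟨R, hR⟩ := exists_norm_clampedArgs_le hN hP.lam_pos hθ hb hB T
      obtain ⟨K, hK⟩ := LocallyLipschitzOn.exists_lipschitzOnWith_of_compact
        (isCompact_closedBall (0 : (Fin n → ℝ) × (Fin q → ℝ) × ℝ × ℝ × (Fin q → ℝ) × ℝ) R)
        ((hF.of_le (by norm_cast)).locallyLipschitz.locallyLipschitzOn)
      refine ⟨K * K₁, fun t h0 hT y z => ?_⟩
      rw [← dist_eq_norm, ← dist_eq_norm, mul_assoc]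
      refine (hK.dist_le_mul _ (by simpa using hR t h0 hT y) _
        (by simpa using hR t h0 hT z)).trans ?_
      gcongr
      exact hlip t y z)
    (fun T => by
      obtain ⟨R, hR⟩ := exists_norm_clampedArgs_le hN hP.lam_pos hθ hb hB T
      obtain ⟨C, hC⟩ := (isCompact_closedBall
        (0 : (Fin n → ℝ) × (Fin q → ℝ) × ℝ × ℝ × (Fin q → ℝ) × ℝ) R).exists_bound_of_continuousOn
        hF.continuous.continuousOn
      exact ⟨C, fun t h0 hT y => hC _ (by simpa using hR t h0 hT y)⟩)
    (fun y hy t h0 htS => by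
      have hreg : RegularTime θ b t := by
        by_contra h
        exact htS ⟨h0, h⟩
      have hv : Continuous fun t => 𝒩 (clampPos hB (y t).2.2) :=
        hN.smooth.continuousOn.comp_continuous
          ((continuous_subtype_val.comp continuous_projIcc).comp hy.snd.snd)
          fun t => (clampPos_mem hB _).1
      have hargs : ContinuousWithinAt (fun t => clampedArgs P 𝒩 θ b hB t (y t)) (Set.Ici 0) t :=
        ((continuous_clampPi hB).comp hy.fst).continuousWithinAt.prodMk
          (((continuous_clampPi hB).comp hy.snd.fst).continuousWithinAt.prodMk
          ((by fun_prop : Continuous fun t => Real.exp (P.lam * t)).continuousWithinAt.prodMk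
          (hv.continuousWithinAt.prodMk (hreg.1.prodMk hreg.2))))
      exact hF.continuous.continuousAt.comp_continuousWithinAt hargs) y₀
  exact ⟨y, hyc, hy0, fun t h0 hr => hy t h0 fun h => h.2 hr⟩

/-- Continuation argument: the clamp is set at `R' + 1`, strictly beyond the a priori bound `R'`. Up
to the first time the norm reaches `R' + 1` the clamped solution solves the original system, so its
norm is at most `R'`; by continuity that time never comes. -/
theorem exists_closedLoopSolution (hP : P.Admissible) (hN : EnhancedNussbaum 𝒩)
    (hc : IsRegressorChoice P W psiBar) (hθ : ParameterAssumption P.del θ Θ₀)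
    (hb : CoefficientAssumption b Ω) (x₀ : Fin n → ℝ) (η₀ : Fin q → ℝ) {ξ₀ : ℝ} (hξ₀ : 0 ≤ ξ₀) :
    ∃ (x : ℝ → Fin n → ℝ) (η : ℝ → Fin q → ℝ) (ξ : ℝ → ℝ),
      IsClosedLoopSolution P W psiBar 𝒩 θ b ⊤ x η ξ ∧ x 0 = x₀ ∧ η 0 = η₀ ∧ ξ 0 = ξ₀ := by
  set R₀ := ‖((x₀, η₀, ξ₀) : (Fin n → ℝ) × (Fin q → ℝ) × ℝ)‖ with hR₀
  have hx₀ : ‖x₀‖ ≤ R₀ := norm_fst_le (x₀, η₀, ξ₀)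
  have hη₀ : ‖η₀‖ ≤ R₀ := (norm_fst_le (η₀, ξ₀)).trans (norm_snd_le (x₀, η₀, ξ₀))
  have hξ₀' : ‖ξ₀‖ ≤ R₀ := (norm_snd_le (η₀, ξ₀)).trans (norm_snd_le (x₀, η₀, ξ₀))
  obtain ⟨R, hR⟩ := exists_uniform_bound hP hN hc hθ hb R₀
  set R' := max R R₀
  have hR'0 : 0 ≤ R' := le_max_of_le_right (norm_nonneg _)
  have hB : 0 ≤ R' + 1 := by linarith
  obtain ⟨y, hyc, hy0, hy⟩ := exists_clamped_solution hP hN hc hθ hb hB (x₀, η₀, ξ₀)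
  -- Monotonicity of ξ is proved for the clamped system itself: ξ ≥ 0 is needed to remove the clamp
  -- on ξ, before the solution is known to be genuine.
  have hmono : MonotoneOn (fun t => (y t).2.2) (Set.Ici 0) := by
    have htop : timeInterval ⊤ = Set.Ici 0 := by
      ext t
      simp [timeInterval]
    have := antitoneOn_timeInterval hθ.piecewise hb.piecewise (T := ⊤)
      (f := fun t => -(y t).2.2) (by fun_prop) fun t ht h0 hr =>
        ⟨_, neg_nonpos.2 (nussbaum_rate_nonneg (W := W) (psiBar := psiBar) hP
          (clampPi hB (y t).1) (clampPi hB (y t).2.1) (Real.exp (P.lam * t))),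
          (((hy t h0.le hr).hasDerivAt (Ici_mem_nhds h0)).hasFDerivAt.snd.snd.hasDerivAt.fun_neg
            ).congr_deriv (by simp [closedLoopField, clampedArgs])⟩
    rw [htop] at this
    intro r hr t ht hrt
    exact neg_le_neg_iff.1 (this hr ht hrt)
  have hξpos : ∀ t, 0 ≤ t → 0 ≤ (y t).2.2 := fun t ht => by
    have := hmono (Set.mem_Ici.2 le_rfl) ht ht
    simp only [hy0] at this
    exact hξ₀.trans this
  have hsol : ∀ T : EReal, (∀ t ∈ timeInterval T, ‖y t‖ ≤ R' + 1) →
      IsClosedLoopSolution P W psiBar 𝒩 θ b T (fun t => (y t).1) (fun t => (y t).2.1)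
        fun t => (y t).2.2 := by
    intro T hT
    have hsub : timeInterval T ⊆ Set.Ici 0 := fun t ht => ht.1
    have hd : ∀ t ∈ timeInterval T, RegularTime θ b t → HasDerivWithinAt y
        (closedLoopField P W psiBar ((y t).1, (y t).2.1, Real.exp (P.lam * t), 𝒩 (y t).2.2,
          θ t, b t)) (timeInterval T) t := by
      intro t ht hr
      have h1 := (hy t ht.1 hr).mono hsub
      have hn := hT t ht
      have hn2 := (norm_snd_le (y t)).trans hn
      rwa [clampedArgs, clampPi_of_norm_le hB ((norm_fst_le (y t)).trans hn),
        clampPi_of_norm_le hB ((norm_fst_le (y t).2).trans hn2),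
        clampPos_of_mem hB ⟨hξpos t ht.1,
          (le_abs_self _).trans ((norm_snd_le (y t).2).trans hn2)⟩] at h1
    exact {
      x_cont := by fun_prop
      η_cont := by fun_prop
      ξ_cont := by fun_prop
      x_ode := fun t ht h1 h2 => by
        simpa [closedLoopField] using (hd t ht ⟨h1, h2⟩).hasFDerivWithinAt.fst.hasDerivWithinAt
      η_ode := fun t ht h1 h2 => by
        simpa [closedLoopField] using
          (hd t ht ⟨h1, h2⟩).hasFDerivWithinAt.snd.fst.hasDerivWithinAt
      ξ_ode := fun t ht h1 h2 => by
        simpa [closedLoopField] using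
          (hd t ht ⟨h1, h2⟩).hasFDerivWithinAt.snd.snd.hasDerivWithinAt }
  have hbound : ∀ T : EReal, (∀ t ∈ timeInterval T, ‖y t‖ ≤ R' + 1) →
      ∀ t ∈ timeInterval T, ‖y t‖ ≤ R' := by
    intro T hT t ht
    obtain ⟨-, h1, h2, h3, h4⟩ := hR T _ _ _ (hsol T hT) (hξpos 0 le_rfl)
      (fun i => by
        simp only [hy0]
        exact (norm_le_pi_norm x₀ i).trans hx₀)
      (fun a => by
        simp only [hy0]
        exact (norm_le_pi_norm η₀ a).trans hη₀)
      (by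
        simp only [hy0]
        exact (le_abs_self _).trans hξ₀') t ht
    have h5 : R ≤ R' := le_max_left _ _
    refine norm_prod_le_iff.2 ⟨(pi_norm_le_iff_of_nonneg hR'0).2 fun i => (h1 i).trans h5,
      norm_prod_le_iff.2 ⟨(pi_norm_le_iff_of_nonneg hR'0).2 fun a => (h2 a).trans h5, ?_⟩⟩
    rw [Real.norm_eq_abs, abs_of_nonneg h3]
    exact h4.trans h5
  have hin : ∀ t, 0 ≤ t → ‖y t‖ ≤ R' + 1 := by
    by_contra! hcon
    obtain ⟨t₁, ht₁, hlt⟩ := hcon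
    set A := {t : ℝ | 0 ≤ t ∧ R' + 1 ≤ ‖y t‖} with hA
    have hAc : IsClosed A := isClosed_Ici.inter (isClosed_le continuous_const hyc.norm)
    have hAb : BddBelow A := ⟨0, fun t ht => ht.1⟩
    have hm : sInf A ∈ A := hAc.csInf_mem ⟨t₁, ht₁, hlt.le⟩ hAb
    set s := sInf A
    have hs0 : 0 < s := by
      refine lt_of_le_of_ne hm.1 fun h => ?_
      have h1 := hm.2
      rw [← h, hy0, ← hR₀] at h1
      have : R₀ ≤ R' := le_max_right _ _
      linarith
    have h1 : ∀ t ∈ timeInterval (s : EReal), ‖y t‖ ≤ R' := hbound s fun t ht => by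
      by_contra h
      exact absurd (csInf_le hAb (show t ∈ A from ⟨ht.1, (not_le.1 h).le⟩))
        (not_le.2 (EReal.coe_lt_coe_iff.1 ht.2))
    have h2 : ‖y s‖ ≤ R' := by
      refine le_of_tendsto (hyc.norm.continuousAt.mono_left
        (nhdsWithin_le_nhds (s := Set.Iio s))) ?_
      filter_upwards [Ioo_mem_nhdsLT hs0] with t ht
      exact h1 t ⟨ht.1.le, EReal.coe_lt_coe_iff.2 ht.2⟩
    have := hm.2
    linarith
  refine ⟨_, _, _, hsol ⊤ fun t ht => hin t ht.1, ?_, ?_, ?_⟩ <;> simp only [hy0]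

end ClosedLoop

/-! ### Exponential decay, boundedness and convergence -/

theorem euclNorm_le_sum {ι : Type} [Fintype ι] (v : ι → ℝ) : euclNorm v ≤ ∑ i, |v i| := by
  refine Real.sqrt_le_iff.2 ⟨Finset.sum_nonneg fun _ _ => abs_nonneg _, ?_⟩
  simpa only [sq_abs] using
    Finset.sum_sq_le_sq_sum_of_nonneg (s := Finset.univ) fun i _ => abs_nonneg (v i)

theorem exists_tendsto_of_antitoneOn {f : ℝ → ℝ} (hf : AntitoneOn f (Set.Ici 0)) {B : ℝ}
    (hB : ∀ t, 0 ≤ t → B ≤ f t) : ∃ l, Filter.Tendsto f Filter.atTop (𝓝 l) := by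
  have hanti : Antitone fun t => f (max 0 t) := fun s t hst =>
    hf (Set.mem_Ici.2 (le_max_left _ _)) (Set.mem_Ici.2 (le_max_left _ _))
      (max_le_max le_rfl hst)
  refine ⟨_, (tendsto_atTop_ciInf hanti ⟨B, ?_⟩).congr' ?_⟩
  · rintro _ ⟨t, rfl⟩
    exact hB _ (le_max_left _ _)
  · filter_upwards [Filter.eventually_ge_atTop 0] with t ht
    simp only [max_eq_right ht]

section Conclusions

variable {n q : ℕ} [NeZero n] {P : Setup n q} {W : RegMat n q}
  {psiBar : (Fin n → ℝ) → (Fin q → ℝ) → ℝ → (Fin n → ℝ)} {𝒩 : ℝ → ℝ}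
  {θ : ℝ → Fin q → ℝ} {Θ₀ : Set (Fin q → ℝ)} {b : ℝ → ℝ} {Ω : Set ℝ}
  {T : EReal} {x : ℝ → Fin n → ℝ} {η : ℝ → Fin q → ℝ} {ξ : ℝ → ℝ}

/-- The constants that work for one initial value form an upper set, hence a convex set, and by the
uniform bound one constant works near each initial value. A partition of unity turns these local
constants into a continuous function. -/
theorem exists_continuous_decay_constant (hP : P.Admissible) (hN : EnhancedNussbaum 𝒩)
    (hc : IsRegressorChoice P W psiBar) (hθ : ParameterAssumption P.del θ Θ₀)
    (hb : CoefficientAssumption b Ω) :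
    ∃ C : (Fin n → ℝ) × (Fin q → ℝ) × ℝ → ℝ, Continuous C ∧ (∀ p, 0 < C p) ∧
      ∀ (T : EReal) (x : ℝ → Fin n → ℝ) (η : ℝ → Fin q → ℝ) (ξ : ℝ → ℝ), 0 < T →
        IsClosedLoopSolution P W psiBar 𝒩 θ b T x η ξ → 0 ≤ ξ 0 →
        ∀ t ∈ timeInterval T,
          euclNorm (x t) ≤ C (x 0, η 0, ξ 0) * Real.exp (-(P.lam * t)) := by
  let S : (Fin n → ℝ) × (Fin q → ℝ) × ℝ → Set ℝ := fun p => {c | 0 < c ∧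
    ∀ (T : EReal) (x : ℝ → Fin n → ℝ) (η : ℝ → Fin q → ℝ) (ξ : ℝ → ℝ),
      IsClosedLoopSolution P W psiBar 𝒩 θ b T x η ξ → 0 ≤ ξ 0 → (x 0, η 0, ξ 0) = p →
      ∀ t ∈ timeInterval T, euclNorm (x t) ≤ c * Real.exp (-(P.lam * t))}
  obtain ⟨C, hC⟩ := exists_continuous_forall_mem_convex_of_local_const (t := S) (fun p => by
      have hup : IsUpperSet (S p) := fun c d hcd hc => ⟨hc.1.trans_le hcd,
        fun T x η ξ hs h0 hp t ht => (hc.2 T x η ξ hs h0 hp t ht).trans (by gcongr)⟩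
      exact hup.ordConnected.convex) (fun p => by
      obtain ⟨R, hR⟩ := exists_uniform_bound hP hN hc hθ hb (‖p‖ + 1)
      -- The factor n comes from bounding the Euclidean norm by the sum of absolute values; the
      -- summand 1 makes the constant positive.
      refine ⟨n * |R| + 1, ?_⟩
      filter_upwards [Metric.ball_mem_nhds p one_pos] with p' hp'
      refine ⟨by positivity, fun T x η ξ hs h0 hp t ht => ?_⟩
      have hn : ‖((x 0, η 0, ξ 0) : (Fin n → ℝ) × (Fin q → ℝ) × ℝ)‖ ≤ ‖p‖ + 1 := by
        rw [hp]
        have h1 := norm_le_norm_add_norm_sub' p' p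
        have h2 : ‖p' - p‖ < 1 := by rwa [← dist_eq_norm]
        linarith
      have hn2 := (norm_snd_le ((x 0, η 0, ξ 0) : (Fin n → ℝ) × (Fin q → ℝ) × ℝ)).trans hn
      have hbd := (hR T x η ξ hs h0
        (fun i => (norm_le_pi_norm (x 0) i).trans ((norm_fst_le _).trans hn))
        (fun a => (norm_le_pi_norm (η 0) a).trans ((norm_fst_le _).trans hn2))
        ((le_abs_self _).trans ((norm_snd_le _).trans hn2)) t ht).1
      have hx : ∀ i, |x t i| ≤ |R| * Real.exp (-(P.lam * t)) := fun i => by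
        have h1 := hbd i
        rw [abs_mul, Real.abs_exp] at h1
        rw [Real.exp_neg, ← div_eq_mul_inv, le_div_iff₀ (Real.exp_pos _), mul_comm]
        exact h1.trans (le_abs_self R)
      calc euclNorm (x t) ≤ ∑ i, |x t i| := euclNorm_le_sum _
        _ ≤ ∑ _i : Fin n, |R| * Real.exp (-(P.lam * t)) := Finset.sum_le_sum fun i _ => hx i
        _ = n * |R| * Real.exp (-(P.lam * t)) := by simp [mul_assoc]
        _ ≤ _ := by
          gcongr
          linarith)
  exact ⟨C, C.continuous, fun p => (hC p).1, fun T x η ξ _ hs h0 =>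
    (hC (x 0, η 0, ξ 0)).2 T x η ξ hs h0 rfl⟩

theorem IsClosedLoopSolution.exists_boundedTrajectory (hP : P.Admissible)
    (hN : EnhancedNussbaum 𝒩) (hc : IsRegressorChoice P W psiBar)
    (hθ : ParameterAssumption P.del θ Θ₀) (hb : CoefficientAssumption b Ω)
    (hs : IsClosedLoopSolution P W psiBar 𝒩 θ b T x η ξ) (h0 : 0 ≤ ξ 0) :
    ∃ R, BoundedTrajectory P T x η ξ R := by
  obtain ⟨R, hR⟩ := exists_uniform_bound hP hN hc hθ hb (max ‖x 0‖ (max ‖η 0‖ (ξ 0)))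
  exact ⟨R, hR T x η ξ hs h0 (fun i => (norm_le_pi_norm (x 0) i).trans (le_max_left _ _))
    (fun a => (norm_le_pi_norm (η 0) a).trans ((le_max_left _ _).trans (le_max_right _ _)))
    ((le_max_right _ _).trans (le_max_right _ _))⟩

omit [NeZero n] in
theorem BoundedTrajectory.eventually_abs_le {R : ℝ} (hR : BoundedTrajectory P T x η ξ R)
    {f : Fun3 n q} (hf : SmoothBounded f) :
    ∀ᶠ B in Filter.atTop, ∀ t ∈ timeInterval T,
      |f (x t) (η t) (Real.exp (P.lam * t))| ≤ B := by
  obtain ⟨B₀, hB₀⟩ := hf.bounded R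
  filter_upwards [Filter.eventually_ge_atTop B₀] with B hB t ht
  obtain ⟨h1, h2, h3, -, -⟩ := hR t ht
  exact (hB₀ _ _ _ h2 h3 h1).trans hB

omit [NeZero n] in
theorem BoundedTrajectory.eventually_euclNorm_le {R : ℝ} (hR : BoundedTrajectory P T x η ξ R)
    {ι : Type} [Fintype ι] {f : (Fin n → ℝ) → (Fin q → ℝ) → ℝ → ι → ℝ}
    (hf : ∀ i, SmoothBounded fun x η μ => f x η μ i) :
    ∀ᶠ B in Filter.atTop, ∀ t ∈ timeInterval T,
      euclNorm (f (x t) (η t) (Real.exp (P.lam * t))) ≤ B := by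
  choose B₀ hB₀ using fun i => (hf i).bounded R
  filter_upwards [Filter.eventually_ge_atTop (∑ i, B₀ i)] with B hB t ht
  obtain ⟨h1, h2, h3, -, -⟩ := hR t ht
  exact (euclNorm_le_sum _).trans
    ((Finset.sum_le_sum fun i _ => hB₀ i _ _ _ h2 h3 h1).trans hB)

/-- Apart from ξ, 𝒩(ξ) and u, every signal is a smooth bounded function along a bounded trajectory.
Each bound is stated for all large `B`, so that finitely many of them share a common one. -/
theorem IsClosedLoopSolution.exists_signalsBoundedBy (hP : P.Admissible)
    (hN : EnhancedNussbaum 𝒩) (hc : IsRegressorChoice P W psiBar)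
    (hθ : ParameterAssumption P.del θ Θ₀) (hb : CoefficientAssumption b Ω)
    (hs : IsClosedLoopSolution P W psiBar 𝒩 θ b T x η ξ) (h0 : 0 ≤ ξ 0) :
    ∃ B, SignalsBoundedBy P W psiBar 𝒩 T x η ξ B := by
  obtain ⟨R, hR⟩ := hs.exists_boundedTrajectory hP hN hc hθ hb h0
  have hA := stateLinear_alpha (W := W) hP hc.W_smooth
  obtain ⟨M, hM⟩ := (isCompact_Icc (a := 0) (b := R)).exists_bound_of_continuousOn
    (hN.smooth.continuousOn.mono Set.Icc_subset_Ici_self)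
  have hMξ : ∀ t ∈ timeInterval T, |𝒩 (ξ t)| ≤ M := fun t ht =>
    hM _ ⟨(hR t ht).2.2.2.1, (hR t ht).2.2.2.2⟩
  obtain ⟨U, hU⟩ := (hR.eventually_abs_le (smoothBounded_uBar hP hc)).exists
  have hreg : ∀ᶠ B in Filter.atTop, ∀ i, ∀ t ∈ timeInterval T,
      euclNorm (wReg P W i (x t) (η t) (Real.exp (P.lam * t))) ≤ B :=
    Filter.eventually_all.2 fun i => hR.eventually_euclNorm_le fun a =>
      (stateLinear_wOf hP hA i a).smoothBounded
  have htun : ∀ᶠ B in Filter.atTop, ∀ i, ∀ t ∈ timeInterval T,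
      euclNorm (tau P W i (x t) (η t) (Real.exp (P.lam * t))) ≤ B :=
    Filter.eventually_all.2 fun i => hR.eventually_euclNorm_le fun a =>
      smoothBounded_tauOf hP hA i a
  have hvir : ∀ᶠ B in Filter.atTop, ∀ i : Fin n, ∀ t ∈ timeInterval T,
      |alpha P W i (x t) (η t) (Real.exp (P.lam * t))| ≤ B :=
    Filter.eventually_all.2 fun i => hR.eventually_abs_le (hA i).smoothBounded
  have hall : ∀ᶠ B in Filter.atTop, SignalsBoundedBy P W psiBar 𝒩 T x η ξ B := by
    filter_upwards [hR.eventually_euclNorm_le (f := fun x _ _ => x) SmoothBounded.coord,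
      hR.eventually_euclNorm_le (f := fun _ η _ => η) SmoothBounded.param,
      Filter.eventually_ge_atTop R, Filter.eventually_ge_atTop M,
      Filter.eventually_ge_atTop (|M| * U), hR.eventually_abs_le (smoothBounded_uBar hP hc),
      hR.eventually_abs_le (smoothBounded_kappaGain hc),
      hR.eventually_abs_le (smoothBounded_nussbaum_rate hP hc),
      hR.eventually_euclNorm_le fun i => (stateLinear_zOf hA i).smoothBounded,
      hR.eventually_euclNorm_le (smoothBounded_sErr hP hc.W_smooth), hreg, htun, hvir,
      Filter.eventually_ge_atTop 0]
      with B h1 h2 h3 h4 h5 h6 h7 h8 h9 h10 h11 h12 h13 h14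
    exact {
      state := h1
      estimate := h2
      xi := fun t ht => by
        rw [abs_of_nonneg (hR t ht).2.2.2.1]
        exact (hR t ht).2.2.2.2.trans h3
      nussbaum := fun t ht => (hMξ t ht).trans h4
      control := fun t ht => by
        rw [abs_mul]
        exact (mul_le_mul ((hMξ t ht).trans (le_abs_self M)) (hU t ht) (abs_nonneg _)
          (abs_nonneg _)).trans h5
      ubar := h6
      kappa := h7
      xi_rate := h8
      errors := h9
      scaled_errors := h10
      regressors := fun t ht i => h11 i t ht
      tuning := fun t ht i => h12 i t ht
      virtual := fun t ht m => by
        rcases Nat.lt_or_ge m n with hm | hm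
        · exact h13 ⟨m, hm⟩ t ht
        · rw [alpha_of_ge P W hm, abs_zero]
          exact h14 }
  exact hall.exists

/-- The identity μw_j = W_jᵀ(s_1, …, s_j) makes the tuning function quadratic in s, with bounded
coefficients. -/
theorem exists_adaptation_rate_bound (hc : IsRegressorChoice P W psiBar) {R : ℝ}
    (hR : BoundedTrajectory P T x η ξ R) (a : Fin q) :
    ∃ C, 0 ≤ C ∧ ∀ t ∈ timeInterval T,
      |(P.Gam *ᵥ tau P W (lastIdx n) (x t) (η t) (Real.exp (P.lam * t))) a| ≤
        C * ∑ i, sErr P W (x t) (η t) (Real.exp (P.lam * t)) i ^ 2 := by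
  have hW : ∀ (j : Fin n) (i : Fin (j.val + 1)) (c : Fin q), ∃ B, ∀ t ∈ timeInterval T,
      |W j (trunc j (x t)) (η t) (Real.exp (P.lam * t)) i c| ≤ B := fun j i c =>
    (hR.eventually_abs_le ((hc.W_smooth j i c).comp_linear (truncCLM j))).exists
  choose B hB using hW
  refine ⟨∑ c, |P.Gam a c| * ∑ j, ∑ i, |B j i c|, by positivity, fun t ht => ?_⟩
  set μ := Real.exp (P.lam * t) with hμ
  set s := sErr P W (x t) (η t) μ with hs
  set Q := ∑ i, s i ^ 2 with hQ
  have hsQ : ∀ i j, |s i| * |s j| ≤ Q := by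
    have h1 : ∀ i, s i ^ 2 ≤ Q := fun i =>
      Finset.single_le_sum (f := fun i => s i ^ 2) (fun _ _ => sq_nonneg _) (Finset.mem_univ i)
    intro i j
    have h2 := two_mul_le_add_sq |s i| |s j|
    rw [sq_abs, sq_abs] at h2
    linarith [h1 i, h1 j]
  have hw : ∀ j c, μ * wReg P W j (x t) (η t) μ c =
      ∑ i, W j (trunc j (x t)) (η t) μ i c * trunc j s i := by
    intro j c
    rw [hc.W_eq j (x t) (η t) μ (Real.exp_pos _)]
    simp only [Matrix.mulVec, dotProduct, Matrix.transpose_apply, Finset.mul_sum]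
    refine Finset.sum_congr rfl fun i _ => ?_
    simp only [trunc, hs, sErr, Pi.smul_apply, smul_eq_mul]
    ring
  have hτ : ∀ c, |tau P W (lastIdx n) (x t) (η t) μ c| ≤ (∑ j, ∑ i, |B j i c|) * Q := by
    intro c
    have h1 : tau P W (lastIdx n) (x t) (η t) μ c =
        ∑ j, ∑ i, W j (trunc j (x t)) (η t) μ i c * (s j * trunc j s i) := by
      rw [tau_eq, Iic_lastIdx]
      simp only [Finset.sum_apply, Pi.smul_apply, smul_eq_mul, ← hs]
      refine Finset.sum_congr rfl fun j _ => ?_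
      rw [mul_right_comm, hw, Finset.sum_mul]
      exact Finset.sum_congr rfl fun i _ => by ring
    rw [h1, Finset.sum_mul]
    refine (Finset.abs_sum_le_sum_abs _ _).trans (Finset.sum_le_sum fun j _ => ?_)
    rw [Finset.sum_mul]
    refine (Finset.abs_sum_le_sum_abs _ _).trans (Finset.sum_le_sum fun i _ => ?_)
    rw [abs_mul, abs_mul]
    exact mul_le_mul ((hB j i c t ht).trans (le_abs_self _)) (hsQ _ _) (by positivity)
      (abs_nonneg _)
  rw [Finset.sum_mul, Matrix.mulVec, dotProduct]
  refine (Finset.abs_sum_le_sum_abs _ _).trans (Finset.sum_le_sum fun c _ => ?_)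
  rw [abs_mul, mul_assoc]
  exact mul_le_mul_of_nonneg_left (hτ c) (abs_nonneg _)

/-- A large multiple of the energy dominates the variation of θ̂: adding it to a component of θ̂
gives a nonincreasing function bounded below. The energy converges as well, so the component does.
The argument ξ is monotone and bounded. -/
theorem IsClosedLoopSolution.exists_limits (hP : P.Admissible)
    (hN : EnhancedNussbaum 𝒩) (hc : IsRegressorChoice P W psiBar)
    (hθ : ParameterAssumption P.del θ Θ₀) (hb : CoefficientAssumption b Ω)
    (hs : IsClosedLoopSolution P W psiBar 𝒩 θ b ⊤ x η ξ) (h0 : 0 ≤ ξ 0) :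
    (∃ l : Fin q → ℝ, Filter.Tendsto η Filter.atTop (𝓝 l)) ∧
      ∃ l : ℝ, Filter.Tendsto ξ Filter.atTop (𝓝 l) := by
  have htop : timeInterval ⊤ = Set.Ici 0 := by
    ext t
    simp [timeInterval]
  have hmem : ∀ t, 0 ≤ t → t ∈ timeInterval ⊤ := fun t ht => htop ▸ ht
  obtain ⟨R, hR⟩ := hs.exists_boundedTrajectory hP hN hc hθ hb h0
  obtain ⟨l, hl⟩ := hθ.radius
  obtain ⟨h, hh, hbh, -⟩ := hN.exists_majorant hb
  set E := energy P W l h x η ξ with hE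
  have hEanti := hs.antitoneOn_energy hP hc hθ hb hl hh hbh h0
  have hH : Continuous fun ζ => ∫ τ in (0 : ℝ)..ζ, (h τ + 1) :=
    continuous_iff_continuousAt.2 fun ζ =>
      ((hh.add continuous_const).integral_hasStrictDerivAt 0 ζ).hasDerivAt.continuousAt
  obtain ⟨M, hM⟩ := (isCompact_Icc (a := 0) (b := R)).exists_bound_of_continuousOn
    hH.continuousOn
  have hElow : ∀ t, 0 ≤ t → -M ≤ E t := by
    intro t ht
    obtain ⟨-, -, -, h3, h4⟩ := hR t (hmem t ht)
    have h5 := hM _ ⟨h3, h4⟩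
    rw [Real.norm_eq_abs] at h5
    have h6 := lyapunovFn_nonneg (W := W) hP l (x t) (η t) (Real.exp (P.lam * t))
    have h7 := le_abs_self (∫ τ in (0 : ℝ)..ξ t, (h τ + 1))
    simp only [hE, energy]
    linarith
  obtain ⟨e, he⟩ := exists_tendsto_of_antitoneOn (htop ▸ hEanti) hElow
  refine ⟨?_, ?_⟩
  · have hcomp : ∀ a, ∃ r, Filter.Tendsto (fun t => η t a) Filter.atTop (𝓝 r) := by
      intro a
      obtain ⟨C, hC0, hC⟩ := exists_adaptation_rate_bound hc hR a
      -- Chosen so that C|s|² ≤ D ∑ k_i s_i², which holds because each 1/k_i is at most the sum of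
      -- all of them.
      set D := C * ∑ i, 1 / P.k i with hD
      have hD0 : 0 ≤ D := mul_nonneg hC0 (Finset.sum_nonneg fun i _ =>
        (one_div_pos.2 (hP.k_pos i)).le)
      have hanti : AntitoneOn (fun t => η t a + D * E t) (timeInterval ⊤) := by
        refine antitoneOn_timeInterval hθ.piecewise hb.piecewise
          ((continuousOn_pi.1 hs.η_cont a).add
            ((hs.continuousOn_energy hP hc l hh).const_mul D)) fun t ht ht0 hr => ?_
        obtain ⟨E', hE', hd⟩ := hs.hasDerivAt_energy hP hc hθ hb hl hh hbh h0 ht ht0 hr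
        have hη := hasDerivAt_pi.1
          ((hs.η_ode t ht hr.1 hr.2).hasDerivAt (timeInterval_mem_nhds ht ht0)) a
        refine ⟨_, ?_, hη.fun_add (hd.const_mul D)⟩
        have h1 := (le_abs_self _).trans (hC t ht)
        set s := sErr P W (x t) (η t) (Real.exp (P.lam * t))
        have h2 : ∑ i, s i ^ 2 ≤ (∑ i, 1 / P.k i) * ∑ i, P.k i * s i ^ 2 := by
          rw [Finset.mul_sum]
          refine Finset.sum_le_sum fun i _ => ?_
          have h3 : 1 / P.k i ≤ ∑ i, 1 / P.k i :=
            Finset.single_le_sum (f := fun i => 1 / P.k i)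
              (fun i _ => (one_div_pos.2 (hP.k_pos i)).le) (Finset.mem_univ i)
          have h4 : 0 ≤ P.k i * s i ^ 2 := mul_nonneg (hP.k_pos i).le (sq_nonneg _)
          calc s i ^ 2 = 1 / P.k i * (P.k i * s i ^ 2) := by
                have := (hP.k_pos i).ne'
                field_simp
            _ ≤ _ := mul_le_mul_of_nonneg_right h3 h4
        have h5 := mul_le_mul_of_nonneg_left h2 hC0
        have h6 := mul_le_mul_of_nonneg_left hE' hD0
        rw [← mul_assoc, ← hD] at h5
        linarith
      obtain ⟨r, hr⟩ := exists_tendsto_of_antitoneOn (htop ▸ hanti) (B := -R + D * -M)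
        fun t ht => add_le_add (abs_le.1 ((hR t (hmem t ht)).2.2.1 a)).1
          (mul_le_mul_of_nonneg_left (hElow t ht) hD0)
      exact ⟨r - D * e, (hr.sub (he.const_mul D)).congr fun t => by ring⟩
    choose r hr using hcomp
    exact ⟨r, tendsto_pi_nhds.2 hr⟩
  · have hmono := hs.monotoneOn_ξ hP hθ hb
    rw [htop] at hmono
    obtain ⟨r, hr⟩ := exists_tendsto_of_antitoneOn hmono.neg (B := -R)
      fun t ht => neg_le_neg (hR t (hmem t ht)).2.2.2.2
    exact ⟨-r, by simpa using hr.neg⟩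

end Conclusions

/-! ### The theorem -/

theorem theorem2 {n q : ℕ} [NeZero n] (P : Setup n q) (hP : P.Admissible)
    (𝒩 : ℝ → ℝ) (hN : EnhancedNussbaum 𝒩) :
    -- the mappings `W_i`, `ψ̄` that the controller needs exist
    (∃ (W : RegMat n q) (psiBar : (Fin n → ℝ) → (Fin q → ℝ) → ℝ → (Fin n → ℝ)),
      IsRegressorChoice P W psiBar) ∧
    -- and for every choice of them the controller works
    ∀ (W : RegMat n q) (psiBar : (Fin n → ℝ) → (Fin q → ℝ) → ℝ → (Fin n → ℝ)),
      IsRegressorChoice P W psiBar →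
      ∀ (θ : ℝ → Fin q → ℝ) (Θ₀ : Set (Fin q → ℝ)) (b : ℝ → ℝ) (Ω : Set ℝ),
        ParameterAssumption P.del θ Θ₀ → CoefficientAssumption b Ω →
        -- a solution on `[0, ∞)` from every initial condition
        (∀ (x₀ : Fin n → ℝ) (η₀ : Fin q → ℝ) (ξ₀ : ℝ), 0 ≤ ξ₀ →
          ∃ (x : ℝ → Fin n → ℝ) (η : ℝ → Fin q → ℝ) (ξ : ℝ → ℝ),
            IsClosedLoopSolution P W psiBar 𝒩 θ b ⊤ x η ξ ∧
              x 0 = x₀ ∧ η 0 = η₀ ∧ ξ 0 = ξ₀) ∧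
        -- exponential decay at the rate `λ`, with a constant that depends continuously on the
        -- initial condition
        (∃ C : (Fin n → ℝ) × (Fin q → ℝ) × ℝ → ℝ, Continuous C ∧ (∀ p, 0 < C p) ∧
          ∀ (T : EReal) (x : ℝ → Fin n → ℝ) (η : ℝ → Fin q → ℝ) (ξ : ℝ → ℝ), 0 < T →
            IsClosedLoopSolution P W psiBar 𝒩 θ b T x η ξ → 0 ≤ ξ 0 →
            ∀ t ∈ timeInterval T,
              euclNorm (x t) ≤ C (x 0, η 0, ξ 0) * Real.exp (-(P.lam * t))) ∧
        -- boundedness of all signals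
        (∀ (T : EReal) (x : ℝ → Fin n → ℝ) (η : ℝ → Fin q → ℝ) (ξ : ℝ → ℝ), 0 < T →
          IsClosedLoopSolution P W psiBar 𝒩 θ b T x η ξ → 0 ≤ ξ 0 →
          ∃ B : ℝ, SignalsBoundedBy P W psiBar 𝒩 T x η ξ B) ∧
        -- convergence of the parameter estimate and of the Nussbaum gain's argument
        (∀ (x : ℝ → Fin n → ℝ) (η : ℝ → Fin q → ℝ) (ξ : ℝ → ℝ),
          IsClosedLoopSolution P W psiBar 𝒩 θ b ⊤ x η ξ → 0 ≤ ξ 0 →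
          (∃ l : Fin q → ℝ, Filter.Tendsto η Filter.atTop (𝓝 l)) ∧
          ∃ l : ℝ, Filter.Tendsto ξ Filter.atTop (𝓝 l)) := by
  refine ⟨exists_isRegressorChoice hP, fun W psiBar hc θ Θ₀ b Ω hθ hb => ⟨?_, ?_, ?_, ?_⟩⟩
  · exact fun x₀ η₀ ξ₀ h0 => exists_closedLoopSolution hP hN hc hθ hb x₀ η₀ h0
  · exact exists_continuous_decay_constant hP hN hc hθ hb
  · exact fun T x η ξ _ hs h0 => hs.exists_signalsBoundedBy hP hN hc hθ hb h0
  · exact fun x η ξ hs h0 => hs.exists_limits hP hN hc hθ hb h0
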